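/- Let $K$ be a compact connected Lie group whose Lie algebra $\mathfrak k$ is simple, and let $V$ be a finite-dimensional irreducible complex representation of $K$ with a $K$-invariant Hermitian product. Let $\mathfrak t\subset\mathfrak k$ be the Lie algebra of a maximal torus, $\Delta$ the root system of $\mathfrak g=\mathfrak k\otimes\mathbb C$ with respect to $\mathfrak h=\mathfrak t\otimes\mathbb C$, and $\Delta^+$ a system of positive roots. Let $p\in V$ be a unit highest weight vector. Let $\mathrm{II}_p:T_pM\times T_pM\to\nu_pM$ be the second fundamental form at $p$ of the orbit $M=Kp$ in the unit sphere of $V$ (with the metric given by the real part of the Hermitian product), and put \[ \|\mathrm{II}_p\|_\infty=\sup\{\|\mathrm{II}_p(u,v)\| : u,v\in T_pM,\ \|u\|=\|v\|=1\}. \] For $\alpha,\beta\in\Delta^+$ set $m_{\alpha,\beta}=\sqrt2$ if $\alpha=\beta$ or $\langle\alpha,\beta\rangle<0$, and $m_{\alpha,\beta}=1$ otherwise, and let \[ C_\Delta=\max_{\gamma\in\Delta^++\Delta^+}\ \sum_{(\alpha,\beta)\in\Delta^+\times\Delta^+,\ \alpha+\beta=\gamma}m_{\alpha,\beta}^2 .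 \] Then: (a) if $\Delta$ is of type $A_n$, then $\|\mathrm{II}_p\|_\infty\le2\sqrt3$; (b) if $\Delta$ is of type $B_n$, $C_n$ or $D_n$, then $\|\mathrm{II}_p\|_\infty\le2\sqrt6$; (c) for $\Delta$ of any type, $\|\mathrm{II}_p\|_\infty\le\sqrt{C_\Delta}$; (d) if $\Delta$ is of type $G_2$, $F_4$, $E_6$, $E_7$, $E_8$, then $C_\Delta=6$, $28$, $40$, $64$, $112$, respectively, and hence $\|\mathrm{II}_p\|_\infty\le\sqrt6$, $2\sqrt7$, $2\sqrt{10}$, $8$, $4\sqrt7$, respectively. -/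

import Mathlib

open scoped TensorProduct Manifold ContDiff ENNReal

namespace OrbitCurvature

section Complexification
variable {L : Type*} [LieRing L] [LieAlgebra ℝ L]

/-- The real part `ℂ ⊗ L → L`. -/
noncomputable def tRe : ℂ ⊗[ℝ] L →ₗ[ℝ] L := TensorProduct.lid ℝ L ∘ₗ Complex.reLm.rTensor L
/-- The imaginary part `ℂ ⊗ L → L`. -/
noncomputable def tIm : ℂ ⊗[ℝ] L →ₗ[ℝ] L := TensorProduct.lid ℝ L ∘ₗ Complex.imLm.rTensor L

theorem tRe_add_tIm (z : ℂ ⊗[ℝ] L) : (1 : ℂ) ⊗ₜ[ℝ] tRe z + Complex.I ⊗ₜ[ℝ] tIm z = z := by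
  induction z with
  | zero => simp
  | add x y hx hy =>
    rw [map_add, map_add, TensorProduct.tmul_add, TensorProduct.tmul_add]
    nth_rewrite 3 [← hx]
    nth_rewrite 3 [← hy]
    abel
  | tmul c x =>
    simp only [tRe, tIm, LinearMap.comp_apply, LinearMap.rTensor_tmul, LinearEquiv.coe_coe,
      TensorProduct.lid_tmul, TensorProduct.tmul_smul, TensorProduct.smul_tmul', ← TensorProduct.add_tmul]
    congr 1
    apply Complex.ext <;> simp

theorem tRe_lie (z : ℂ ⊗[ℝ] L) (t : L) : tRe ⁅z, (1 : ℂ) ⊗ₜ[ℝ] t⁆ = ⁅tRe z, t⁆ := by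
  induction z with
  | zero => simp
  | add x y hx hy => simp [hx, hy]
  | tmul c x => simp [tRe]

theorem tIm_lie (z : ℂ ⊗[ℝ] L) (t : L) : tIm ⁅z, (1 : ℂ) ⊗ₜ[ℝ] t⁆ = ⁅tIm z, t⁆ := by
  induction z with
  | zero => simp
  | add x y hx hy => simp [hx, hy]
  | tmul c x => simp [tIm]

/-- The complexification `𝔱^ℂ ⊆ ℂ ⊗ L` of a real Lie subalgebra `𝔱 ⊆ L`. -/
noncomputable def complexification (𝔱 : LieSubalgebra ℝ L) : LieSubalgebra ℂ (ℂ ⊗[ℝ] L) where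
  __ := 𝔱.toSubmodule.baseChange ℂ
  lie_mem' := by
    intro x y hx hy
    change x ∈ 𝔱.toSubmodule.baseChange ℂ at hx
    change y ∈ 𝔱.toSubmodule.baseChange ℂ at hy
    change ⁅x, y⁆ ∈ 𝔱.toSubmodule.baseChange ℂ
    rw [Submodule.baseChange_eq_span] at hx hy
    refine Submodule.span_induction₂ (p := fun x y _ _ => ⁅x, y⁆ ∈ 𝔱.toSubmodule.baseChange ℂ)
      ?_ (fun _ _ => by simp) (fun x _ => ?_) ?_ ?_ ?_ ?_ hx hy
    · rintro _ _ ⟨a, ha, rfl⟩ ⟨b, hb, rfl⟩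
      simpa using Submodule.tmul_mem_baseChange_of_mem (1 : ℂ) (𝔱.lie_mem ha hb)
    · rw [← lie_skew, zero_lie, neg_zero]
      exact zero_mem _
    · intro x y z _ _ _ h1 h2
      rw [add_lie]
      exact add_mem h1 h2
    · intro x y z _ _ _ h1 h2
      rw [LieRing.lie_add]
      exact add_mem h1 h2
    · intro c x y _ _ h
      rw [smul_lie]
      exact Submodule.smul_mem _ c h
    · intro c x y _ _ h
      rw [LieAlgebra.lie_smul]
      exact Submodule.smul_mem _ c h

theorem mem_complexification {𝔱 : LieSubalgebra ℝ L} {z : ℂ ⊗[ℝ] L} :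
    z ∈ complexification 𝔱 ↔ tRe z ∈ 𝔱 ∧ tIm z ∈ 𝔱 := by
  constructor
  · intro hz
    change z ∈ 𝔱.toSubmodule.baseChange ℂ at hz
    rw [Submodule.baseChange_eq_span] at hz
    induction hz using Submodule.span_induction with
    | mem x hx =>
      obtain ⟨a, ha, rfl⟩ := hx
      simpa [tRe, tIm] using ha
    | zero => simp
    | add x y _ _ hx hy => simp [add_mem, hx, hy]
    | smul c x _ hx =>
      obtain ⟨h1, h2⟩ := hx
      have e1 : tRe (c • x) = c.re • tRe x - c.im • tIm x := by
        rw [← tRe_add_tIm x]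
        simp [tRe, tIm, TensorProduct.smul_tmul', sub_eq_add_neg]
      have e2 : tIm (c • x) = c.im • tRe x + c.re • tIm x := by
        rw [← tRe_add_tIm x]
        simp [tRe, tIm, TensorProduct.smul_tmul']
      rw [e1, e2]
      exact ⟨sub_mem (𝔱.smul_mem _ h1) (𝔱.smul_mem _ h2),
        add_mem (𝔱.smul_mem _ h1) (𝔱.smul_mem _ h2)⟩
  · rintro ⟨h1, h2⟩
    change z ∈ 𝔱.toSubmodule.baseChange ℂ
    rw [← tRe_add_tIm z]
    exact add_mem (Submodule.tmul_mem_baseChange_of_mem _ h1)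
      (Submodule.tmul_mem_baseChange_of_mem _ h2)

instance complexification_isCartanSubalgebra (𝔱 : LieSubalgebra ℝ L) [𝔱.IsCartanSubalgebra] :
    (complexification 𝔱).IsCartanSubalgebra where
  nilpotent := by
    have h : LieRing.IsNilpotent (ℂ ⊗[ℝ] 𝔱) := inferInstance
    let g : ℂ ⊗[ℝ] 𝔱 →ₗ[ℂ] ℂ ⊗[ℝ] L := (𝔱.incl : 𝔱 →ₗ[ℝ] L).baseChange ℂ
    have hg : ∀ x, g x ∈ complexification 𝔱 := by
      intro x
      induction x with
      | zero => simp
      | add x y hx hy =>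
        rw [map_add]
        exact add_mem hx hy
      | tmul c x => exact Submodule.tmul_mem_baseChange_of_mem c x.2
    have hl : ∀ x y, g ⁅x, y⁆ = ⁅g x, g y⁆ := by
      intro x y
      induction x with
      | zero => simp
      | add x x' hx hx' => simp [hx, hx']
      | tmul c x =>
        induction y with
        | zero =>
          rw [map_zero, ← lie_skew, ← lie_skew (g _), zero_lie, zero_lie, neg_zero, map_zero,
            neg_zero]
        | add y y' hy hy' => rw [LieRing.lie_add, map_add, map_add, LieRing.lie_add, hy, hy']
        | tmul d y => simp [g]
    let f : ℂ ⊗[ℝ] 𝔱 →ₗ⁅ℂ⁆ complexification 𝔱 :=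
      { LinearMap.codRestrict (complexification 𝔱).toSubmodule g hg with
        map_lie' := fun {x y} => Subtype.ext (hl x y) }
    refine Function.Surjective.lieAlgebra_isNilpotent (f := f) ?_
    rintro ⟨z, hz⟩
    obtain ⟨h1, h2⟩ := mem_complexification.1 hz
    refine ⟨(1 : ℂ) ⊗ₜ ⟨_, h1⟩ + Complex.I ⊗ₜ ⟨_, h2⟩, Subtype.ext ?_⟩
    change g _ = z
    conv_rhs => rw [← tRe_add_tIm z]
    simp [g]
  self_normalizing := by
    apply le_antisymm _ (LieSubalgebra.le_normalizer _)
    intro z hz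
    rw [LieSubalgebra.mem_normalizer_iff] at hz
    have key : ∀ t ∈ 𝔱, tRe ⁅z, (1 : ℂ) ⊗ₜ[ℝ] t⁆ ∈ 𝔱 ∧ tIm ⁅z, (1 : ℂ) ⊗ₜ[ℝ] t⁆ ∈ 𝔱 := fun t ht =>
      mem_complexification.1 (hz _ (mem_complexification.2 (by simpa [tRe, tIm] using ht)))
    simp only [tRe_lie, tIm_lie] at key
    rw [mem_complexification, ← LieSubalgebra.IsCartanSubalgebra.self_normalizing (H := 𝔱),
      LieSubalgebra.mem_normalizer_iff, LieSubalgebra.mem_normalizer_iff]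
    exact ⟨fun t ht => (key t ht).1, fun t ht => (key t ht).2⟩

instance isKilling_complexified [Module.Finite ℝ L] [LieAlgebra.IsKilling ℝ L] : LieAlgebra.IsKilling ℂ (ℂ ⊗[ℝ] L) where
  killingCompl_top_eq_bot := by
    rw [eq_bot_iff]
    intro z hz
    rw [LieIdeal.mem_killingCompl] at hz
    have key : ∀ y : L, killingForm ℝ L (tRe z) y = 0 ∧ killingForm ℝ L (tIm z) y = 0 := by
      intro y
      have h := hz ((1 : ℂ) ⊗ₜ y) trivial
      rw [LieModule.traceForm_comm, LieModule.traceForm_baseChange, ← tRe_add_tIm z, map_add,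
        LinearMap.add_apply, LinearMap.BilinForm.baseChange_tmul,
        LinearMap.BilinForm.baseChange_tmul] at h
      have h1 := congrArg Complex.re h
      have h2 := congrArg Complex.im h
      exact ⟨by simpa using h1, by simpa using h2⟩
    have hk := LieAlgebra.IsKilling.ker_killingForm_eq_bot ℝ L
    have h1 : tRe z = 0 := by
      rw [← LinearMap.ker_eq_bot'.1 hk (tRe z)]
      ext y
      exact (key y).1
    have h2 : tIm z = 0 := by
      rw [← LinearMap.ker_eq_bot'.1 hk (tIm z)]
      ext y
      exact (key y).2
    rw [← tRe_add_tIm z, h1, h2]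
    simp
end Complexification

section RootData

variable {ι R M N : Type*} [Fintype ι] [CommRing R] [CharZero R] [AddCommGroup M] [Module R M]
  [AddCommGroup N] [Module R N] {P : RootPairing ι R M N}

/-- The root pairing has Cartan matrix `A` with respect to the base `b`, for some numbering of the
simple roots. -/
def HasCartanMatrix [P.IsCrystallographic] (b : P.Base) {n : ℕ} (A : Matrix (Fin n) (Fin n) ℤ) :
    Prop :=
  ∃ e : Fin n ≃ b.support, b.cartanMatrix.submatrix e e = A

open Classical in
/-- The number `m_{α,β}²`, where `m_{α,β} = √2` if `α = β` or `⟨α, β⟩ < 0`, and `m_{α,β} = 1`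
otherwise. (`⟨α, β⟩` has the sign of `⟨α, β^∨⟩`.) -/
noncomputable def mSq (P : RootPairing ι R M N) [P.IsCrystallographic] (α β : ι) : ℕ :=
  if α = β ∨ P.pairingIn ℤ α β < 0 then 2 else 1

open Classical in
/-- The set `Δ⁺ × Δ⁺` of pairs of positive roots. -/
noncomputable def posPairs (b : P.Base) : Finset (ι × ι) :=
  Finset.univ.filter fun c => b.IsPos c.1 ∧ b.IsPos c.2

open Classical in
/-- The constant `C_Δ = max_γ ∑_{α + β = γ} m_{α,β}²`; here `γ` runs over the sums of two positive
roots, and the sum is over all ordered pairs `(α, β)` of positive roots with sum `γ`. -/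
noncomputable def cDelta [P.IsCrystallographic] (b : P.Base) : ℕ :=
  ((posPairs b).image fun c => P.root c.1 + P.root c.2).sup fun γ =>
    ∑ c ∈ (posPairs b).filter (fun c => P.root c.1 + P.root c.2 = γ), mSq P c.1 c.2

end RootData

section Orbit

variable {d : ℕ} {K : Type*} [TopologicalSpace K] [ChartedSpace (EuclideanSpace ℝ (Fin d)) K]
  [Group K] {V : Type*} [NormedAddCommGroup V] [InnerProductSpace ℂ V] [FiniteDimensional ℂ V]

instance leInfty_minSmoothness : ENat.LEInfty (minSmoothness ℝ 3) := by
  rw [minSmoothness_of_isRCLikeNormedField]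
  infer_instance

instance finiteDimensional_groupLieAlgebra :
    FiniteDimensional ℝ (GroupLieAlgebra (𝓡 d) K) :=
  inferInstanceAs (FiniteDimensional ℝ (EuclideanSpace ℝ (Fin d)))

/-- The derivative at `1` of the orbit map `k ↦ ρ(k) v`, that is, the map `x ↦ x v` from the Lie
algebra `𝔨` of `K` to `V`. -/
noncomputable def infAction (ρ : Representation ℂ K V) (v : V) :
    GroupLieAlgebra (𝓡 d) K →L[ℝ] V :=
  mfderiv (𝓡 d) 𝓘(ℝ, V) (fun k => ρ k v) (1 : K)

/-- The orbit `M = K p`. -/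
def orbit (ρ : Representation ℂ K V) (p : V) : Set V := Set.range fun k => ρ k p

/-- The tangent space at `q` of the orbit through `q`, the image of the derivative of the orbit
map. -/
noncomputable def orbitTangent (d : ℕ) [ChartedSpace (EuclideanSpace ℝ (Fin d)) K]
    (ρ : Representation ℂ K V) (q : V) : Submodule ℝ V :=
  LinearMap.range (infAction (d := d) ρ q).toLinearMap

/-- The orthogonal projection of `V` onto the normal space `ν_q` at `q`, in the sphere through `q`,
of the orbit through `q`: the space of all vectors that are orthogonal to `q` and to the orbit, with
respect to the real part of the Hermitian product. -/
noncomputable def normalProj (d : ℕ) [ChartedSpace (EuclideanSpace ℝ (Fin d)) K]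
    (ρ : Representation ℂ K V) (q : V) : V →L[ℝ] V :=
  letI : InnerProductSpace ℝ V := InnerProductSpace.complexToReal
  (Submodule.span ℝ {q} ⊔ orbitTangent d ρ q)ᗮ.starProjection

/-- `Y` is a smooth vector field on `V` that is tangent to the orbit `K p` at its points. -/
structure IsTangentField (d : ℕ) [ChartedSpace (EuclideanSpace ℝ (Fin d)) K]
    (ρ : Representation ℂ K V) (p : V) (Y : V → V) : Prop where
  smooth : ContDiff ℝ ∞ Y
  tangent : ∀ q ∈ orbit ρ p, Y q ∈ orbitTangent d ρ q

/-- The value `II_p(u, Y(p)) = (D_u Y)^ν` at `p` of the second fundamental form of the orbit `K p`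
in the unit sphere of `V`, for a vector `u` and a vector field `Y` tangent to the orbit. -/
noncomputable def secondFundamentalForm (d : ℕ) [ChartedSpace (EuclideanSpace ℝ (Fin d)) K]
    (ρ : Representation ℂ K V) (p : V) (u : V) (Y : V → V) : V :=
  normalProj d ρ p (fderiv ℝ Y p u)

/-- The supremum norm `‖II_p‖_∞ = sup {‖II_p(u, v)‖ : ‖u‖ = ‖v‖ = 1}`, as an element of `[0, ∞]`. -/
noncomputable def normII (d : ℕ) [ChartedSpace (EuclideanSpace ℝ (Fin d)) K]
    (ρ : Representation ℂ K V) (p : V) : ℝ≥0∞ :=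
  ⨆ (u : V) (Y : V → V) (_ : u ∈ orbitTangent d ρ p) (_ : IsTangentField d ρ p Y)
    (_ : ‖u‖ = 1) (_ : ‖Y p‖ = 1), ‖secondFundamentalForm d ρ p u Y‖ₑ

/-- The action of `x ∈ 𝔤 = 𝔨 ⊗ ℂ` on the vector `v`, the complex linear extension of `infAction`. -/
noncomputable def complexAction (ρ : Representation ℂ K V) (v : V) :
    ℂ ⊗[ℝ] GroupLieAlgebra (𝓡 d) K →ₗ[ℂ] V :=
  LinearMap.liftBaseChange ℂ (infAction ρ v).toLinearMap

variable [LieGroup (𝓡 d) ∞ K]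

section
variable [LieAlgebra.IsSimple ℝ (GroupLieAlgebra (𝓡 d) K)]
  (𝔱 : LieSubalgebra ℝ (GroupLieAlgebra (𝓡 d) K)) [𝔱.IsCartanSubalgebra]

/-- The root system of `𝔤 = 𝔨 ⊗ ℂ` with respect to the Cartan subalgebra `𝔥 = 𝔱^ℂ`. -/
noncomputable abbrev roots :
    RootPairing (complexification 𝔱).root ℂ (Module.Dual ℂ (complexification 𝔱))
      (complexification 𝔱) :=
  LieAlgebra.IsKilling.rootSystem (complexification 𝔱)

variable {𝔱}

/-- `p` is a highest weight vector of `V` with respect to `𝔥 = 𝔱^ℂ` and the positive roots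
determined by the base `b`. -/
structure IsHighestWeightVector (ρ : Representation ℂ K V) (b : (roots 𝔱).Base) (p : V) :
    Prop where
  ne_zero : p ≠ 0
  weight : ∃ μ : Module.Dual ℂ (complexification 𝔱), ∀ h : complexification 𝔱,
    complexAction ρ p (h : ℂ ⊗[ℝ] GroupLieAlgebra (𝓡 d) K) = μ h • p
  raising : ∀ α : (complexification 𝔱).root, b.IsPos α →
    ∀ e ∈ LieAlgebra.rootSpace (complexification 𝔱) α.1, complexAction ρ p e = 0

end

end Orbit

end OrbitCurvature

/-! Differentiating ⟪Y(kp), kξ⟫ = 0 in k, for a normal vector ξ and a tangent field Y, shows that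
II_p(xp, yp) is the normal part of xyp (`secondFundamentalForm_eq`). The rest is representation
theory and the combinatorics of roots.

Choose root vectors f_α of weight -α whose adjoints e_α satisfy [e_α, f_α] = α^∨
(`exists_rootVector`). Let W be the complex span of p and all f_α p. Unless the action is trivial, W
lies in ℝp + T_pM, so the normal part of xyp is no longer than its projection Q(xyp) to the
complement of W. Since f_α p = 0 for α not positive and 𝔥 preserves W, expanding x and y in root
vectors leaves Q(xyp) = Σ c_α d_β Q(f_α f_β p) over pairs of positive roots. Terms with different α
+ β have different weights, so they are orthogonal.

The numbers m_{α,β} come from sl₂. One has ‖f_α p‖² = μ(α^∨), which is 0 or at least 1. As f_α and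
f_β commute on p modulo W, for α ≠ β the order can be chosen so that e_α f_β p = 0. Then ‖f_α f_β
p‖² = (‖f_α p‖² - ⟨β, α^∨⟩) ‖f_β p‖², and ‖Q(f_α f_β p)‖ ≤ m_{α,β} ‖f_α p‖ ‖f_β p‖ follows
(`norm_starProjection_f_f_sq_le`). With a_α = ‖c_α f_α p‖ and its analogue for d, what remains is
the inequality `IsPairBound` between families of numbers on Δ⁺. Cauchy–Schwarz on each fibre α + β =
γ proves it with the constant C_Δ.

For the classical types a better constant is needed, independent of the rank. The roots are realised
in ℤ^m as differences of vectors in a set Λ, made of unit vectors for type A and of 0, ±e_k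
otherwise. If γ is a sum of two vectors among 0, ±e_k, then α + β = γ is a path x → z → y in Λ, the
fibre sum is controlled by entries of a matrix product, and Frobenius norms bound the total
(`sum_pathSum_sq_le`). Any other γ has a bounded number of decompositions. The two contributions add
up to 2·4 + 4 = 12 for type A and 2·8 + 8 = 24 for types B, C, D.

For the exceptional types C_Δ is computed from a list of positive roots, which is certified by
closure under simple reflections and descent to simple roots. -/

namespace OrbitCurvature

/-! ### Lie brackets of vector fields as commutators of derivations -/

section Bracket
open VectorField Set Filter
variable {H : Type*} [TopologicalSpace H] {E : Type*} [NormedAddCommGroup E] [NormedSpace ℝ E]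
  {I : ModelWithCorners ℝ E H}
  {M : Type*} [TopologicalSpace M] [ChartedSpace H M] [IsManifold I 2 M]
  {F : Type*} [NormedAddCommGroup F] [NormedSpace ℝ F]

theorem fderivWithin_comp_extChartAt_symm {f : M → F} {x : M} {e : E}
    (he : e ∈ (extChartAt I x).target)
    (hf : MDifferentiableAt I 𝓘(ℝ, F) f ((extChartAt I x).symm e)) :
    fderivWithin ℝ (f ∘ (extChartAt I x).symm) (range I) e =
      (mfderiv I 𝓘(ℝ, F) f ((extChartAt I x).symm e)).comp
        (mfderivWithin 𝓘(ℝ, E) I (extChartAt I x).symm (range I) e) := by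
  have hI : IsManifold I 1 M := IsManifold.of_le (n := 2) (by norm_num)
  have h1 : MDifferentiableWithinAt 𝓘(ℝ, E) I (extChartAt I x).symm (range I) e :=
    mdifferentiableWithinAt_extChartAt_symm he
  rw [← mfderivWithin_eq_fderivWithin, mfderiv_comp_mfderivWithin e hf h1
    (I.uniqueMDiffOn _ (extChartAt_target_subset_range x he))]

theorem fderivWithin_comp_extChartAt_symm_mpullbackWithin {f : M → F} {x : M} {e : E}
    (he : e ∈ (extChartAt I x).target)
    (hf : MDifferentiableAt I 𝓘(ℝ, F) f ((extChartAt I x).symm e)) (V : Π y : M, TangentSpace I y) :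
    fderivWithin ℝ (f ∘ (extChartAt I x).symm) (range I) e
      ((mpullbackWithin 𝓘(ℝ, E) I (extChartAt I x).symm V (range I) : E → E) e) =
      (mfderiv I 𝓘(ℝ, F) f ((extChartAt I x).symm e) (V ((extChartAt I x).symm e)) : F) := by
  have hI : IsManifold I 1 M := IsManifold.of_le (n := 2) (by norm_num)
  have h := DFunLike.congr_fun (fderivWithin_comp_extChartAt_symm he hf)
    ((mpullbackWithin 𝓘(ℝ, E) I (extChartAt I x).symm V (range I) : E → E) e)
  refine h.trans ?_
  refine congrArg (mfderiv I 𝓘(ℝ, F) f ((extChartAt I x).symm e)) ?_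
  exact (isInvertible_mfderivWithin_extChartAt_symm he).self_apply_inverse _

/-- Differentiation along `[V, W]` is the commutator of the differentiations along `V` and `W`. -/
theorem mfderiv_apply_mlieBracket [CompleteSpace E]
    {f fV fW : M → F} {x : M} {V W : Π y : M, TangentSpace I y}
    (hf : ContMDiff I 𝓘(ℝ, F) 2 f)
    (hV : MDifferentiableAt I I.tangent (fun y => (V y : TangentBundle I M)) x)
    (hW : MDifferentiableAt I I.tangent (fun y => (W y : TangentBundle I M)) x)
    (hfV : MDifferentiableAt I 𝓘(ℝ, F) fV x) (hfW : MDifferentiableAt I 𝓘(ℝ, F) fW x)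
    (eV : ∀ y, mfderiv I 𝓘(ℝ, F) f y (V y) = fV y)
    (eW : ∀ y, mfderiv I 𝓘(ℝ, F) f y (W y) = fW y) :
    (id (mfderiv I 𝓘(ℝ, F) f x (mlieBracket I V W x)) : F) =
      (id (mfderiv I 𝓘(ℝ, F) fW x (V x)) : F) - (id (mfderiv I 𝓘(ℝ, F) fV x (W x)) : F) := by
  have hI : IsManifold I 1 M := IsManifold.of_le (n := 2) (by norm_num)
  have hx : extChartAt I x x ∈ (extChartAt I x).target := mem_extChartAt_target x
  have hxs : (extChartAt I x).symm (extChartAt I x x) = x := extChartAt_to_inv x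
  have hr : extChartAt I x x ∈ range I := extChartAt_target_subset_range x hx
  have hfd : ∀ y, MDifferentiableAt I 𝓘(ℝ, F) f y := fun y =>
    hf.mdifferentiableAt (by norm_num)
  -- The bracket formula in the chart differentiates this function, so the identity is needed near
  -- the base point and not only at it.
  have key : ∀ {U : Π y : M, TangentSpace I y} {fU : M → F},
      (∀ y, mfderiv I 𝓘(ℝ, F) f y (U y) = fU y) →
      (fun e => fderivWithin ℝ (f ∘ (extChartAt I x).symm) (range I) e
        ((mpullbackWithin 𝓘(ℝ, E) I (extChartAt I x).symm U (range I) : E → E) e))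
        =ᶠ[nhdsWithin (extChartAt I x x) (range I)] fU ∘ (extChartAt I x).symm := by
    intro U fU h
    filter_upwards [extChartAt_target_mem_nhdsWithin (I := I) x] with e he
    exact (fderivWithin_comp_extChartAt_symm_mpullbackWithin he (hfd _) U).trans (h _)
  have hsm : ContDiffWithinAt ℝ 2 (f ∘ (extChartAt I x).symm) (range I) (extChartAt I x x) := by
    rw [← contMDiffWithinAt_iff_contDiffWithinAt]
    refine ContMDiffAt.comp_contMDiffWithinAt (extChartAt I x x) hf.contMDiffAt ?_
    exact contMDiffWithinAt_extChartAt_symm_range x hx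
  have dU : ∀ {U : Π y : M, TangentSpace I y},
      MDifferentiableAt I I.tangent (fun y => (U y : TangentBundle I M)) x →
      DifferentiableWithinAt ℝ (mpullbackWithin 𝓘(ℝ, E) I (extChartAt I x).symm U (range I) : E → E)
        (range I) (extChartAt I x x) := by
    intro U hU
    have := MDifferentiableWithinAt.differentiableWithinAt_mpullbackWithin_vectorField
      (s := univ) (mdifferentiableWithinAt_univ.2 hU)
    rwa [preimage_univ, univ_inter] at this
  have main := fderivWithin_apply_lieBracket (𝕜 := ℝ) (n := 2) hsm
    (by rw [minSmoothness_of_isRCLikeNormedField]) I.uniqueDiffOn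
    (I.range_subset_closure_interior hr) hr (dU hW) (dU hV)
  rw [(key eW).fderivWithin_eq_of_mem hr, (key eV).fderivWithin_eq_of_mem hr] at main
  have hself : ∀ {g : M → F}, MDifferentiableAt I 𝓘(ℝ, F) g x → ∀ u : E,
      fderivWithin ℝ (g ∘ (extChartAt I x).symm) (range I) (extChartAt I x x) u =
        (id (mfderiv I 𝓘(ℝ, F) g x u) : F) := by
    intro g hg u
    exact (DFunLike.congr_fun hg.mfderiv u).symm
  have hpb : ∀ U : Π y : M, TangentSpace I y,
      (mpullbackWithin 𝓘(ℝ, E) I (extChartAt I x).symm U (range I) : E → E) (extChartAt I x x) =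
        (id (U x) : E) := by
    intro U
    have h2 : ∀ y, y = x → ((mfderivWithin 𝓘(ℝ, E) I (extChartAt I x).symm (range I)
        (extChartAt I x x)).inverse : E →L[ℝ] E) (U y) =
        (mfderivWithin 𝓘(ℝ, E) I (extChartAt I x).symm (range I)
        (extChartAt I x x)).inverse (U x) := by
      rintro y rfl; rfl
    exact (h2 _ hxs).trans (mfderivWithin_extChartAt_symm_inverse_apply (I := I) (U x))
  have e1 : (id (mlieBracket I V W x) : E) =
      lieBracketWithin ℝ (mpullbackWithin 𝓘(ℝ, E) I (extChartAt I x).symm V (range I) : E → E)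
        (mpullbackWithin 𝓘(ℝ, E) I (extChartAt I x).symm W (range I) : E → E) (range I)
          (extChartAt I x x) := by
    rw [← mlieBracketWithin_univ, mlieBracketWithin_apply, mfderiv_extChartAt_self, preimage_univ,
      univ_inter]
    exact DFunLike.congr_fun (ContinuousLinearMap.inverse_id (R := ℝ) (M := E)) _
  have m1 := (congrArg (fderivWithin ℝ (f ∘ (extChartAt I x).symm) (range I) (extChartAt I x x))
    e1).symm.trans (hself (hfd x) (id (mlieBracket I V W x) : E))
  have m2 := (congrArg (fderivWithin ℝ (fW ∘ (extChartAt I x).symm) (range I) (extChartAt I x x))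
    (hpb V)).trans (hself hfW (id (V x) : E))
  have m3 := (congrArg (fderivWithin ℝ (fV ∘ (extChartAt I x).symm) (range I) (extChartAt I x x))
    (hpb W)).trans (hself hfV (id (W x) : E))
  exact m1.symm.trans (main.trans (congrArg₂ (· - ·) m2 m3))
end Bracket

/-! ### The infinitesimal action and the second fundamental form -/

section Action
attribute [local instance] InnerProductSpace.complexToReal
variable {d : ℕ} {K : Type*} [TopologicalSpace K] [ChartedSpace (EuclideanSpace ℝ (Fin d)) K]
  [Group K] [LieGroup (𝓡 d) ∞ K]
  {V : Type*} [NormedAddCommGroup V] [InnerProductSpace ℂ V] [FiniteDimensional ℂ V]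
  {ρ : Representation ℂ K V}
  (hsmooth : ∀ v : V, ContMDiff (𝓡 d) 𝓘(ℝ, V) ∞ (fun k : K => ρ k v))
include hsmooth

theorem mdifferentiableAt_orbitMap (v : V) (k : K) :
    MDifferentiableAt (𝓡 d) 𝓘(ℝ, V) (fun k : K => ρ k v) k :=
  (hsmooth v).mdifferentiableAt (by simp)

theorem infAction_add (v w : V) (x : GroupLieAlgebra (𝓡 d) K) :
    infAction ρ (v + w) x = infAction ρ v x + infAction ρ w x := by
  have h := mfderiv_add (mdifferentiableAt_orbitMap hsmooth v 1)
    (mdifferentiableAt_orbitMap hsmooth w 1)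
  have h2 : (fun k : K => ρ k (v + w)) = (fun k => ρ k v) + fun k => ρ k w := by
    ext k; simp
  unfold infAction
  rw [h2]
  exact DFunLike.congr_fun h x

theorem infAction_clm_comp (T : V →L[ℝ] V) {v w : V}
    (h : ∀ k, ρ k w = T (ρ k v)) (x : GroupLieAlgebra (𝓡 d) K) :
    infAction ρ w x = T (infAction ρ v x) := by
  have h2 : (fun k : K => ρ k w) = T ∘ fun k => ρ k v := by
    ext k; simp [h]
  have h3 : HasMFDerivAt (𝓡 d) 𝓘(ℝ, V) (T ∘ fun k => ρ k v) (1 : K) (T.comp (infAction ρ v)) :=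
    HasMFDerivAt.comp (1 : K) T.hasMFDerivAt (mdifferentiableAt_orbitMap hsmooth v 1).hasMFDerivAt
  unfold infAction
  rw [h2]
  exact DFunLike.congr_fun h3.mfderiv x

theorem infAction_smul (c : ℂ) (v : V) (x : GroupLieAlgebra (𝓡 d) K) :
    infAction ρ (c • v) x = c • infAction ρ v x :=
  infAction_clm_comp hsmooth ((c • ContinuousLinearMap.id ℂ V).restrictScalars ℝ) (by simp) x

/-- The action of an element of the Lie algebra as an endomorphism. -/
noncomputable def infEnd (x : GroupLieAlgebra (𝓡 d) K) : V →ₗ[ℂ] V where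
  toFun v := infAction ρ v x
  map_add' v w := infAction_add hsmooth v w x
  map_smul' c v := infAction_smul hsmooth c v x

theorem mfderiv_orbitMap_mulInvariantVectorField (v : V) (x : GroupLieAlgebra (𝓡 d) K) (k : K) :
    mfderiv (𝓡 d) 𝓘(ℝ, V) (fun k : K => ρ k v) k (mulInvariantVectorField x k) =
      ρ k (infAction ρ v x) := by
  let T : V →L[ℝ] V := ((ρ k).toContinuousLinearMap).restrictScalars ℝ
  have h2 : (fun l : K => ρ l v) ∘ (fun l => k * l) = T ∘ fun l => ρ l v := by
    ext l; simp [T]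
  have h3 : HasMFDerivAt (𝓡 d) 𝓘(ℝ, V) (T ∘ fun l => ρ l v) (1 : K) (T.comp (infAction ρ v)) :=
    HasMFDerivAt.comp (1 : K) T.hasMFDerivAt (mdifferentiableAt_orbitMap hsmooth v 1).hasMFDerivAt
  have hm : MDifferentiableAt (𝓡 d) (𝓡 d) (fun l : K => k * l) 1 :=
    (contMDiff_mul_left (I := 𝓡 d) (n := ∞)).mdifferentiableAt (by simp)
  have h4 := mfderiv_comp_apply (1 : K) (g := fun l : K => ρ l v) 
    (mdifferentiableAt_orbitMap hsmooth v (k * 1)) hm x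
  rw [h2] at h4
  have h5 := DFunLike.congr_fun h3.mfderiv x
  -- The chain rule gives the derivative at `k * 1`, which equals `k` only propositionally. All
  -- tangent spaces are the model space, so the base point can be replaced.
  have h6 : ∀ l, l = k → ∀ u : EuclideanSpace ℝ (Fin d),
    (id (mfderiv (𝓡 d) 𝓘(ℝ, V) (fun k : K => ρ k v) l u) : V) = 
      (id (mfderiv (𝓡 d) 𝓘(ℝ, V) (fun k : K => ρ k v) k u) : V) := by
    rintro l rfl u; rfl
  exact (h6 (k * 1) (mul_one k) _).symm.trans (h4.symm.trans h5)

/-- Along the left-invariant field of x, the derivative of k ↦ kv is k ↦ k(xv), again an orbit map.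
Hence the commutator of two such derivations at 1 is xyv - yxv. -/
theorem infAction_lie (v : V) (x y : GroupLieAlgebra (𝓡 d) K) :
    infAction ρ v ⁅x, y⁆ =
      infAction ρ (infAction ρ v y) x - infAction ρ (infAction ρ v x) y := by
  have hM : IsManifold (𝓡 d) 2 K := IsManifold.of_le (n := ∞) ENat.LEInfty.out
  have hd : ∀ x : GroupLieAlgebra (𝓡 d) K, MDifferentiableAt (𝓡 d) (𝓡 d).tangent
      (fun y => (mulInvariantVectorField x y : TangentBundle (𝓡 d) K)) 1 := fun x =>
    mdifferentiableAt_mulInvariantVectorField x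
  have h1 : ∀ x : GroupLieAlgebra (𝓡 d) K, (id (mulInvariantVectorField x (1 : K)) :
      EuclideanSpace ℝ (Fin d)) = x := by
    intro x
    have h : ∀ f : K → K, f = id →
        (id (mfderiv (𝓡 d) (𝓡 d) f (1 : K) x) : EuclideanSpace ℝ (Fin d)) = x := by
      rintro f rfl
      exact DFunLike.congr_fun (mfderiv_id (I := 𝓡 d) (x := (1 : K))) x
    exact h _ (by ext; simp)
  have := mfderiv_apply_mlieBracket (hsmooth v |>.of_le ENat.LEInfty.out) (hd x) (hd y)
    (mdifferentiableAt_orbitMap hsmooth (infAction ρ v x) 1)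
    (mdifferentiableAt_orbitMap hsmooth (infAction ρ v y) 1)
    (mfderiv_orbitMap_mulInvariantVectorField hsmooth v x)
    (mfderiv_orbitMap_mulInvariantVectorField hsmooth v y)
  refine this.trans (congrArg₂ (· - ·) ?_ ?_)
  · exact congrArg (infAction ρ (infAction ρ v y)) (h1 x)
  · exact congrArg (infAction ρ (infAction ρ v x)) (h1 y)


/-- Since lk = k(k⁻¹lk), the element y is Ad(k⁻¹)x. Thus k carries the tangent space at v onto
vectors that include the tangent space at kv. -/
theorem infAction_rho (v : V) (k : K) (x : GroupLieAlgebra (𝓡 d) K) :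
    ∃ y : GroupLieAlgebra (𝓡 d) K, infAction ρ (ρ k v) x = ρ k (infAction ρ v y) := by
  let T : V →L[ℝ] V := ((ρ k).toContinuousLinearMap).restrictScalars ℝ
  have h2 : (fun l : K => ρ l (ρ k v)) = T ∘ (fun l => ρ l v) ∘ fun l => k⁻¹ * (l * k) := by
    ext l
    simp only [T, Function.comp_apply, ContinuousLinearMap.coe_restrictScalars',
      LinearMap.coe_toContinuousLinearMap']
    rw [← Module.End.mul_apply, ← Module.End.mul_apply, ← map_mul, ← map_mul]
    simp
  have hc : MDifferentiableAt (𝓡 d) (𝓡 d) (fun l : K => k⁻¹ * (l * k)) 1 :=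
    ((contMDiff_mul_left (I := 𝓡 d) (n := ∞) (a := k⁻¹)).comp
      (contMDiff_mul_right (I := 𝓡 d) (n := ∞) (a := k))).mdifferentiableAt (by simp)
  have e : k⁻¹ * ((1 : K) * k) = 1 := by simp
  have h3 := HasMFDerivAt.comp (1 : K) (g := fun l : K => ρ l v)
    (mdifferentiableAt_orbitMap hsmooth v (k⁻¹ * ((1 : K) * k))).hasMFDerivAt hc.hasMFDerivAt
  have h4 := HasMFDerivAt.comp (1 : K) T.hasMFDerivAt h3
  rw [← h2] at h4
  refine ⟨(id (mfderiv (𝓡 d) (𝓡 d) (fun l : K => k⁻¹ * (l * k)) 1 x) : EuclideanSpace ℝ (Fin d)), ?_⟩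
  have h6 : ∀ l, l = (1 : K) → ∀ u : EuclideanSpace ℝ (Fin d),
    (id (mfderiv (𝓡 d) 𝓘(ℝ, V) (fun k : K => ρ k v) l u) : V) =
      (id (mfderiv (𝓡 d) 𝓘(ℝ, V) (fun k : K => ρ k v) 1 u) : V) := by
    rintro l rfl u; rfl
  exact (DFunLike.congr_fun h4.mfderiv x).trans (congrArg (ρ k) (h6 _ e _))

/-- The product rule for k ↦ ⟪Y(kv), kw⟫ at k = 1. With Y the identity it yields skewness of the
action; with Y tangent and w normal it yields the second fundamental form. -/
theorem inner_fderiv_add_inner_infAction {Y : V → V} {v w : V} (hY : DifferentiableAt ℝ Y v)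
    {c : ℝ} (hc : ∀ k, inner ℝ (Y (ρ k v)) (ρ k w) = c) (x : GroupLieAlgebra (𝓡 d) K) :
    inner ℝ (Y v) (infAction ρ w x) + inner ℝ (fderiv ℝ Y v (infAction ρ v x)) w = 0 := by
  have h1 : HasMFDerivAt (𝓡 d) 𝓘(ℝ, V × V) (fun k => (ρ k v, ρ k w)) (1 : K)
      ((infAction ρ v).prod (infAction ρ w)) :=
    have hv := (mdifferentiableAt_orbitMap hsmooth v 1).hasMFDerivAt
    have hw := (mdifferentiableAt_orbitMap hsmooth w 1).hasMFDerivAt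
    ⟨hv.1.prodMk hw.1, hv.2.prodMk hw.2⟩
  have e : ((ρ (1 : K) v, ρ (1 : K) w) : V × V) = (v, w) := by simp
  have hf : HasFDerivAt (fun q : V × V => Y q.1) ((fderiv ℝ Y v).comp (ContinuousLinearMap.fst ℝ V V))
      (ρ (1 : K) v, ρ (1 : K) w) := by
    rw [e]
    exact HasFDerivAt.comp (v, w) hY.hasFDerivAt hasFDerivAt_fst
  have h2 := hf.inner ℝ (hasFDerivAt_snd (𝕜 := ℝ) (E := V) (F := V))
  have h3 := HasMFDerivAt.comp (1 : K) h2.hasMFDerivAt h1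
  have h4 : (fun q : V × V => inner ℝ (Y q.1) q.2) ∘ (fun k : K => (ρ k v, ρ k w)) = fun _ => c := by
    ext k
    exact hc k
  rw [h4] at h3
  have h5 := hasMFDerivAt_unique h3 (hasMFDerivAt_const c (1 : K))
  have h6 := DFunLike.congr_fun h5 x
  have h7 : inner ℝ (Y (ρ (1 : K) v)) (infAction ρ w x) + 
    inner ℝ (fderiv ℝ Y v (infAction ρ v x)) (ρ (1 : K) w) = 0 := h6
  simpa using h7

theorem inner_infAction_left (hunitary : ∀ (k : K) (v w : V), inner ℂ (ρ k v) (ρ k w) = inner ℂ v w)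
    (v w : V) (x : GroupLieAlgebra (𝓡 d) K) :
    inner ℂ (infAction ρ v x) w = - inner ℂ v (infAction ρ w x) := by
  have hre : ∀ v w : V, (inner ℂ (infAction ρ v x) w).re = - (inner ℂ v (infAction ρ w x)).re := by
    intro v w
    have := inner_fderiv_add_inner_infAction hsmooth (Y := id) (v := v) (w := w)
      differentiableAt_id (c := inner ℝ v w) (fun k => by
        simp only [real_inner_eq_re_inner ℂ, id]; rw [hunitary]) x
    simp only [real_inner_eq_re_inner ℂ, fderiv_id, id, ContinuousLinearMap.id_apply] at this
    change (inner ℂ v (infAction ρ w x)).re + (inner ℂ (infAction ρ v x) w).re = 0 at this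
    linarith
  apply Complex.ext
  · simpa using hre v w
  -- The real part for iw is the imaginary part for w, up to sign.
  · have := hre v (Complex.I • w)
    rw [infAction_smul hsmooth, inner_smul_right, inner_smul_right] at this
    simp at this ⊢
    linarith

/-- For normal ξ the function ⟪Y(kp), kξ⟫ vanishes, because kξ is normal at kp. Its derivative gives
⟪D_{xp}Y, ξ⟫ = -⟪yp, xξ⟫, which is ⟪xyp, ξ⟫ by skewness. -/
theorem secondFundamentalForm_eq
    (hunitary : ∀ (k : K) (v w : V), inner ℂ (ρ k v) (ρ k w) = inner ℂ v w)
    {p : V} {Y : V → V} (hY : IsTangentField d ρ p Y) (x y : GroupLieAlgebra (𝓡 d) K)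
    (hy : Y p = infAction ρ p y) :
    secondFundamentalForm d ρ p (infAction ρ p x) Y =
      normalProj d ρ p (infAction ρ (infAction ρ p y) x) := by
  unfold secondFundamentalForm normalProj
  rw [← sub_eq_zero, ← map_sub, Submodule.starProjection_apply_eq_zero_iff,
    Submodule.mem_orthogonal]
  intro ξ hξ
  rw [Submodule.mem_orthogonal] at hξ
  have hc : ∀ k, inner ℝ (Y (ρ k p)) (ρ k ξ) = 0 := by
    intro k
    obtain ⟨z, hz⟩ := hY.tangent (ρ k p) ⟨k, rfl⟩
    obtain ⟨z', hz'⟩ := infAction_rho hsmooth p k z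
    rw [← hz]
    change inner ℝ (infAction ρ (ρ k p) z) _ = 0
    rw [hz', real_inner_eq_re_inner ℂ, hunitary, ← real_inner_eq_re_inner ℂ]
    exact hξ _ (Submodule.mem_sup_right ⟨z', rfl⟩)
  have h1 := inner_fderiv_add_inner_infAction hsmooth
    (hY.smooth.differentiable (by simp)).differentiableAt hc x
  rw [hy] at h1
  have h2 := congrArg Complex.re (inner_infAction_left hsmooth hunitary (infAction ρ p y) ξ x)
  rw [inner_sub_right, real_inner_comm, real_inner_comm _ ξ]
  rw [real_inner_eq_re_inner ℂ (infAction ρ (infAction ρ p y) x) ξ]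
  rw [real_inner_eq_re_inner ℂ (infAction ρ p y)] at h1
  simp at h1 h2 ⊢
  linarith

end Action

/-! ### Trace arguments for operators and their adjoints -/

section Trace
variable {V : Type*} [NormedAddCommGroup V] [InnerProductSpace ℂ V] [FiniteDimensional ℂ V]

theorem conj_trace_eq_trace_adjoint (A : V →ₗ[ℂ] V) :
    (starRingEnd ℂ) (LinearMap.trace ℂ V A) = LinearMap.trace ℂ V (LinearMap.adjoint A) := by
  rw [LinearMap.trace_eq_sum_inner A (stdOrthonormalBasis ℂ V),
    LinearMap.trace_eq_sum_inner _ (stdOrthonormalBasis ℂ V), map_sum]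
  refine Finset.sum_congr rfl fun i _ => ?_
  rw [LinearMap.adjoint_inner_right, inner_conj_symm]

theorem trace_adjoint_mul_self (A : V →ₗ[ℂ] V) :
    ∃ r : ℝ, 0 ≤ r ∧ (A ≠ 0 → 0 < r) ∧ LinearMap.trace ℂ V (LinearMap.adjoint A * A) = r := by
  set b := stdOrthonormalBasis ℂ V
  refine ⟨∑ i, ‖A (b i)‖ ^ 2, by positivity, fun hA => ?_, ?_⟩
  · by_contra h
    have h0 : ∑ i, ‖A (b i)‖ ^ 2 = 0 := le_antisymm (not_lt.1 h) (by positivity)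
    rw [Finset.sum_eq_zero_iff_of_nonneg (fun i _ => by positivity)] at h0
    apply hA
    apply b.toBasis.ext
    intro i
    simpa using h0 i (Finset.mem_univ i)
  · rw [LinearMap.trace_eq_sum_inner _ b]
    push_cast
    refine Finset.sum_congr rfl fun i _ => ?_
    rw [Module.End.mul_apply, LinearMap.adjoint_inner_right, inner_self_eq_norm_sq_to_K]
    rfl

/-- Eigenvalues of `ad T` are imaginary for skew-Hermitian `T`. -/
theorem conj_eq_neg_of_commutator_eq_smul {T E : V →ₗ[ℂ] V} (hT : LinearMap.adjoint T = -T)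
    (hE : E ≠ 0) {a : ℂ} (h : T * E - E * T = a • E) : (starRingEnd ℂ) a = -a := by
  obtain ⟨r, -, hr, htr⟩ := trace_adjoint_mul_self E
  have hr := hr hE
  have hmul : ∀ A B : V →ₗ[ℂ] V, LinearMap.adjoint (A * B) = LinearMap.adjoint B * LinearMap.adjoint A :=
    fun A B => LinearMap.adjoint_comp A B
  have h1 : LinearMap.trace ℂ V (LinearMap.adjoint E * (T * E - E * T)) = a * r := by
    rw [h, mul_smul_comm, map_smul, htr, smul_eq_mul]
  have h2 := congrArg (starRingEnd ℂ) h1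
  rw [conj_trace_eq_trace_adjoint, hmul, LinearMap.adjoint_adjoint, map_sub, hmul, hmul, hT] at h2
  have h3 : LinearMap.trace ℂ V ((LinearMap.adjoint E * -T - -T * LinearMap.adjoint E) * E) =
      - LinearMap.trace ℂ V (LinearMap.adjoint E * (T * E - E * T)) := by
    have e1 : (LinearMap.adjoint E * -T - -T * LinearMap.adjoint E) * E =
      -(LinearMap.adjoint E * T * E) + T * (LinearMap.adjoint E * E) := by noncomm_ring
    have e2 : LinearMap.adjoint E * (T * E - E * T) =
      (LinearMap.adjoint E * T * E) - (LinearMap.adjoint E * E) * T := by noncomm_ring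
    rw [e1, e2, map_add, map_sub, map_neg, LinearMap.trace_mul_comm ℂ T]
    ring
  rw [h3, h1, map_mul, Complex.conj_ofReal] at h2
  have : (r : ℂ) ≠ 0 := by exact_mod_cast hr.ne'
  exact mul_right_cancel₀ this (by rw [← h2]; ring)

theorem inner_eq_zero_of_skew {T : V →ₗ[ℂ] V} (hT : ∀ v w, inner ℂ (T v) w = - inner ℂ v (T w))
    {v w : V} {a c : ℂ} (hv : T v = a • v) (hw : T w = c • w) (hac : a ≠ c) :
    inner ℂ v w = (0 : ℂ) := by
  by_cases h0 : v = 0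
  · simp [h0]
  have h1 := hT v v
  rw [hv, inner_smul_left, inner_smul_right] at h1
  have h2 : inner ℂ v v ≠ (0 : ℂ) := by simpa using h0
  have h3 : (starRingEnd ℂ) a = -a := mul_right_cancel₀ h2 (by rw [h1]; ring)
  have h4 := hT v w
  rw [hv, hw, inner_smul_left, inner_smul_right, h3] at h4
  have h5 : (a - c) * inner ℂ v w = 0 := by linear_combination -h4
  exact (mul_eq_zero.1 h5).resolve_left (sub_ne_zero.2 hac)

/-- If `[H, F] = -2F` and `[F^*, F] = c H`, then `c > 0`. -/
theorem exists_pos_of_commutator {H F : V →ₗ[ℂ] V} (hF : F ≠ 0) {c : ℂ}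
    (h1 : H * F - F * H = (-2 : ℂ) • F)
    (h2 : LinearMap.adjoint F * F - F * LinearMap.adjoint F = c • H) :
    ∃ r : ℝ, 0 < r ∧ c = r := by
  obtain ⟨s, -, hs, htr⟩ := trace_adjoint_mul_self F
  have hs := hs hF
  obtain ⟨q, hq, -, hqt⟩ := trace_adjoint_mul_self (c • H)
  have hmul : ∀ A B : V →ₗ[ℂ] V, LinearMap.adjoint (A * B) = LinearMap.adjoint B * LinearMap.adjoint A :=
    fun A B => LinearMap.adjoint_comp A B
  have hsa : LinearMap.adjoint (c • H) = c • H := by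
    rw [← h2, map_sub, hmul, hmul, LinearMap.adjoint_adjoint]
  rw [hsa] at hqt
  -- Replacing one factor cH by [F^*, F] turns the trace into -c tr(F^*[H, F]), and [H, F] = -2F.
  -- The left side is also tr((cH)^*(cH)) ≥ 0, so c is real and nonnegative.
  have h3 : LinearMap.trace ℂ V ((c • H) * (c • H)) = c * (2 * s) := by
    rw [smul_mul_assoc, map_smul, smul_eq_mul, ← h2, ← htr]
    congr 1
    have e : LinearMap.trace ℂ V (H * (LinearMap.adjoint F * F - F * LinearMap.adjoint F)) =
        - LinearMap.trace ℂ V (LinearMap.adjoint F * (H * F - F * H)) := by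
      have e1 : H * (LinearMap.adjoint F * F - F * LinearMap.adjoint F) =
        H * (LinearMap.adjoint F * F) - (H * F) * LinearMap.adjoint F := by noncomm_ring
      have e2 : LinearMap.adjoint F * (H * F - F * H) =
        LinearMap.adjoint F * (H * F) - (LinearMap.adjoint F * F) * H := by noncomm_ring
      rw [e1, e2, map_sub, map_sub, LinearMap.trace_mul_comm ℂ H, LinearMap.trace_mul_comm ℂ (H * F)]
      ring
    rw [e, h1, mul_smul_comm, map_smul, smul_eq_mul]
    ring
  have hs' : (2 * s : ℂ) ≠ 0 := by exact_mod_cast (by positivity : 2 * s ≠ 0)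
  have hc : c = (q / (2 * s) : ℝ) := by
    push_cast
    rw [eq_div_iff hs', ← h3, hqt]
  refine ⟨q / (2 * s), ?_, hc⟩
  have : 0 ≤ q / (2 * s) := by positivity
  refine lt_of_le_of_ne this fun h => ?_
  rw [← h] at hc
  rw [hc, Complex.ofReal_zero, zero_smul] at h2
  -- If c = 0, then F commutes with F^*, and cyclicity makes this trace zero although s > 0.
  have h4 : LinearMap.trace ℂ V (LinearMap.adjoint F * (H * F - F * H)) = -2 * s := by
    rw [h1, mul_smul_comm, map_smul, htr, smul_eq_mul]
  have e2 : LinearMap.adjoint F * (H * F - F * H) =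
      LinearMap.adjoint F * H * F - (LinearMap.adjoint F * F) * H := by noncomm_ring
  have e3 : LinearMap.trace ℂ V (LinearMap.adjoint F * H * F) =
      LinearMap.trace ℂ V ((F * LinearMap.adjoint F) * H) := by
    rw [LinearMap.trace_mul_comm, mul_assoc]
  rw [e2, map_sub, e3, sub_eq_zero.1 h2, sub_self] at h4
  exact hs' (by linear_combination h4)
end Trace

/-! ### Unitary actions of the complexification -/

section Tau
variable {L : Type*} [LieRing L] [LieAlgebra ℝ L]
  {V : Type*} [NormedAddCommGroup V] [InnerProductSpace ℂ V] [FiniteDimensional ℂ V]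

/-- The negative of the complex conjugation on `ℂ ⊗ L`. -/
noncomputable def negConj (z : ℂ ⊗[ℝ] L) : ℂ ⊗[ℝ] L :=
  -((1 : ℂ) ⊗ₜ[ℝ] tRe z) + Complex.I ⊗ₜ[ℝ] tIm z

theorem negConj_real_smul (r : ℝ) (z : ℂ ⊗[ℝ] L) :
    negConj ((r : ℂ) • z) = (r : ℂ) • negConj z := by
  have h : (r : ℂ) • z = r • z := by
    nth_rewrite 2 [← tRe_add_tIm z]
    nth_rewrite 1 [← tRe_add_tIm z]
    simp only [smul_add, TensorProduct.smul_tmul', smul_eq_mul, Complex.real_smul]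
  have h' : ∀ y : ℂ ⊗[ℝ] L, (r : ℂ) • y = r • y := by
    intro y
    nth_rewrite 2 [← tRe_add_tIm y]
    nth_rewrite 1 [← tRe_add_tIm y]
    simp only [smul_add, TensorProduct.smul_tmul', smul_eq_mul, Complex.real_smul]
  rw [h', h']
  simp only [negConj, map_smul, smul_add, smul_neg, TensorProduct.tmul_smul]

/-- A unitary representation of the complexification of a real Lie algebra. -/
structure IsUnitaryAction (π : ℂ ⊗[ℝ] L →ₗ[ℂ] (V →ₗ[ℂ] V)) : Prop where
  lie : ∀ x y, π ⁅x, y⁆ = π x * π y - π y * π x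
  skew : ∀ (x : L) (v w : V),
    inner ℂ (π ((1 : ℂ) ⊗ₜ x) v) w = - inner ℂ v (π ((1 : ℂ) ⊗ₜ x) w)

namespace IsUnitaryAction
variable {π : ℂ ⊗[ℝ] L →ₗ[ℂ] (V →ₗ[ℂ] V)} (h : IsUnitaryAction π)
include h

theorem inner_left (z : ℂ ⊗[ℝ] L) (v w : V) :
    inner ℂ (π z v) w = inner ℂ v (π (negConj z) w) := by
  have hI : ∀ x : L, Complex.I ⊗ₜ[ℝ] x = Complex.I • ((1 : ℂ) ⊗ₜ[ℝ] x) := by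
    intro x; simp [TensorProduct.smul_tmul']
  conv_lhs => rw [← tRe_add_tIm z]
  simp only [negConj, hI, map_add, map_neg, map_smul, LinearMap.add_apply, LinearMap.neg_apply,
    LinearMap.smul_apply, inner_add_left, inner_add_right, inner_neg_right, inner_smul_left,
    inner_smul_right, h.skew, Complex.conj_I]
  ring

theorem adjoint_eq (z : ℂ ⊗[ℝ] L) : LinearMap.adjoint (π z) = π (negConj z) := by
  symm
  rw [LinearMap.eq_adjoint_iff]
  intro v w
  rw [← inner_conj_symm, ← h.inner_left, inner_conj_symm]

/-- Taking adjoints changes the sign of the action of the real part and fixes that of i times the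
imaginary part. Skewness therefore makes the latter act by zero. -/
theorem exists_real_of_adjoint_eq_neg {z : ℂ ⊗[ℝ] L} (hz : LinearMap.adjoint (π z) = - π z) :
    ∃ x : L, π z = π ((1 : ℂ) ⊗ₜ x) := by
  refine ⟨tRe z, ?_⟩
  rw [h.adjoint_eq, negConj] at hz
  nth_rewrite 3 [← tRe_add_tIm z] at hz
  simp only [map_add, map_neg] at hz
  have h2 : π (Complex.I ⊗ₜ[ℝ] tIm z) = 0 := by
    have : (2 : ℂ) • π (Complex.I ⊗ₜ[ℝ] tIm z) = 0 := by
      rw [two_smul]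
      nth_rewrite 1 [← add_right_inj (-π ((1 : ℂ) ⊗ₜ[ℝ] tRe z))]
      rw [← add_assoc, hz]
      abel
    simpa using this
  conv_lhs => rw [← tRe_add_tIm z]
  rw [map_add, h2, add_zero]

/-- The kernel is stable under `negConj`, by adjoints, so it contains the real and imaginary parts
of each of its elements. -/
theorem injective (hinj : ∀ x : L, π ((1 : ℂ) ⊗ₜ x) = 0 → x = 0) : Function.Injective π := by
  rw [injective_iff_map_eq_zero]
  intro z hz
  have h1 : π (negConj z) = 0 := by rw [← h.adjoint_eq, hz, map_zero]
  have hz' := hz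
  rw [← tRe_add_tIm z, map_add] at hz'
  rw [negConj, map_add, map_neg] at h1
  have h2 : π ((1 : ℂ) ⊗ₜ[ℝ] tRe z) = 0 := by
    have : (2 : ℂ) • π ((1 : ℂ) ⊗ₜ[ℝ] tRe z) = 0 := by
      calc (2 : ℂ) • π ((1 : ℂ) ⊗ₜ[ℝ] tRe z)
          = (π ((1 : ℂ) ⊗ₜ[ℝ] tRe z) + π (Complex.I ⊗ₜ[ℝ] tIm z)) -
            (-π ((1 : ℂ) ⊗ₜ[ℝ] tRe z) + π (Complex.I ⊗ₜ[ℝ] tIm z)) := by rw [two_smul]; abel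
        _ = 0 := by rw [hz', h1, sub_zero]
    simpa using this
  have h3 : π ((1 : ℂ) ⊗ₜ[ℝ] tIm z) = 0 := by
    rw [h2, zero_add] at hz'
    have hI : Complex.I ⊗ₜ[ℝ] tIm z = Complex.I • ((1 : ℂ) ⊗ₜ[ℝ] tIm z) := by
      simp [TensorProduct.smul_tmul']
    rw [hI, map_smul] at hz'
    simpa using hz'
  rw [← tRe_add_tIm z, hinj _ h2, hinj _ h3]
  simp

end IsUnitaryAction
end Tau

/-! ### Root vectors normalised by the Hermitian product -/

theorem smul_lie_smul' {L : Type*} [LieRing L] [LieAlgebra ℂ L] (c : ℂ) (x y : L) :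
    ⁅c • x, c • y⁆ = (c * c) • ⁅x, y⁆ := by
  rw [smul_lie, LieAlgebra.lie_smul, smul_smul]

section RootVectors
open LieAlgebra LieAlgebra.IsKilling LieModule
variable {L : Type*} [LieRing L] [LieAlgebra ℝ L] [FiniteDimensional ℝ L] [LieAlgebra.IsKilling ℝ L]
  {𝔱 : LieSubalgebra ℝ L} [𝔱.IsCartanSubalgebra]
  {V : Type*} [NormedAddCommGroup V] [InnerProductSpace ℂ V] [FiniteDimensional ℂ V]
  {π : ℂ ⊗[ℝ] L →ₗ[ℂ] (V →ₗ[ℂ] V)}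

theorem one_tmul_mem_complexification {t : L} (ht : t ∈ 𝔱) :
    (1 : ℂ) ⊗ₜ[ℝ] t ∈ complexification 𝔱 :=
  Submodule.tmul_mem_baseChange_of_mem (1 : ℂ) ht

theorem exists_complexification_eq (z : complexification 𝔱) :
    ∃ (t₁ t₂ : L) (h₁ : t₁ ∈ 𝔱) (h₂ : t₂ ∈ 𝔱),
      z = ⟨_, one_tmul_mem_complexification h₁⟩ +
        Complex.I • (⟨_, one_tmul_mem_complexification h₂⟩ : complexification 𝔱) := by
  obtain ⟨h1, h2⟩ := mem_complexification.1 z.2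
  refine ⟨_, _, h1, h2, Subtype.ext ?_⟩
  conv_lhs => rw [← tRe_add_tIm z.1]
  simp [TensorProduct.smul_tmul']

theorem mem_rootSpace_of_forall {χ : Module.Dual ℂ (complexification 𝔱)} {z : ℂ ⊗[ℝ] L}
    (h : ∀ (t : L) (ht : t ∈ 𝔱), ⁅(1 : ℂ) ⊗ₜ[ℝ] t, z⁆ = χ ⟨_, one_tmul_mem_complexification ht⟩ • z) :
    z ∈ rootSpace (complexification 𝔱) χ := by
  apply LieModule.weightSpace_le_genWeightSpace
  rw [LieModule.mem_weightSpace]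
  intro x
  obtain ⟨t₁, t₂, h₁, h₂, rfl⟩ := exists_complexification_eq x
  rw [add_lie, smul_lie]
  change ⁅(1 : ℂ) ⊗ₜ[ℝ] t₁, z⁆ + Complex.I • ⁅(1 : ℂ) ⊗ₜ[ℝ] t₂, z⁆ = _
  rw [h _ h₁, h _ h₂, map_add, map_smul, add_smul, smul_eq_mul, mul_smul]

variable (h : IsUnitaryAction π) (hinj : ∀ x : L, π ((1 : ℂ) ⊗ₜ x) = 0 → x = 0)
include h hinj

/-- Roots are imaginary on 𝔱, where the action is skew. Taking the adjoint of [t, z] = -α(t)z thus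
gives weight α for the adjoint of z, and faithfulness carries this back to the Lie algebra. -/
theorem negConj_mem_rootSpace {α : Weight ℂ (complexification 𝔱) (ℂ ⊗[ℝ] L)} {z : ℂ ⊗[ℝ] L}
    (hz : z ∈ rootSpace (complexification 𝔱) (-α)) :
    negConj z ∈ rootSpace (complexification 𝔱) α := by
  have hz' : z ∈ rootSpace (complexification 𝔱) (-α : Weight ℂ (complexification 𝔱) (ℂ ⊗[ℝ] L)) := hz
  refine mem_rootSpace_of_forall (χ := α.toLinear) fun t ht => ?_
  apply h.injective hinj
  set a := α ⟨_, one_tmul_mem_complexification ht⟩ with ha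
  have h1 := congrArg π (lie_eq_smul_of_mem_rootSpace hz' ⟨_, one_tmul_mem_complexification ht⟩)
  change π ⁅(1 : ℂ) ⊗ₜ[ℝ] t, z⁆ = π (-α _ • z) at h1
  rw [h.lie, map_smul] at h1
  have hT : LinearMap.adjoint (π ((1 : ℂ) ⊗ₜ[ℝ] t)) = - π ((1 : ℂ) ⊗ₜ[ℝ] t) := by
    rw [h.adjoint_eq]
    simp [negConj, tRe, tIm]
  have h2 : π ((1 : ℂ) ⊗ₜ[ℝ] t) * π z - π z * π ((1 : ℂ) ⊗ₜ[ℝ] t) = (-a) • π z := by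
    rw [h1]
  by_cases hz0 : π z = 0
  · have : π (negConj z) = 0 := by rw [← h.adjoint_eq, hz0, map_zero]
    rw [h.lie, map_smul, this]; simp
  have h3 := conj_eq_neg_of_commutator_eq_smul hT hz0 h2
  have h4 := congrArg LinearMap.adjoint h2
  have hmul : ∀ A B : V →ₗ[ℂ] V, LinearMap.adjoint (A * B) = LinearMap.adjoint B * LinearMap.adjoint A :=
    fun A B => LinearMap.adjoint_comp A B
  rw [map_sub, hmul, hmul, hT, h.adjoint_eq, map_smulₛₗ, h3, h.adjoint_eq] at h4
  rw [h.lie, map_smul]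
  change _ = a • _
  rw [neg_neg] at h4
  rw [← h4]
  noncomm_ring

/-- Take an sl₂-triple. Root spaces are lines, so the adjoint of its lowering element is a multiple
of its raising element, and `exists_pos_of_commutator` shows that the factor is positive. Rescaling
makes it 1. -/
theorem exists_rootVector (α : (complexification 𝔱).root) :
    ∃ f ∈ rootSpace (complexification 𝔱) (-α.1), f ≠ 0 ∧
      negConj f ∈ rootSpace (complexification 𝔱) α.1 ∧
      ⁅negConj f, f⁆ = (coroot α.1 : ℂ ⊗[ℝ] L) := by
  have hα : α.1.IsNonZero := LieSubalgebra.isNonZero_coe_root α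
  obtain ⟨h₀, e₀, f₀, t, he, hf⟩ := exists_isSl2Triple_of_weight_isNonZero hα
  have hh := t.h_eq_coroot hα he hf
  have hn := negConj_mem_rootSpace h hinj hf
  obtain ⟨c, hc⟩ := (finrank_eq_one_iff_of_nonzero'
    (⟨e₀, he⟩ : rootSpace (complexification 𝔱) α.1) (by simpa using t.e_ne_zero)).1
    (finrank_rootSpace_eq_one α.1 hα) ⟨negConj f₀, hn⟩
  have hc' : negConj f₀ = c • e₀ := by simpa using (congrArg Subtype.val hc).symm
  have h1 : ⁅negConj f₀, f₀⁆ = c • h₀ := by rw [hc', ← t.lie_e_f]; exact smul_lie c e₀ f₀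
  have hF : π f₀ ≠ 0 := fun hF => t.f_ne_zero (h.injective hinj (by rw [hF, map_zero]))
  obtain ⟨r, hr, rfl⟩ := exists_pos_of_commutator (H := π h₀) hF (c := c)
    (by rw [← h.lie, t.lie_h_f_nsmul]; simp [two_smul])
    (by rw [h.adjoint_eq, ← h.lie, h1, map_smul])
  -- The scaling factor is real, so `negConj` commutes with it although it is only conjugate linear.
  have hs : ((√r)⁻¹ : ℝ) * ((√r)⁻¹ : ℝ) * r = 1 := by
    have : √r ≠ 0 := by positivity
    field_simp
    rw [Real.sq_sqrt hr.le]
  have hs' : (((√r)⁻¹ : ℝ) : ℂ) * (((√r)⁻¹ : ℝ) : ℂ) * (r : ℂ) = 1 := by exact_mod_cast hs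
  refine ⟨(((√r)⁻¹ : ℝ) : ℂ) • f₀, Submodule.smul_mem _ _ hf, ?_, ?_, ?_⟩
  · have : √r ≠ 0 := by positivity
    simpa [t.f_ne_zero] using this
  · rw [negConj_real_smul]
    exact Submodule.smul_mem _ _ hn
  · rw [negConj_real_smul, ← hh]
    refine (smul_lie_smul' _ _ _).trans ?_
    rw [h1, smul_smul, hs', one_smul]

end RootVectors

/-! ### Root space decomposition -/

section Decomposition
open LieAlgebra LieAlgebra.IsKilling LieModule
variable {L : Type*} [LieRing L] [LieAlgebra ℂ L] [FiniteDimensional ℂ L] [LieAlgebra.IsKilling ℂ L]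
  {H : LieSubalgebra ℂ L} [H.IsCartanSubalgebra]

theorem exists_eq_add_sum_rootVector {f : H.root → L} (hf : ∀ α, f α ∈ rootSpace H (-α.1))
    (hf0 : ∀ α, f α ≠ 0) (z : L) : ∃ (x : H) (c : H.root → ℂ), z = x + ∑ α, c α • f α := by
  have key : z ∈ H.toSubmodule ⊔ Submodule.span ℂ (Set.range f) := by
    have htop : z ∈ (⊤ : LieSubmodule ℂ H L).toSubmodule := trivial
    rw [← LieModule.iSup_genWeightSpace_eq_top' ℂ H L, LieSubmodule.iSup_toSubmodule] at htop
    refine (iSup_le fun χ => ?_ : _ ≤ H.toSubmodule ⊔ Submodule.span ℂ (Set.range f)) htop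
    by_cases hχ : χ.IsZero
    · refine le_trans ?_ le_sup_left
      intro y hy
      have : y ∈ rootSpace H (0 : H → ℂ) := by
        have h0 : (χ : H → ℂ) = 0 := hχ
        rwa [← h0]
      rw [LieAlgebra.rootSpace_zero_eq] at this
      exact this
    · refine le_trans ?_ le_sup_right
      intro y hy
      have hn : (-χ).IsNonZero := by simpa using hχ
      let α : H.root := ⟨-χ, by simpa using hχ⟩
      have e : (-(α.1 : H → ℂ)) = χ := by simp [α]
      have hfα := hf α
      rw [e] at hfα
      obtain ⟨c, hc⟩ := (finrank_eq_one_iff_of_nonzero'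
        (⟨f α, hfα⟩ : rootSpace H χ) (by simpa using hf0 α)).1
        (finrank_rootSpace_eq_one χ hχ) ⟨y, hy⟩
      have : y = c • f α := by simpa using (congrArg Subtype.val hc).symm
      rw [this]
      exact Submodule.smul_mem _ _ (Submodule.subset_span ⟨α, rfl⟩)
  obtain ⟨x, hx, y, hy, rfl⟩ := Submodule.mem_sup.1 key
  obtain ⟨c, rfl⟩ := (Submodule.mem_span_range_iff_exists_fun ℂ).1 hy
  exact ⟨⟨x, hx⟩, c, rfl⟩
end Decomposition

/-! ### Differences of positive roots and the numbers m_{α,β}² -/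

section Pairs
variable {ι R M N : Type*} [Fintype ι] [Field R] [CharZero R] [AddCommGroup M] [Module R M]
  [AddCommGroup N] [Module R N] {P : RootPairing ι R M N}

theorem not_isPos_of_root_eq_neg (b : P.Base) {i j : ι} (hi : b.IsPos i)
    (hij : P.root j = -P.root i) : ¬ b.IsPos j := by
  intro hj
  have : j = P.reflectionPerm i i := by
    apply P.root.injective
    rw [hij, P.root_reflectionPerm, P.reflection_apply_self]
  rw [this] at hj
  exact (RootPairing.Base.IsPos.neg_iff_not b i).1 hj hi

/-- At most one of ±(i - j) is a positive root. If neither pairing is below -1, that suffices. If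
one is at most -2, then the difference is no root at all, and the other pairing is -1. This selects
the order in which two lowering operators are applied to p. -/
theorem not_sub_isPos_or [P.IsCrystallographic] [P.IsReduced] (b : P.Base) {i j : ι} (hij : i ≠ j)
    (hi : b.IsPos i) (hj : b.IsPos j) :
    ((∀ k, P.root k = P.root j - P.root i → ¬ b.IsPos k) ∧ -1 ≤ P.pairingIn ℤ j i) ∨
    ((∀ k, P.root k = P.root i - P.root j → ¬ b.IsPos k) ∧ -1 ≤ P.pairingIn ℤ i j) := by
  have hne : P.root i ≠ P.root j := fun h => hij (P.root.injective h)
  have hne' : P.root i ≠ - P.root j := fun h => not_isPos_of_root_eq_neg b hj h hi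
  have key := P.pairingIn_pairingIn_mem_set_of_isCrystal_of_isRed' i j hne hne'
  have hpos : (∀ k, P.root k = P.root j - P.root i → ¬ b.IsPos k) ∨
      (∀ k, P.root k = P.root i - P.root j → ¬ b.IsPos k) := by
    by_contra! hcon
    obtain ⟨⟨k, hk, hkp⟩, l, hl, hlp⟩ := hcon
    exact not_isPos_of_root_eq_neg b hkp (by rw [hl, hk]; abel) hlp
  have hgen : ∀ {i j : ι}, P.root i ≠ - P.root j → P.pairingIn ℤ i j ≤ -2 →
      ∀ k, P.root k ≠ P.root j - P.root i := by
    intro i j hne' h k hk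
    -- This pairing would be at least 4, which is impossible in a reduced crystallographic system.
    have h1 : P.pairing k j = 2 - P.pairing i j := by
      rw [← P.root'_coroot_eq_pairing, ← P.root'_coroot_eq_pairing, ← P.pairing_same j,
        ← P.root'_coroot_eq_pairing]
      simp [RootPairing.root', hk]
    have h2 : P.pairingIn ℤ k j = 2 - P.pairingIn ℤ i j := by
      have := P.algebraMap_pairingIn ℤ k j
      rw [h1, ← P.algebraMap_pairingIn ℤ i j] at this
      simp only [algebraMap_int_eq, eq_intCast] at this
      exact_mod_cast this
    have h3 := P.pairingIn_pairingIn_mem_set_of_isCrystal_of_isRed k j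
    simp only [Set.mem_insert_iff, Set.mem_singleton_iff, Prod.mk.injEq] at h3
    omega
  simp only [Set.mem_insert_iff, Set.mem_singleton_iff, Prod.mk.injEq] at key
  by_cases h1 : P.pairingIn ℤ i j ≤ -2
  · exact Or.inl ⟨fun k hk => absurd hk (hgen hne' h1 k), by omega⟩
  by_cases h2 : P.pairingIn ℤ j i ≤ -2
  · exact Or.inr ⟨fun k hk => absurd hk (hgen (fun h => hne' (by rw [h, neg_neg])) h2 k), by omega⟩
  rcases hpos with h | h
  · exact Or.inl ⟨h, by omega⟩
  · exact Or.inr ⟨h, by omega⟩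

theorem mSq_comm [P.IsCrystallographic] (i j : ι) : mSq P i j = mSq P j i := by
  have h : (i = j ∨ P.pairingIn ℤ i j < 0) ↔ (j = i ∨ P.pairingIn ℤ j i < 0) := by
    rw [eq_comm, P.pairingIn_lt_zero_iff ℤ]
  unfold mSq
  split_ifs <;> simp_all

theorem one_le_mSq [P.IsCrystallographic] (i j : ι) : 1 ≤ mSq P i j := by
  unfold mSq; split_ifs <;> omega

end Pairs

/-! ### Norms of f_α p and f_α f_β p -/

section HighestWeight
open LieAlgebra LieAlgebra.IsKilling LieModule
variable {G : Type*} [LieRing G] [LieAlgebra ℂ G] [FiniteDimensional ℂ G] [LieAlgebra.IsKilling ℂ G]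
  {H : LieSubalgebra ℂ G} [H.IsCartanSubalgebra]
  {V : Type*} [NormedAddCommGroup V] [InnerProductSpace ℂ V]

/-- A representation with root vectors `f α` of weight `-α` and `e α` of weight `α` that act by
adjoint operators, and a unit highest weight vector `p` of weight `μ`. -/
structure HighestWeightData (π : G →ₗ[ℂ] (V →ₗ[ℂ] V)) (b : (rootSystem H).Base) (e f : H.root → G)
    (p : V) (μ : Module.Dual ℂ H) : Prop where
  lie : ∀ x y, π ⁅x, y⁆ = π x * π y - π y * π x
  f_mem : ∀ α, f α ∈ rootSpace H (-α.1)
  f_ne : ∀ α, f α ≠ 0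
  e_mem : ∀ α, e α ∈ rootSpace H α.1
  lie_e_f : ∀ α, ⁅e α, f α⁆ = (coroot α.1 : G)
  inner_f : ∀ α v w, inner ℂ (π (f α) v) w = inner ℂ v (π (e α) w)
  inner_eq_zero : ∀ (χ₁ χ₂ : Module.Dual ℂ H) (v w : V), χ₁ ≠ χ₂ → (∀ x : H, π x v = χ₁ x • v) →
    (∀ x : H, π x w = χ₂ x • w) → inner ℂ v w = (0 : ℂ)
  exists_adjoint : ∀ x : H, ∃ y : H, ∀ v w, inner ℂ (π x v) w = inner ℂ v (π y w)
  norm_p : ‖p‖ = 1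
  weight : ∀ x : H, π x p = μ x • p
  raising : ∀ α : H.root, b.IsPos α → ∀ z ∈ rootSpace H α.1, π z p = 0

namespace HighestWeightData
variable {π : G →ₗ[ℂ] (V →ₗ[ℂ] V)} {b : (rootSystem H).Base} {e f : H.root → G}
  {p : V} {μ : Module.Dual ℂ H} (D : HighestWeightData π b e f p μ)
include D

theorem lie_apply (x y : G) (v : V) : π x (π y v) = π y (π x v) + π ⁅x, y⁆ v := by
  rw [D.lie]; simp

theorem inner_e (α : H.root) (v w : V) : inner ℂ (π (e α) v) w = inner ℂ v (π (f α) w) := by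
  rw [← inner_conj_symm, ← D.inner_f, inner_conj_symm]

theorem weight_f (α : H.root) {v : V} {χ : Module.Dual ℂ H} (hv : ∀ x : H, π x v = χ x • v) (x : H) :
    π x (π (f α) v) = (χ - α.1.toLinear) x • π (f α) v := by
  have h1 : ⁅(x : G), f α⁆ = -(α.1 x) • f α := by
    have h2 : f α ∈ rootSpace H (-α.1 : Weight ℂ H G) := D.f_mem α
    exact lie_eq_smul_of_mem_rootSpace h2 x
  rw [D.lie_apply, hv, h1, map_smul, map_smul, LinearMap.smul_apply, ← add_smul]
  rfl

theorem apply_eq_zero_of_not_isPos {α : H.root} (hα : ¬ b.IsPos α) {z : G}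
    (hz : z ∈ rootSpace H (-α.1)) : π z p = 0 := by
  let β : H.root := (rootSystem H).reflectionPerm α α
  have hβ : b.IsPos β := (RootPairing.Base.IsPos.neg_iff_not b α).2 hα
  have h1 : (rootSystem H).root β = -(rootSystem H).root α := by
    rw [RootPairing.root_reflectionPerm, RootPairing.reflection_apply_self]
  have h2 : (β.1 : H → ℂ) = -α.1 := by
    ext x
    exact LinearMap.congr_fun h1 x
  exact D.raising β hβ z (by rwa [h2])

/-- Expand ‖f v‖² = ⟪v, e f v⟫ with e f = f e + α^∨. All later norms follow from this identity. -/
theorem norm_f_sq (α : H.root) {v : V} {c : ℂ} (hv : π (coroot α.1 : G) v = c • v) :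
    ((‖π (f α) v‖ ^ 2 : ℝ) : ℂ) = c * (‖v‖ ^ 2 : ℝ) + (‖π (e α) v‖ ^ 2 : ℝ) := by
  have h1 : ∀ w : V, ((‖w‖ ^ 2 : ℝ) : ℂ) = inner ℂ w w := fun w => by
    rw [inner_self_eq_norm_sq_to_K]; simp
  rw [h1, h1, h1, D.inner_f, D.lie_apply, D.lie_e_f, hv, inner_add_right, inner_smul_right,
    ← D.inner_e]
  ring

theorem apply_coroot_eq (α : H.root) (hα : b.IsPos α) :
    μ (coroot α.1) = (‖π (f α) p‖ ^ 2 : ℝ) := by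
  rw [D.norm_f_sq α (D.weight _), D.norm_p, D.raising α hα _ (D.e_mem α)]
  simp

theorem norm_f_f_sq (α β : H.root) (h0 : π (e α) (π (f β) p) = 0) :
    b.IsPos α → ‖π (f α) (π (f β) p)‖ ^ 2 =
      (‖π (f α) p‖ ^ 2 - (rootSystem H).pairingIn ℤ β α) * ‖π (f β) p‖ ^ 2 := by
  intro hα
  have h1 := D.norm_f_sq α (D.weight_f β D.weight (coroot α.1))
  have h2 : ((rootSystem H).pairingIn ℤ β α : ℂ) = β.1 (coroot α.1) := by
    have := (rootSystem H).algebraMap_pairingIn ℤ β α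
    simpa using this
  have h3 : (μ - β.1.toLinear) (coroot α.1) =
      ((‖π (f α) p‖ ^ 2 - (rootSystem H).pairingIn ℤ β α : ℝ) : ℂ) := by
    rw [LinearMap.sub_apply, D.apply_coroot_eq α hα]
    push_cast
    rw [h2]
    rfl
  rw [h0, h3] at h1
  simp only [norm_zero] at h1
  have h4 : ((‖π (f α) (π (f β) p)‖ ^ 2 : ℝ) : ℂ) =
    (((‖π (f α) p‖ ^ 2 - (rootSystem H).pairingIn ℤ β α) * ‖π (f β) p‖ ^ 2 : ℝ) : ℂ) := by
    rw [h1]; push_cast; ring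
  exact_mod_cast h4

/-- With a = ‖f_α p‖² one has e_α f_α p = a p, and α^∨ acts on f_α p by a - 2. So `norm_f_sq` gives
(a - 2)a + a². -/
theorem norm_f_f_self_sq (α : H.root) (hα : b.IsPos α) : ‖π (f α) (π (f α) p)‖ ^ 2 =
      2 * ‖π (f α) p‖ ^ 2 * (‖π (f α) p‖ ^ 2 - 1) := by
  have h1 := D.norm_f_sq α (D.weight_f α D.weight (coroot α.1))
  have h2 : (Weight.toLinear ℂ H G α.1) (coroot α.1) = 2 := root_apply_coroot (LieSubalgebra.isNonZero_coe_root α)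
  have h0 : π (e α) (π (f α) p) = ((‖π (f α) p‖ ^ 2 : ℝ) : ℂ) • p := by
    rw [D.lie_apply, D.raising α hα _ (D.e_mem α), map_zero, zero_add, D.lie_e_f, D.weight,
      D.apply_coroot_eq α hα]
  rw [h0, LinearMap.sub_apply, D.apply_coroot_eq α hα, h2, norm_smul, D.norm_p] at h1
  have h4 : ((‖π (f α) (π (f α) p)‖ ^ 2 : ℝ) : ℂ) =
    ((2 * ‖π (f α) p‖ ^ 2 * (‖π (f α) p‖ ^ 2 - 1) : ℝ) : ℂ) := by
    rw [h1]
    simp only [Complex.norm_real, norm_pow, norm_norm, mul_one]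
    push_cast; ring
  exact_mod_cast h4

/-- The norm 2a(a - 1) of `norm_f_f_self_sq` is nonnegative. This replaces the integrality of
μ(α^∨). -/
theorem f_apply_eq_zero_or_one_le (α : H.root) (hα : b.IsPos α) :
    π (f α) p = 0 ∨ 1 ≤ ‖π (f α) p‖ ^ 2 := by
  by_cases h : π (f α) p = 0
  · exact Or.inl h
  · right
    have h1 := D.norm_f_f_self_sq α hα
    have h2 : 0 < ‖π (f α) p‖ ^ 2 := by positivity
    by_contra h3
    have : 0 ≤ ‖π (f α) (π (f α) p)‖ ^ 2 := by positivity
    nlinarith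

/-- As e_α kills p, only [e_α, f_β] p remains. The bracket has weight α - β: either it is zero, or β
- α is a root that is not positive, and then the bracket is a raising vector. -/
theorem e_f_apply_eq_zero {α β : H.root} (hαβ : α ≠ β) (hα : b.IsPos α)
    (h : ∀ k, (rootSystem H).root k = (rootSystem H).root β - (rootSystem H).root α → ¬ b.IsPos k) :
    π (e α) (π (f β) p) = 0 := by
  rw [D.lie_apply, D.raising α hα _ (D.e_mem α), map_zero, zero_add]
  have h1 : ⁅e α, f β⁆ ∈ rootSpace H ((α.1 : H → ℂ) + (-β.1)) :=
    LieAlgebra.lie_mem_genWeightSpace_of_mem_genWeightSpace (D.e_mem α) (D.f_mem β)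
  by_cases hbot : rootSpace H ((α.1 : H → ℂ) + (-β.1)) = ⊥
  · rw [hbot] at h1
    have : ⁅e α, f β⁆ = 0 := by simpa using h1
    rw [this, map_zero, LinearMap.zero_apply]
  · let χ : Weight ℂ H G := ⟨(α.1 : H → ℂ) + (-β.1), hbot⟩
    have hχ : χ.IsNonZero := by
      intro h0
      apply hαβ
      have h0' : (α.1 : H → ℂ) + (-β.1) = 0 := h0
      apply Subtype.ext
      apply DFunLike.coe_injective
      rw [← sub_eq_add_neg] at h0'
      exact sub_eq_zero.1 h0'
    let k : H.root := ⟨-χ, by simpa using hχ⟩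
    have hk : (rootSystem H).root k = (rootSystem H).root β - (rootSystem H).root α := by
      ext x
      change -(α.1 x + -β.1 x) = β.1 x - α.1 x
      ring
    have hk' : (-(k.1 : H → ℂ)) = (α.1 : H → ℂ) + (-β.1) := by
      simp [k, χ]
    exact D.apply_eq_zero_of_not_isPos (h k hk) (by rwa [hk'])

end HighestWeightData
end HighestWeight

/-! ### Reduction to an inequality on pairs of positive roots -/

theorem norm_sum_sq_of_inner_eq_zero {V κ : Type*} [NormedAddCommGroup V] [InnerProductSpace ℂ V]
    (s : Finset κ) (v : κ → V) (h : ∀ i ∈ s, ∀ j ∈ s, i ≠ j → inner ℂ (v i) (v j) = (0 : ℂ)) :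
    ‖∑ i ∈ s, v i‖ ^ 2 = ∑ i ∈ s, ‖v i‖ ^ 2 := by
  classical
  induction s using Finset.induction_on with
  | empty => simp
  | insert a s ha ih =>
    rw [Finset.sum_insert ha, Finset.sum_insert ha, ← ih fun i hi j hj =>
      h i (Finset.mem_insert_of_mem hi) j (Finset.mem_insert_of_mem hj)]
    have h0 : inner ℂ (v a) (∑ i ∈ s, v i) = (0 : ℂ) := by
      rw [inner_sum]
      refine Finset.sum_eq_zero fun i hi => h a (Finset.mem_insert_self _ _) i
        (Finset.mem_insert_of_mem hi) ?_
      rintro rfl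
      exact ha hi
    have := norm_add_sq_eq_norm_sq_add_norm_sq_of_inner_eq_zero (𝕜 := ℂ) (v a) _ h0
    simpa only [pow_two] using this

section PairBound
variable {ι R M N : Type*} [Fintype ι] [CommRing R] [CharZero R] [AddCommGroup M] [Module R M]
  [AddCommGroup N] [Module R N] {P : RootPairing ι R M N}

open Classical in
/-- `C` bounds the sum over `γ ∈ Δ⁺ + Δ⁺` of the squares of `∑_{α + β = γ} m_{α,β} a_α c_β`, for all
nonnegative families `a`, `c` on `Δ⁺` of `ℓ²`-norm at most one. -/
def IsPairBound [P.IsCrystallographic] (b : P.Base) (C : ℝ) : Prop :=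
  ∀ a c : ι → ℝ, (∀ i, 0 ≤ a i) → (∀ i, 0 ≤ c i) →
    (∑ i with b.IsPos i, a i ^ 2 ≤ 1) → (∑ i with b.IsPos i, c i ^ 2 ≤ 1) →
    ∑ γ ∈ (posPairs b).image fun q => P.root q.1 + P.root q.2,
      (∑ q ∈ (posPairs b).filter (fun q => P.root q.1 + P.root q.2 = γ),
        √(mSq P q.1 q.2) * (a q.1 * c q.2)) ^ 2 ≤ C

end PairBound

section HighestWeight
open LieAlgebra LieAlgebra.IsKilling LieModule
variable {G : Type*} [LieRing G] [LieAlgebra ℂ G] [FiniteDimensional ℂ G] [LieAlgebra.IsKilling ℂ G]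
  {H : LieSubalgebra ℂ G} [H.IsCartanSubalgebra]
  {V : Type*} [NormedAddCommGroup V] [InnerProductSpace ℂ V] [FiniteDimensional ℂ V]

/-- The span of `p` and of all `π (f α) p`. -/
def lowerSpan (π : G →ₗ[ℂ] (V →ₗ[ℂ] V)) (f : H.root → G) (p : V) : Submodule ℂ V :=
  Submodule.span ℂ (insert p (Set.range fun α => π (f α) p))

namespace HighestWeightData
variable {π : G →ₗ[ℂ] (V →ₗ[ℂ] V)} {b : (rootSystem H).Base} {e f : H.root → G}
  {p : V} {μ : Module.Dual ℂ H} (D : HighestWeightData π b e f p μ)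

omit [FiniteDimensional ℂ V] in
theorem mem_lowerSpan (π : G →ₗ[ℂ] (V →ₗ[ℂ] V)) (f : H.root → G) (p : V) : p ∈ lowerSpan π f p :=
  Submodule.subset_span (Set.mem_insert _ _)

omit [FiniteDimensional ℂ V] in
theorem f_apply_mem_lowerSpan (π : G →ₗ[ℂ] (V →ₗ[ℂ] V)) (f : H.root → G) (p : V) (α : H.root) :
    π (f α) p ∈ lowerSpan π f p :=
  Submodule.subset_span (Set.mem_insert_of_mem _ ⟨α, rfl⟩)

include D

theorem f_apply_eq_zero {α : H.root} (hα : ¬ b.IsPos α) : π (f α) p = 0 :=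
  D.apply_eq_zero_of_not_isPos hα (D.f_mem α)

theorem apply_mem_lowerSpan (z : G) : π z p ∈ lowerSpan π f p := by
  obtain ⟨x, c, rfl⟩ := exists_eq_add_sum_rootVector D.f_mem D.f_ne z
  rw [map_add, LinearMap.add_apply, map_sum, LinearMap.sum_apply, D.weight]
  refine add_mem (Submodule.smul_mem _ _ (mem_lowerSpan _ _ _)) (sum_mem fun α _ => ?_)
  rw [map_smul, LinearMap.smul_apply]
  exact Submodule.smul_mem _ _ (f_apply_mem_lowerSpan _ _ _ α)

theorem cartan_apply_mem_lowerSpan (x : H) {w : V} (hw : w ∈ lowerSpan π f p) :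
    π x w ∈ lowerSpan π f p := by
  induction hw using Submodule.span_induction with
  | mem w hw =>
    rcases hw with rfl | ⟨α, rfl⟩
    · exact D.apply_mem_lowerSpan _
    · rw [D.weight_f α D.weight]
      exact Submodule.smul_mem _ _ (f_apply_mem_lowerSpan _ _ _ α)
  | zero => simp
  | add v w _ _ hv hw => rw [map_add]; exact add_mem hv hw
  | smul c w _ hw => rw [map_smul]; exact Submodule.smul_mem _ c hw

/-- The Cartan subalgebra preserves the span, and also its complement because its adjoints lie in it
again. So the projection commutes with it. -/
theorem weight_starProjection {S : V} {χ : Module.Dual ℂ H} (hS : ∀ x : H, π x S = χ x • S) (x : H) :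
    π x ((lowerSpan π f p)ᗮ.starProjection S) = χ x • (lowerSpan π f p)ᗮ.starProjection S := by
  set W := lowerSpan π f p
  have hperp : ∀ v ∈ Wᗮ, π x v ∈ Wᗮ := by
    intro v hv
    obtain ⟨y, hy⟩ := D.exists_adjoint x
    rw [Submodule.mem_orthogonal'] at hv ⊢
    intro w hw
    rw [hy]
    exact hv _ (D.cartan_apply_mem_lowerSpan y hw)
  have hdec := W.starProjection_add_starProjection_orthogonal S
  set A := W.starProjection S
  set B := Wᗮ.starProjection S
  have hA : A ∈ W := W.starProjection_apply_mem S
  have hB : B ∈ Wᗮ := Wᗮ.starProjection_apply_mem S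
  have h1 : π x B - χ x • B = χ x • A - π x A := by
    have := hS x
    rw [← hdec, map_add, smul_add] at this
    rw [sub_eq_sub_iff_add_eq_add, add_comm, this]
  have h2 : π x B - χ x • B ∈ W := by
    rw [h1]
    exact sub_mem (W.smul_mem _ hA) (D.cartan_apply_mem_lowerSpan x hA)
  have h3 : π x B - χ x • B ∈ Wᗮ := sub_mem (hperp B hB) (Submodule.smul_mem _ _ hB)
  exact sub_eq_zero.1 (Submodule.disjoint_def.1 W.orthogonal_disjoint _ h2 h3)

theorem starProjection_eq_zero {v : V} (hv : v ∈ lowerSpan π f p) :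
    (lowerSpan π f p)ᗮ.starProjection v = 0 := by
  rw [Submodule.starProjection_apply_eq_zero_iff, Submodule.orthogonal_orthogonal]
  exact hv

/-- The commutator [f_α, f_β] sends p into the span, which the projection kills. -/
theorem starProjection_f_f_comm (α β : H.root) :
    (lowerSpan π f p)ᗮ.starProjection (π (f α) (π (f β) p)) =
      (lowerSpan π f p)ᗮ.starProjection (π (f β) (π (f α) p)) := by
  rw [D.lie_apply, map_add, D.starProjection_eq_zero (D.apply_mem_lowerSpan _), add_zero]

theorem starProjection_f_f_eq_zero {α β : H.root} (h : ¬ (b.IsPos α ∧ b.IsPos β)) :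
    (lowerSpan π f p)ᗮ.starProjection (π (f α) (π (f β) p)) = 0 := by
  by_cases hβ : b.IsPos β
  · rw [D.starProjection_f_f_comm, D.f_apply_eq_zero fun hα => h ⟨hα, hβ⟩, map_zero, map_zero]
  · rw [D.f_apply_eq_zero hβ, map_zero, map_zero]

/-- For α ≠ β, use the order from `not_sub_isPos_or`. The norm of f_α f_β p is then governed by ‖f_α
p‖² - ⟨β, α^∨⟩. This is at most ‖f_α p‖² if the pairing is nonnegative; for pairing -1 it is ‖f_α
p‖² + 1 ≤ 2‖f_α p‖², unless f_α p = 0. In that last case the other order shows that the projection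
vanishes. -/
theorem norm_starProjection_f_f_sq_le {α β : H.root} (hα : b.IsPos α) (hβ : b.IsPos β) :
    ‖(lowerSpan π f p)ᗮ.starProjection (π (f α) (π (f β) p))‖ ^ 2 ≤
      mSq (rootSystem H) α β * (‖π (f α) p‖ ^ 2 * ‖π (f β) p‖ ^ 2) := by
  have hproj : ∀ v : V, ‖(lowerSpan π f p)ᗮ.starProjection v‖ ^ 2 ≤ ‖v‖ ^ 2 := fun v =>
    pow_le_pow_left₀ (norm_nonneg _) (Submodule.norm_starProjection_apply_le _ v) 2
  by_cases hαβ : α = β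
  · subst hαβ
    have hm : mSq (rootSystem H) α α = 2 := by simp [mSq]
    refine (hproj _).trans ?_
    rw [D.norm_f_f_self_sq α hα, hm]
    push_cast
    nlinarith [sq_nonneg ‖π (f α) p‖]
  have main : ∀ {α β : H.root}, α ≠ β → b.IsPos α → b.IsPos β →
      (∀ k, (rootSystem H).root k = (rootSystem H).root β - (rootSystem H).root α → ¬ b.IsPos k) →
      -1 ≤ (rootSystem H).pairingIn ℤ β α →
      ‖(lowerSpan π f p)ᗮ.starProjection (π (f α) (π (f β) p))‖ ^ 2 ≤
        mSq (rootSystem H) β α * (‖π (f α) p‖ ^ 2 * ‖π (f β) p‖ ^ 2) := by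
    intro α β hαβ hα hβ hk hn
    have h1 := D.norm_f_f_sq α β (D.e_f_apply_eq_zero hαβ hα hk) hα
    rcases D.f_apply_eq_zero_or_one_le α hα with h0 | h0
    · rw [D.starProjection_f_f_comm, h0]
      simp
    refine (hproj _).trans ?_
    rw [h1]
    have hB : 0 ≤ ‖π (f β) p‖ ^ 2 := by positivity
    rcases lt_or_ge ((rootSystem H).pairingIn ℤ β α) 0 with hneg | hpos
    · have hn' : (rootSystem H).pairingIn ℤ β α = -1 := by omega
      have hm : mSq (rootSystem H) β α = 2 := by simp [mSq, hn']
      rw [hn', hm]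
      push_cast
      nlinarith
    · have hm : (1 : ℝ) ≤ mSq (rootSystem H) β α := by exact_mod_cast one_le_mSq β α
      have hpos' : (0 : ℝ) ≤ (rootSystem H).pairingIn ℤ β α := by exact_mod_cast hpos
      have h2 : 0 ≤ ‖π (f α) p‖ ^ 2 * ‖π (f β) p‖ ^ 2 := by positivity
      nlinarith
  rcases not_sub_isPos_or b hαβ hα hβ with ⟨h1, h2⟩ | ⟨h1, h2⟩
  · rw [mSq_comm]
    exact main hαβ hα hβ h1 h2
  · rw [D.starProjection_f_f_comm, mul_comm (_ ^ 2)]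
    exact main (Ne.symm hαβ) hβ hα h1 h2

theorem inner_f_f_eq_zero {α β : H.root} (hαβ : α ≠ β) : inner ℂ (π (f α) p) (π (f β) p) = (0 : ℂ) := by
  refine D.inner_eq_zero _ _ _ _ ?_ (D.weight_f α D.weight) (D.weight_f β D.weight)
  intro h
  exact hαβ ((rootSystem H).root.injective (sub_right_injective h))

theorem inner_p_f_eq_zero (α : H.root) : inner ℂ p (π (f α) p) = (0 : ℂ) := by
  refine D.inner_eq_zero _ _ _ _ ?_ D.weight (D.weight_f α D.weight)
  intro h
  have : (rootSystem H).root α = 0 := by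
    have h' : μ - 0 = μ - (rootSystem H).root α := by rw [sub_zero]; exact h
    exact (sub_right_injective h').symm
  exact (rootSystem H).ne_zero α this

open Classical in
-- The vectors p and f_α p have distinct weights, so Pythagoras applies to the expansion of zp.
theorem exists_coeff (z : G) : ∃ (x : H) (c : H.root → ℂ), z = x + ∑ α, c α • f α ∧
    ∑ α with b.IsPos α, ‖c α • π (f α) p‖ ^ 2 ≤ ‖π z p‖ ^ 2 := by
  obtain ⟨x, c, hz⟩ := exists_eq_add_sum_rootVector D.f_mem D.f_ne z
  refine ⟨x, c, hz, ?_⟩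
  rw [hz, map_add, LinearMap.add_apply, map_sum, LinearMap.sum_apply, D.weight]
  simp only [map_smul, LinearMap.smul_apply]
  have h0 : inner ℂ (μ x • p) (∑ α, c α • π (f α) p) = (0 : ℂ) := by
    rw [inner_smul_left, inner_sum, Finset.sum_eq_zero, mul_zero]
    intro α _
    rw [inner_smul_right, D.inner_p_f_eq_zero, mul_zero]
  have h1 := norm_add_sq_eq_norm_sq_add_norm_sq_of_inner_eq_zero (𝕜 := ℂ) _ _ h0
  have h2 := norm_sum_sq_of_inner_eq_zero Finset.univ (fun α => c α • π (f α) p) (by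
    intro i _ j _ hij
    rw [inner_smul_left, inner_smul_right, D.inner_f_f_eq_zero hij, mul_zero, mul_zero])
  rw [pow_two, h1, ← pow_two, ← pow_two, h2]
  refine le_trans (Finset.sum_le_univ_sum_of_nonneg fun i => by positivity) ?_
  linarith [sq_nonneg ‖μ x • p‖]

open Classical in
theorem starProjection_apply_apply {z w : G} {x y : H} {c d : H.root → ℂ}
    (hz : z = x + ∑ α, c α • f α) (hw : w = y + ∑ α, d α • f α) :
    (lowerSpan π f p)ᗮ.starProjection (π z (π w p)) =
      ∑ q ∈ posPairs b, (c q.1 * d q.2) •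
        (lowerSpan π f p)ᗮ.starProjection (π (f q.1) (π (f q.2) p)) := by
  set Q := (lowerSpan π f p)ᗮ.starProjection
  have h1 : Q (π z (π w p)) = ∑ β, d β • Q (π z (π (f β) p)) := by
    rw [hw, map_add, LinearMap.add_apply, map_sum, LinearMap.sum_apply, D.weight, map_add, map_add,
      map_smul, map_smul, D.starProjection_eq_zero (D.apply_mem_lowerSpan _), smul_zero, zero_add,
      map_sum, map_sum]
    simp only [map_smul, LinearMap.smul_apply]
  have h2 : ∀ β, Q (π z (π (f β) p)) = ∑ α, c α • Q (π (f α) (π (f β) p)) := by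
    intro β
    rw [hz, map_add, LinearMap.add_apply, map_sum, LinearMap.sum_apply, map_add,
      D.starProjection_eq_zero (D.cartan_apply_mem_lowerSpan _ (f_apply_mem_lowerSpan _ _ _ β)),
      zero_add, map_sum]
    simp only [map_smul, LinearMap.smul_apply]
  rw [h1, posPairs, Finset.sum_filter_of_ne (p := fun q : H.root × H.root => b.IsPos q.1 ∧ b.IsPos q.2),
    Fintype.sum_prod_type, Finset.sum_comm]
  · refine Finset.sum_congr rfl fun β _ => ?_
    rw [h2, Finset.smul_sum]
    refine Finset.sum_congr rfl fun α _ => ?_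
    rw [smul_smul, mul_comm]
  · intro q _ hq
    by_contra hcon
    exact hq (by rw [D.starProjection_f_f_eq_zero hcon, smul_zero])

theorem norm_starProjection_sq_le {C : ℝ} (hC : IsPairBound b C) {z w : G} (hz : ‖π z p‖ ≤ 1)
    (hw : ‖π w p‖ ≤ 1) : ‖(lowerSpan π f p)ᗮ.starProjection (π z (π w p))‖ ^ 2 ≤ C := by
  classical
  obtain ⟨x, c, hzc, hc⟩ := D.exists_coeff z
  obtain ⟨y, d, hwd, hd⟩ := D.exists_coeff w
  have hz2 : ‖π z p‖ ^ 2 ≤ 1 := pow_le_one₀ (norm_nonneg _) hz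
  have hw2 : ‖π w p‖ ^ 2 ≤ 1 := pow_le_one₀ (norm_nonneg _) hw
  refine le_trans ?_ (hC (fun α => ‖c α • π (f α) p‖) (fun α => ‖d α • π (f α) p‖)
    (fun _ => norm_nonneg _) (fun _ => norm_nonneg _) (hc.trans hz2) (hd.trans hw2))
  rw [D.starProjection_apply_apply hzc hwd]
  set Q := (lowerSpan π f p)ᗮ.starProjection
  set r := (rootSystem H).root
  have hsum := Finset.sum_fiberwise_of_maps_to (s := posPairs b)
    (t := (posPairs b).image fun q => r q.1 + r q.2) (g := fun q => r q.1 + r q.2)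
    (fun q hq => Finset.mem_image_of_mem _ hq)
    (fun q => (c q.1 * d q.2) • Q (π (f q.1) (π (f q.2) p)))
  rw [← hsum, norm_sum_sq_of_inner_eq_zero]
  · refine Finset.sum_le_sum fun γ _ => ?_
    refine pow_le_pow_left₀ (norm_nonneg _) ?_ 2
    refine (norm_sum_le _ _).trans (Finset.sum_le_sum fun q hq => ?_)
    have hq' := (Finset.mem_filter.1 (Finset.mem_filter.1 hq).1).2
    have h1 := D.norm_starProjection_f_f_sq_le hq'.1 hq'.2
    have h2 := Real.sqrt_le_sqrt h1
    rw [Real.sqrt_sq (norm_nonneg _), Real.sqrt_mul (Nat.cast_nonneg _), ← mul_pow,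
      Real.sqrt_sq (by positivity)] at h2
    rw [norm_smul, norm_mul, norm_smul, norm_smul]
    calc ‖c q.1‖ * ‖d q.2‖ * ‖Q (π (f q.1) (π (f q.2) p))‖
        ≤ ‖c q.1‖ * ‖d q.2‖ * (√(mSq (rootSystem H) q.1 q.2) *
            (‖π (f q.1) p‖ * ‖π (f q.2) p‖)) := by gcongr
      _ = _ := by ring
  -- The part with α + β = γ has weight μ - γ even after projection, and distinct weights are
  -- orthogonal.
  · intro γ _ δ _ hγδ
    have hweight : ∀ γ (x : H), π x (∑ q ∈ (posPairs b).filter (fun q => r q.1 + r q.2 = γ),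
        (c q.1 * d q.2) • Q (π (f q.1) (π (f q.2) p))) = (μ - γ) x •
          ∑ q ∈ (posPairs b).filter (fun q => r q.1 + r q.2 = γ),
        (c q.1 * d q.2) • Q (π (f q.1) (π (f q.2) p)) := by
      intro γ x
      rw [map_sum, Finset.smul_sum]
      refine Finset.sum_congr rfl fun q hq => ?_
      have h1 := D.weight_starProjection
        (D.weight_f q.1 (D.weight_f q.2 D.weight)) x
      have h2 : μ - q.2.1.toLinear - q.1.1.toLinear = μ - γ := by
        rw [← (Finset.mem_filter.1 hq).2, sub_sub, add_comm]
        rfl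
      rw [map_smul, h1, h2, smul_comm]
    exact D.inner_eq_zero _ _ _ _ (fun h => hγδ (sub_right_injective h)) (hweight γ) (hweight δ)

end HighestWeightData
end HighestWeight

/-! ### Comparison of the normal space with the complement of W -/

section Unitary
open LieAlgebra LieAlgebra.IsKilling LieModule
variable {L : Type*} [LieRing L] [LieAlgebra ℝ L] [FiniteDimensional ℝ L] [LieAlgebra.IsKilling ℝ L]
  {𝔱 : LieSubalgebra ℝ L} [𝔱.IsCartanSubalgebra]
  {V : Type*} [NormedAddCommGroup V] [InnerProductSpace ℂ V] [FiniteDimensional ℂ V]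
  {π : ℂ ⊗[ℝ] L →ₗ[ℂ] (V →ₗ[ℂ] V)}

namespace IsUnitaryAction
variable (h : IsUnitaryAction π)
include h

theorem inner_eq_zero_of_weight_ne (χ₁ χ₂ : Module.Dual ℂ (complexification 𝔱)) (v w : V)
    (hne : χ₁ ≠ χ₂) (hv : ∀ x : complexification 𝔱, π x v = χ₁ x • v)
    (hw : ∀ x : complexification 𝔱, π x w = χ₂ x • w) : inner ℂ v w = (0 : ℂ) := by
  by_contra h0
  apply hne
  have key : ∀ (t : L) (ht : t ∈ 𝔱), χ₁ ⟨_, one_tmul_mem_complexification ht⟩ =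
      χ₂ ⟨_, one_tmul_mem_complexification ht⟩ := by
    intro t ht
    by_contra hcon
    exact h0 (inner_eq_zero_of_skew (h.skew t) (hv ⟨_, one_tmul_mem_complexification ht⟩)
      (hw ⟨_, one_tmul_mem_complexification ht⟩) hcon)
  ext x
  obtain ⟨t₁, t₂, h₁, h₂, rfl⟩ := exists_complexification_eq x
  rw [map_add, map_add, map_smul, map_smul, key t₁ h₁, key t₂ h₂]

theorem exists_highestWeightData (hinj : ∀ x : L, π ((1 : ℂ) ⊗ₜ x) = 0 → x = 0)
    {b : (rootSystem (complexification 𝔱)).Base} {p : V} {μ : Module.Dual ℂ (complexification 𝔱)}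
    (hp : ‖p‖ = 1) (hμ : ∀ x : complexification 𝔱, π x p = μ x • p)
    (hr : ∀ α : (complexification 𝔱).root, b.IsPos α →
      ∀ z ∈ rootSpace (complexification 𝔱) α.1, π z p = 0) :
    ∃ f, HighestWeightData π b (fun α => negConj (f α)) f p μ := by
  choose f hf hf0 hn hc using fun α => exists_rootVector (𝔱 := 𝔱) h hinj α
  refine ⟨f, ⟨h.lie, hf, hf0, hn, hc, fun α => h.inner_left (f α), h.inner_eq_zero_of_weight_ne, ?_,
    hp, hμ, hr⟩⟩
  intro x
  obtain ⟨h1, h2⟩ := mem_complexification.1 x.2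
  refine ⟨⟨negConj x.1, ?_⟩, h.inner_left x.1⟩
  have hI : Complex.I ⊗ₜ[ℝ] tIm x.1 ∈ complexification 𝔱 :=
    Submodule.tmul_mem_baseChange_of_mem _ h2
  exact add_mem (neg_mem (one_tmul_mem_complexification h1)) hI

/-- The vectors `x p` for `x` in the real form. -/
def _root_.OrbitCurvature.realTangent (π : ℂ ⊗[ℝ] L →ₗ[ℂ] (V →ₗ[ℂ] V)) (p : V) : Set V :=
  Set.range fun x : L => π ((1 : ℂ) ⊗ₜ x) p

/-- The element z - `negConj z` acts by a skew operator, hence like an element of the real form. The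
subtracted term has weight α and kills p. -/
theorem smul_f_mem_realTangent (hinj : ∀ x : L, π ((1 : ℂ) ⊗ₜ x) = 0 → x = 0)
    {b : (rootSystem (complexification 𝔱)).Base} {p : V}
    {α : (complexification 𝔱).root} (hα : b.IsPos α)
    (hr : ∀ z ∈ rootSpace (complexification 𝔱) α.1, π z p = 0) {z : ℂ ⊗[ℝ] L}
    (hz : z ∈ rootSpace (complexification 𝔱) (-α.1)) : π z p ∈ realTangent π p := by
  have h1 : LinearMap.adjoint (π (z - negConj z)) = - π (z - negConj z) := by
    rw [map_sub, ← h.adjoint_eq, map_sub, LinearMap.adjoint_adjoint, neg_sub]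
  obtain ⟨x, hx⟩ := h.exists_real_of_adjoint_eq_neg h1
  refine ⟨x, ?_⟩
  change π ((1 : ℂ) ⊗ₜ x) p = _
  rw [← hx, map_sub, LinearMap.sub_apply, hr _ (negConj_mem_rootSpace h hinj hz), sub_zero]

/-- Some t in 𝔱 has μ(t) ≠ 0, and skewness makes μ(t) imaginary. So real multiples of t sweep out
ℝip. -/
theorem smul_mem_realTangent {p : V} {μ : Module.Dual ℂ (complexification 𝔱)} (hμ0 : μ ≠ 0)
    (hp : ‖p‖ = 1) (hμ : ∀ x : complexification 𝔱, π x p = μ x • p) (r : ℝ) :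
    (r * Complex.I : ℂ) • p ∈ realTangent π p := by
  obtain ⟨t, ht, hne⟩ : ∃ (t : L) (ht : t ∈ 𝔱), μ ⟨_, one_tmul_mem_complexification ht⟩ ≠ 0 := by
    by_contra! hcon
    apply hμ0
    ext x
    obtain ⟨t₁, t₂, h₁, h₂, rfl⟩ := exists_complexification_eq x
    rw [map_add, map_smul, hcon t₁ h₁, hcon t₂ h₂]
    simp
  have h1 := hμ ⟨_, one_tmul_mem_complexification ht⟩
  change π ((1 : ℂ) ⊗ₜ[ℝ] t) p = _ at h1
  set a := μ ⟨_, one_tmul_mem_complexification ht⟩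
  have h2 := h.skew t p p
  rw [h1, inner_smul_left, inner_smul_right, inner_self_eq_norm_sq_to_K, hp] at h2
  have h3 : a.re = 0 := by
    have := congrArg Complex.re h2
    simp at this
    linarith
  have h4 : a = a.im * Complex.I := by apply Complex.ext <;> simp [h3]
  have h5 : a.im ≠ 0 := fun h0 => hne (by rw [h4, h0]; simp)
  refine ⟨(r / a.im) • t, ?_⟩
  change π ((1 : ℂ) ⊗ₜ[ℝ] ((r / a.im) • t)) p = _
  have h6 : (1 : ℂ) ⊗ₜ[ℝ] ((r / a.im) • t) = ((r / a.im : ℝ) : ℂ) • ((1 : ℂ) ⊗ₜ[ℝ] t) := by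
    rw [TensorProduct.tmul_smul, TensorProduct.smul_tmul', TensorProduct.smul_tmul']
    simp
  rw [h6, map_smul, LinearMap.smul_apply, h1, h4, smul_smul]
  congr 1
  push_cast
  field_simp
  simp [h5, mul_comm]

end IsUnitaryAction

attribute [local instance] InnerProductSpace.complexToReal

omit [LieAlgebra.IsKilling ℝ L] [FiniteDimensional ℝ L] in
-- The left complement is real and the right one complex. Projecting to the former kills W, so it
-- factors through the projection to the latter.
theorem norm_starProjection_orthogonal_le (W : Submodule ℂ V) (U : Submodule ℝ V)
    (h : ∀ w ∈ W, w ∈ U) (S : V) : ‖Uᗮ.starProjection S‖ ≤ ‖Wᗮ.starProjection S‖ := by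
  have hdec := W.starProjection_add_starProjection_orthogonal S
  have h1 : Uᗮ.starProjection S = Uᗮ.starProjection (Wᗮ.starProjection S) := by
    conv_lhs => rw [← hdec]
    rw [map_add, add_eq_right, Submodule.starProjection_apply_eq_zero_iff,
      Submodule.orthogonal_orthogonal]
    exact h _ (W.starProjection_apply_mem S)
  rw [h1]
  exact Submodule.norm_starProjection_apply_le _ _

namespace IsUnitaryAction
variable (h : IsUnitaryAction π)
include h

theorem norm_normal_le (hinj : ∀ x : L, π ((1 : ℂ) ⊗ₜ x) = 0 → x = 0)
    {b : (rootSystem (complexification 𝔱)).Base} {C : ℝ} (hC : IsPairBound b C) {p : V}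
    {μ : Module.Dual ℂ (complexification 𝔱)}
    (hp : ‖p‖ = 1) (hμ : ∀ x : complexification 𝔱, π x p = μ x • p)
    (hr : ∀ α : (complexification 𝔱).root, b.IsPos α →
      ∀ z ∈ rootSpace (complexification 𝔱) α.1, π z p = 0)
    {U : Submodule ℝ V} (hpU : p ∈ U) (hTU : ∀ v ∈ realTangent π p, v ∈ U) {x y : L}
    (hx : ‖π ((1 : ℂ) ⊗ₜ x) p‖ = 1) (hy : ‖π ((1 : ℂ) ⊗ₜ y) p‖ = 1) :
    ‖Uᗮ.starProjection (π ((1 : ℂ) ⊗ₜ x) (π ((1 : ℂ) ⊗ₜ y) p))‖ ≤ √C := by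
  obtain ⟨f, D⟩ := h.exists_highestWeightData hinj hp hμ hr
  -- If μ = 0, then ‖f_α p‖² = μ(α^∨) = 0 for every positive α, so xp = 0, against ‖xp‖ = 1.
  have hμ0 : μ ≠ 0 := by
    rintro rfl
    have hf : ∀ α, π (f α) p = 0 := by
      intro α
      by_cases hα : b.IsPos α
      · have := D.apply_coroot_eq α hα
        simp only [LinearMap.zero_apply] at this
        simpa using this.symm
      · exact D.f_apply_eq_zero hα
    obtain ⟨z, c, hz⟩ := exists_eq_add_sum_rootVector D.f_mem D.f_ne ((1 : ℂ) ⊗ₜ x)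
    rw [hz, map_add, LinearMap.add_apply, map_sum, LinearMap.sum_apply, hμ] at hx
    simp [hf] at hx
  -- The span is complex while U is only real, so the induction must carry all complex multiples.
  have hW' : ∀ w ∈ lowerSpan π f p, ∀ c : ℂ, c • w ∈ U := by
    intro w hw
    induction hw using Submodule.span_induction with
    | zero => simp
    | add v w _ _ hv hw => exact fun c => by rw [smul_add]; exact add_mem (hv c) (hw c)
    | smul a w _ hw => exact fun c => by rw [smul_smul]; exact hw _
    | mem v hv =>
    intro c
    rcases hv with rfl | ⟨α, rfl⟩
    · have : c • v = c.re • v + (c.im * Complex.I : ℂ) • v := by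
        rw [← Complex.coe_smul c.re, ← add_smul, Complex.re_add_im]
      rw [this]
      exact add_mem (U.smul_mem _ hpU) (hTU _ (h.smul_mem_realTangent hμ0 hp hμ _))
    · by_cases hα : b.IsPos α
      · apply hTU
        have := h.smul_f_mem_realTangent hinj hα (hr α hα) (Submodule.smul_mem _ c (D.f_mem α))
        simpa using this
      · change c • π (f α) p ∈ U
        rw [D.f_apply_eq_zero hα, smul_zero]
        exact zero_mem _
  have hW : ∀ w ∈ lowerSpan π f p, w ∈ U := fun w hw => by simpa using hW' w hw 1
  refine (norm_starProjection_orthogonal_le _ U hW _).trans (Real.le_sqrt_of_sq_le ?_)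
  exact D.norm_starProjection_sq_le hC hx.le hy.le

end IsUnitaryAction
end Unitary

/-! ### The bound for the orbit -/

section Orbit
attribute [local instance] InnerProductSpace.complexToReal
variable {d : ℕ} {K : Type*} [TopologicalSpace K] [ChartedSpace (EuclideanSpace ℝ (Fin d)) K]
  [Group K] [LieGroup (𝓡 d) ∞ K]
  {V : Type*} [NormedAddCommGroup V] [InnerProductSpace ℂ V] [FiniteDimensional ℂ V]
  {ρ : Representation ℂ K V}
  (hsmooth : ∀ v : V, ContMDiff (𝓡 d) 𝓘(ℝ, V) ∞ (fun k : K => ρ k v))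

/-- The action of `𝔤 = 𝔨 ⊗ ℂ` by endomorphisms of `V`. -/
noncomputable def complexEnd : ℂ ⊗[ℝ] GroupLieAlgebra (𝓡 d) K →ₗ[ℂ] (V →ₗ[ℂ] V) :=
  LinearMap.liftBaseChange ℂ
    { toFun := infEnd hsmooth
      map_add' := fun x y => by ext v; exact map_add (infAction ρ v) x y
      map_smul' := fun c x => by ext v; exact map_smul (infAction ρ v) c x }

theorem complexEnd_one_tmul (x : GroupLieAlgebra (𝓡 d) K) (v : V) :
    complexEnd hsmooth ((1 : ℂ) ⊗ₜ x) v = infAction ρ v x := by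
  simp [complexEnd]
  rfl

theorem complexEnd_apply (z : ℂ ⊗[ℝ] GroupLieAlgebra (𝓡 d) K) (v : V) :
    complexEnd hsmooth z v = complexAction ρ v z := by
  induction z with
  | zero => simp
  | add x y hx hy => rw [map_add, map_add, LinearMap.add_apply, hx, hy]
  | tmul c x =>
    simp [complexEnd, complexAction]
    rfl

theorem complexEnd_lie (z w : ℂ ⊗[ℝ] GroupLieAlgebra (𝓡 d) K) :
    complexEnd hsmooth ⁅z, w⁆ =
      complexEnd hsmooth z * complexEnd hsmooth w - complexEnd hsmooth w * complexEnd hsmooth z := by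
  induction z with
  | zero => simp
  | add x y hx hy =>
    rw [add_lie, map_add, hx, hy, map_add]
    noncomm_ring
  | tmul c x =>
    induction w with
    | zero => rw [← lie_skew, zero_lie]; simp
    | add w w' hw hw' =>
      rw [LieRing.lie_add, map_add, hw, hw', map_add]
      noncomm_ring
    | tmul c' y =>
      have h1 : ∀ (c : ℂ) (x : GroupLieAlgebra (𝓡 d) K), complexEnd hsmooth (c ⊗ₜ x) =
          c • infEnd hsmooth x := fun c x => by
        simp [complexEnd]
      rw [LieAlgebra.ExtendScalars.bracket_tmul, h1, h1, h1]
      ext v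
      have h2 : infEnd hsmooth ⁅x, y⁆ v = infEnd hsmooth x (infEnd hsmooth y v) -
        infEnd hsmooth y (infEnd hsmooth x v) := infAction_lie hsmooth v x y
      simp only [LinearMap.smul_apply, LinearMap.sub_apply, Module.End.mul_apply, map_smul, h2,
        smul_sub, smul_smul]
      rw [mul_comm c c']

theorem isUnitaryAction_complexEnd
    (hunitary : ∀ (k : K) (v w : V), inner ℂ (ρ k v) (ρ k w) = inner ℂ v w) :
    IsUnitaryAction (complexEnd hsmooth) where
  lie := complexEnd_lie hsmooth
  skew x v w := by
    rw [complexEnd_one_tmul, complexEnd_one_tmul]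
    exact inner_infAction_left hsmooth hunitary v w x

/-- The kernel of the action is an ideal of a simple Lie algebra. -/
theorem infAction_injective_or_eq_zero [LieAlgebra.IsSimple ℝ (GroupLieAlgebra (𝓡 d) K)] :
    (∀ x : GroupLieAlgebra (𝓡 d) K, complexEnd hsmooth ((1 : ℂ) ⊗ₜ x) = 0 → x = 0) ∨
      ∀ x : GroupLieAlgebra (𝓡 d) K, complexEnd hsmooth ((1 : ℂ) ⊗ₜ x) = 0 := by
  let I : LieIdeal ℝ (GroupLieAlgebra (𝓡 d) K) :=
    { carrier := {x | complexEnd hsmooth ((1 : ℂ) ⊗ₜ x) = 0}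
      add_mem' := fun {x y} hx hy => by
        change complexEnd hsmooth ((1 : ℂ) ⊗ₜ (x + y)) = 0
        rw [TensorProduct.tmul_add, map_add, hx, hy, add_zero]
      zero_mem' := by
        change complexEnd hsmooth ((1 : ℂ) ⊗ₜ 0) = 0
        rw [TensorProduct.tmul_zero, map_zero]
      smul_mem' := fun c x hx => by
        change complexEnd hsmooth ((1 : ℂ) ⊗ₜ x) = 0 at hx
        have h1 : (1 : ℂ) ⊗ₜ[ℝ] (c • x) = (c : ℂ) • ((1 : ℂ) ⊗ₜ[ℝ] x) := by
          rw [TensorProduct.tmul_smul, TensorProduct.smul_tmul', TensorProduct.smul_tmul']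
          simp
        change complexEnd hsmooth ((1 : ℂ) ⊗ₜ (c • x)) = 0
        rw [h1, map_smul, hx, smul_zero]
      lie_mem := fun {x y} hy => by
        change complexEnd hsmooth ((1 : ℂ) ⊗ₜ y) = 0 at hy
        change complexEnd hsmooth ((1 : ℂ) ⊗ₜ ⁅x, y⁆) = 0
        have h1 := complexEnd_lie hsmooth ((1 : ℂ) ⊗ₜ x) ((1 : ℂ) ⊗ₜ y)
        rw [LieAlgebra.ExtendScalars.bracket_tmul, mul_one, hy, mul_zero, zero_mul, sub_zero] at h1
        exact h1 }
  rcases LieAlgebra.IsSimple.eq_bot_or_eq_top I with hI | hI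
  · left
    intro x hx
    have : x ∈ I := hx
    rw [hI] at this
    simpa using this
  · right
    intro x
    have : x ∈ I := by rw [hI]; trivial
    exact this

include hsmooth in
theorem normII_le [LieAlgebra.IsSimple ℝ (GroupLieAlgebra (𝓡 d) K)]
    (hunitary : ∀ (k : K) (v w : V), inner ℂ (ρ k v) (ρ k w) = inner ℂ v w)
    {𝔱 : LieSubalgebra ℝ (GroupLieAlgebra (𝓡 d) K)} [𝔱.IsCartanSubalgebra]
    {b : (roots 𝔱).Base} {p : V} (hp : IsHighestWeightVector ρ b p) (hp1 : ‖p‖ = 1)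
    {C : ℝ} (hC : IsPairBound b C) : normII d ρ p ≤ ENNReal.ofReal √C := by
  refine iSup_le fun u => iSup_le fun Y => iSup_le fun hu => iSup_le fun hY => iSup_le fun hu1 =>
    iSup_le fun hY1 => ?_
  obtain ⟨x, rfl⟩ := hu
  obtain ⟨y, hy⟩ := hY.tangent p ⟨1, by simp⟩
  change ‖infAction ρ p x‖ = 1 at hu1
  have hy' : Y p = infAction ρ p y := hy.symm
  have h := isUnitaryAction_complexEnd hsmooth hunitary
  rw [← ofReal_norm]
  apply ENNReal.ofReal_le_ofReal
  have h1 := secondFundamentalForm_eq hsmooth hunitary hY x y hy'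
  refine (congrArg norm h1).trans_le ?_
  rcases infAction_injective_or_eq_zero (d := d) hsmooth with hinj | h0
  · obtain ⟨μ, hμ⟩ := hp.weight
    have := h.norm_normal_le hinj hC hp1 (μ := μ)
      (fun x => (complexEnd_apply hsmooth _ _).trans (hμ x))
      (fun α hα z hz => (complexEnd_apply hsmooth _ _).trans (hp.raising α hα z hz))
      (U := Submodule.span ℝ {p} ⊔ orbitTangent d ρ p)
      (Submodule.mem_sup_left (Submodule.mem_span_singleton_self p))
      (by
        rintro _ ⟨x, rfl⟩
        exact Submodule.mem_sup_right ⟨x, (complexEnd_one_tmul hsmooth x p).symm⟩)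
      (x := x) (y := y) (by rw [complexEnd_one_tmul]; exact hu1)
      (by rw [complexEnd_one_tmul, ← hy']; exact hY1)
    rw [complexEnd_one_tmul, complexEnd_one_tmul] at this
    exact this
  -- A trivial action has no tangent vector of norm 1.
  · have h2 := complexEnd_one_tmul hsmooth x p
    rw [h0, LinearMap.zero_apply] at h2
    rw [← h2] at hu1
    simp at hu1

end Orbit

/-! ### The pair bound with constant C_Δ -/

section PairBound
variable {ι R M N : Type*} [Fintype ι] [CommRing R] [CharZero R] [AddCommGroup M] [Module R M]
  [AddCommGroup N] [Module R N] {P : RootPairing ι R M N}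

open Classical in
theorem sum_mSq_le_cDelta [P.IsCrystallographic] (b : P.Base) (γ : M) :
    ∑ q ∈ (posPairs b).filter (fun q => P.root q.1 + P.root q.2 = γ), mSq P q.1 q.2 ≤ cDelta b := by
  by_cases h : γ ∈ (posPairs b).image fun q => P.root q.1 + P.root q.2
  · exact Finset.le_sup (f := fun γ => ∑ q ∈ (posPairs b).filter
      (fun q => P.root q.1 + P.root q.2 = γ), mSq P q.1 q.2) h
  · rw [Finset.sum_eq_zero]
    · exact Nat.zero_le _
    · intro q hq
      obtain ⟨h1, h2⟩ := Finset.mem_filter.1 hq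
      exact absurd (Finset.mem_image.2 ⟨q, h1, h2⟩) h

open Classical in
theorem sq_sum_sqrt_mul_le {κ : Type*} (s : Finset κ) (m : κ → ℕ) (t : κ → ℝ) {C : ℝ}
    (hm : ((∑ q ∈ s, m q : ℕ) : ℝ) ≤ C) :
    (∑ q ∈ s, √(m q) * t q) ^ 2 ≤ C * ∑ q ∈ s, t q ^ 2 := by
  refine (Finset.sum_mul_sq_le_sq_mul_sq s (fun q => √(m q)) t).trans ?_
  refine mul_le_mul_of_nonneg_right ?_ (Finset.sum_nonneg fun _ _ => sq_nonneg _)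
  refine le_trans (le_of_eq ?_) hm
  rw [Nat.cast_sum]
  exact Finset.sum_congr rfl fun q _ => Real.sq_sqrt (Nat.cast_nonneg _)

open Classical in
theorem sum_posPairs_mul_sq_le (b : P.Base) {a c : ι → ℝ}
    (ha : ∑ i with b.IsPos i, a i ^ 2 ≤ 1) (hc : ∑ i with b.IsPos i, c i ^ 2 ≤ 1) :
    ∑ q ∈ posPairs b, (a q.1 * c q.2) ^ 2 ≤ 1 := by
  have h : posPairs b = (Finset.univ.filter b.IsPos) ×ˢ (Finset.univ.filter b.IsPos) := by
    ext q; simp [posPairs]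
  rw [h, Finset.sum_product]
  have h2 : ∑ i with b.IsPos i, ∑ j with b.IsPos j, (a i * c j) ^ 2 =
      (∑ i with b.IsPos i, a i ^ 2) * ∑ j with b.IsPos j, c j ^ 2 := by
    rw [Finset.sum_mul_sum]
    exact Finset.sum_congr rfl fun i _ => Finset.sum_congr rfl fun j _ => mul_pow _ _ _
  refine (le_of_eq h2).trans ?_
  exact mul_le_one₀ ha (Finset.sum_nonneg fun _ _ => sq_nonneg _) hc

/-- Cauchy–Schwarz on each fibre of r costs the sum of m over that fibre, at most C. The fibres
partition s, so the squares of t add up to at most 1. -/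
theorem sum_image_sq_sum_sqrt_mul_le {κ E : Type*} [DecidableEq E] (s : Finset κ) (r : κ → E)
    (m : κ → ℕ) (t : κ → ℝ) {C : ℕ} (hm : ∀ γ, ∑ q ∈ s with r q = γ, m q ≤ C)
    (ht : ∑ q ∈ s, t q ^ 2 ≤ 1) :
    ∑ γ ∈ s.image r, (∑ q ∈ s with r q = γ, √(m q) * t q) ^ 2 ≤ C := by
  have h2 := Finset.sum_fiberwise_of_maps_to (s := s) (t := s.image r) (g := r)
    (fun q hq => Finset.mem_image_of_mem _ hq) (fun q => t q ^ 2)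
  calc ∑ γ ∈ s.image r, (∑ q ∈ s with r q = γ, √(m q) * t q) ^ 2
      ≤ ∑ γ ∈ s.image r, (C : ℝ) * ∑ q ∈ s with r q = γ, t q ^ 2 :=
        Finset.sum_le_sum fun γ _ => sq_sum_sqrt_mul_le _ m t (Nat.cast_le.2 (hm γ))
    _ ≤ C := by
        rw [← Finset.mul_sum, h2]
        exact mul_le_of_le_one_right (Nat.cast_nonneg _) ht

open Classical in
theorem isPairBound_cDelta [P.IsCrystallographic] (b : P.Base) : IsPairBound b (cDelta b) :=
  fun _ _ _ _ ha hc => sum_image_sq_sum_sqrt_mul_le (posPairs b) (fun q => P.root q.1 + P.root q.2)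
    (fun q => mSq P q.1 q.2) _ (sum_mSq_le_cDelta b) (sum_posPairs_mul_sq_le b ha hc)

end PairBound

/-! ### Integral coordinates of roots and coroots -/

section Coordinates
variable {ι R M N : Type*} [Fintype ι] [CommRing R] [CharZero R] [AddCommGroup M] [Module R M]
  [AddCommGroup N] [Module R N] {P : RootPairing ι R M N} [P.IsCrystallographic]

/-- The integral coordinates of the roots and of the coroots with respect to the simple ones, for a
numbering of the simple roots for which the Cartan matrix is `A`. -/
structure RootCoordinates (b : P.Base) {n : ℕ} (A : Matrix (Fin n) (Fin n) ℤ) where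
  /-- The numbering of the simple roots. -/
  simple : Fin n → ι
  /-- The coordinates of a root. -/
  coord : ι → Fin n → ℤ
  /-- The coordinates of a coroot. -/
  cocoord : ι → Fin n → ℤ
  simple_mem : ∀ k, simple k ∈ b.support
  exists_simple : ∀ i ∈ b.support, ∃ k, simple k = i
  simple_injective : Function.Injective simple
  pairingIn_simple : ∀ k l, P.pairingIn ℤ (simple k) (simple l) = A k l
  root_eq : ∀ i, P.root i = ∑ k, coord i k • P.root (simple k)
  coroot_eq : ∀ i, P.coroot i = ∑ k, cocoord i k • P.coroot (simple k)

theorem HasCartanMatrix.nonempty_rootCoordinates {b : P.Base} {n : ℕ} {A : Matrix (Fin n) (Fin n) ℤ}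
    (h : HasCartanMatrix b A) : Nonempty (RootCoordinates b A) := by
  obtain ⟨e, he⟩ := h
  have h1 : ∀ i, ∃ c : Fin n → ℤ, P.root i = ∑ k, c k • P.root (e k) := by
    intro i
    obtain ⟨f, -, -, hf⟩ := b.exists_root_eq_sum_int i
    refine ⟨fun k => f (e k), ?_⟩
    rw [hf, ← Finset.sum_coe_sort, ← Equiv.sum_comp e]
  have h2 : ∀ i, ∃ c : Fin n → ℤ, P.coroot i = ∑ k, c k • P.coroot (e k) := by
    intro i
    obtain ⟨f, -, -, hf⟩ := b.flip.exists_root_eq_sum_int i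
    refine ⟨fun k => f (e k), ?_⟩
    change P.coroot i = ∑ j ∈ b.support, f j • P.coroot j at hf
    rw [hf, ← Finset.sum_coe_sort, ← Equiv.sum_comp e]
  choose c hc using h1
  choose c' hc' using h2
  refine ⟨⟨fun k => e k, c, c', fun k => (e k).2, fun i hi => ⟨e.symm ⟨i, hi⟩, by simp⟩,
    Subtype.val_injective.comp e.injective, fun k l => ?_, hc, hc'⟩⟩
  rw [← he]
  rfl

namespace RootCoordinates
variable {b : P.Base} {n : ℕ} {A : Matrix (Fin n) (Fin n) ℤ} (X : RootCoordinates b A)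
include X

theorem sum_smul_root_injective :
    Function.Injective fun x : Fin n → ℤ => ∑ k, x k • P.root (X.simple k) := by
  have h : LinearIndependent ℤ fun k => P.root (X.simple k) := by
    refine LinearIndependent.comp (b.linearIndepOn_root.restrict_scalars' ℤ)
      (fun k => ⟨X.simple k, X.simple_mem k⟩) fun k l hkl => X.simple_injective ?_
    exact congrArg Subtype.val hkl
  intro x y hxy
  have h0 := Fintype.linearIndependent_iff.1 h (x - y) (by
    simpa [sub_smul, Finset.sum_sub_distrib, sub_eq_zero] using hxy)
  exact sub_eq_zero.1 (funext h0)

theorem sum_smul_coroot_injective :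
    Function.Injective fun x : Fin n → ℤ => ∑ k, x k • P.coroot (X.simple k) := by
  have h : LinearIndependent ℤ fun k => P.coroot (X.simple k) := by
    refine LinearIndependent.comp (b.linearIndepOn_coroot.restrict_scalars' ℤ)
      (fun k => ⟨X.simple k, X.simple_mem k⟩) fun k l hkl => X.simple_injective ?_
    exact congrArg Subtype.val hkl
  intro x y hxy
  have h0 := Fintype.linearIndependent_iff.1 h (x - y) (by
    simpa [sub_smul, Finset.sum_sub_distrib, sub_eq_zero] using hxy)
  exact sub_eq_zero.1 (funext h0)

theorem coord_eq_of_root_eq {i : ι} {x : Fin n → ℤ} (h : P.root i = ∑ k, x k • P.root (X.simple k)) :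
    X.coord i = x :=
  X.sum_smul_root_injective ((X.root_eq i).symm.trans h)

theorem cocoord_eq_of_coroot_eq {i : ι} {x : Fin n → ℤ}
    (h : P.coroot i = ∑ k, x k • P.coroot (X.simple k)) : X.cocoord i = x :=
  X.sum_smul_coroot_injective ((X.coroot_eq i).symm.trans h)

theorem coord_injective : Function.Injective X.coord := by
  intro i j hij
  apply P.root.injective
  rw [X.root_eq i, X.root_eq j, hij]

theorem root_add_root_eq_iff {i j k l : ι} : P.root i + P.root j = P.root k + P.root l ↔
    X.coord i + X.coord j = X.coord k + X.coord l := by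
  rw [X.root_eq i, X.root_eq j, X.root_eq k, X.root_eq l, ← Finset.sum_add_distrib,
    ← Finset.sum_add_distrib]
  simp only [← add_smul]
  exact X.sum_smul_root_injective.eq_iff (a := X.coord i + X.coord j)

theorem root_eq_add_iff {i j k : ι} : P.root i = P.root j + P.root k ↔
    X.coord i = X.coord j + X.coord k := by
  rw [X.root_eq i, X.root_eq j, X.root_eq k, ← Finset.sum_add_distrib]
  simp only [← add_smul]
  exact X.sum_smul_root_injective.eq_iff (b := X.coord j + X.coord k)

theorem coord_simple (k : Fin n) : X.coord (X.simple k) = Pi.single k 1 := by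
  apply X.coord_eq_of_root_eq
  rw [Finset.sum_eq_single k]
  · simp
  · intro l _ hl; simp [hl]
  · simp

theorem cocoord_simple (k : Fin n) : X.cocoord (X.simple k) = Pi.single k 1 := by
  apply X.cocoord_eq_of_coroot_eq
  rw [Finset.sum_eq_single k]
  · simp
  · intro l _ hl; simp [hl]
  · simp

theorem pairingIn_eq (i j : ι) : P.pairingIn ℤ i j =
    ∑ k, ∑ l, X.coord i k * A k l * X.cocoord j l := by
  apply FaithfulSMul.algebraMap_injective ℤ R
  rw [P.algebraMap_pairingIn, ← P.root_coroot_eq_pairing, X.root_eq i, X.coroot_eq j]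
  simp only [map_sum, map_zsmul, LinearMap.sum_apply, LinearMap.smul_apply, P.root_coroot_eq_pairing,
    map_mul]
  simp only [Finset.smul_sum]
  rw [Finset.sum_comm]
  refine Finset.sum_congr rfl fun k _ => Finset.sum_congr rfl fun l _ => ?_
  rw [← P.algebraMap_pairingIn ℤ, X.pairingIn_simple]
  simp only [zsmul_eq_mul, eq_intCast]
  ring

theorem pairingIn_simple_right (i : ι) (l : Fin n) :
    P.pairingIn ℤ i (X.simple l) = ∑ k, X.coord i k * A k l := by
  rw [X.pairingIn_eq, X.cocoord_simple]
  simp [Pi.single_apply]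

theorem pairingIn_simple_left (k : Fin n) (j : ι) :
    P.pairingIn ℤ (X.simple k) j = ∑ l, A k l * X.cocoord j l := by
  rw [X.pairingIn_eq, X.coord_simple, Finset.sum_eq_single k]
  · simp
  · intro l _ hl; simp [hl]
  · simp

theorem coord_reflectionPerm (l : Fin n) (i : ι) : X.coord (P.reflectionPerm (X.simple l) i) =
    X.coord i - Pi.single l (∑ k, X.coord i k * A k l) := by
  apply X.coord_eq_of_root_eq
  rw [P.root_reflectionPerm, P.reflection_apply_root' ℤ, X.pairingIn_simple_right]
  simp only [Pi.sub_apply, sub_smul, Finset.sum_sub_distrib, ← X.root_eq]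
  congr 1
  refine ((Finset.sum_eq_single l ?_ ?_).trans ?_).symm
  · intro k _ hk; rw [Pi.single_eq_of_ne hk, zero_smul]
  · simp
  · simp

theorem cocoord_reflectionPerm (l : Fin n) (i : ι) : X.cocoord (P.reflectionPerm (X.simple l) i) =
    X.cocoord i - Pi.single l (∑ k, A l k * X.cocoord i k) := by
  apply X.cocoord_eq_of_coroot_eq
  have h : P.coroot (P.reflectionPerm (X.simple l) i) = P.coroot i -
      P.pairingIn ℤ (X.simple l) i • P.coroot (X.simple l) := by
    rw [P.coroot_reflectionPerm]
    exact P.flip.reflection_apply_root' ℤ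
  rw [h, X.pairingIn_simple_left]
  simp only [Pi.sub_apply, sub_smul, Finset.sum_sub_distrib, ← X.coroot_eq]
  congr 1
  refine ((Finset.sum_eq_single l ?_ ?_).trans ?_).symm
  · intro k _ hk; rw [Pi.single_eq_of_ne hk, zero_smul]
  · simp
  · simp

theorem coord_reflectionPerm_self (i : ι) : X.coord (P.reflectionPerm i i) = - X.coord i := by
  apply X.coord_eq_of_root_eq
  rw [P.root_reflectionPerm, P.reflection_apply_self, X.root_eq i]
  simp

theorem height_eq (i : ι) : b.height i = ∑ k, X.coord i k := by
  classical
  have h1 : ∀ F : ι → M, ∑ j ∈ b.support, F j = ∑ k, F (X.simple k) := by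
    intro F
    symm
    refine Finset.sum_bij (fun k _ => X.simple k) (fun k _ => X.simple_mem k)
      (fun k _ l _ h => X.simple_injective h) (fun i hi => ?_) (fun _ _ => rfl)
    obtain ⟨k, hk⟩ := X.exists_simple i hi
    exact ⟨k, Finset.mem_univ _, hk⟩
  have h2 : ∀ F : ι → ℤ, ∑ j ∈ b.support, F j = ∑ k, F (X.simple k) := by
    intro F
    symm
    refine Finset.sum_bij (fun k _ => X.simple k) (fun k _ => X.simple_mem k)
      (fun k _ l _ h => X.simple_injective h) (fun i hi => ?_) (fun _ _ => rfl)
    obtain ⟨k, hk⟩ := X.exists_simple i hi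
    exact ⟨k, Finset.mem_univ _, hk⟩
  let f : ι → ℤ := Function.extend X.simple (X.coord i) 0
  have hf : ∀ k, f (X.simple k) = X.coord i k := fun k => X.simple_injective.extend_apply _ _ k
  have h3 : P.root i = ∑ j ∈ b.support, f j • P.root j := by
    rw [h1]; simp only [hf]; exact X.root_eq i
  rw [RootPairing.Base.height_eq_sum h3, h2]
  simp only [hf]

theorem isPos_iff (i : ι) : b.IsPos i ↔ 0 < ∑ k, X.coord i k := by
  rw [RootPairing.Base.isPos_iff, X.height_eq]

end RootCoordinates
end Coordinates

/-! ### Sums over fibres -/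

section Fibers

/-- On the right the labels enter only through the relation r q' = r q, so sums of roots can be
exchanged for sums of their images in ℤ^m. -/
theorem sum_image_sq_sum_eq {κ E : Type*} [DecidableEq E] (s : Finset κ) (r : κ → E) (f : κ → ℝ) :
    ∑ γ ∈ s.image r, (∑ q ∈ s with r q = γ, f q) ^ 2 =
      ∑ q ∈ s, f q * ∑ q' ∈ s with r q' = r q, f q' := by
  rw [← Finset.sum_fiberwise_of_maps_to (s := s) (t := s.image r) (g := r)
    (fun q hq => Finset.mem_image_of_mem _ hq)]
  refine Finset.sum_congr rfl fun γ _ => ?_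
  rw [pow_two, Finset.sum_mul]
  refine Finset.sum_congr rfl fun q hq => ?_
  rw [(Finset.mem_filter.1 hq).2]

theorem sum_image_sq_sum_congr {κ E E' : Type*} [DecidableEq E] [DecidableEq E'] (s : Finset κ)
    (r : κ → E) (r' : κ → E') (h : ∀ q q', r q = r q' ↔ r' q = r' q') (f : κ → ℝ) :
    ∑ γ ∈ s.image r, (∑ q ∈ s with r q = γ, f q) ^ 2 =
      ∑ γ ∈ s.image r', (∑ q ∈ s with r' q = γ, f q) ^ 2 := by
  rw [sum_image_sq_sum_eq, sum_image_sq_sum_eq]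
  simp only [h]

end Fibers

/-! ### Path sums and Frobenius norms -/

section Paths
variable {E : Type*} [DecidableEq E] [AddCommGroup E]

/-- The entries of the product of the matrices `(A (x - y))` and `(B (x - y))`, indexed by `Λ`,
summed over all positions `(x, y)` with `x - y = γ`. -/
def pathSum (Λ : Finset E) (A B : E → ℝ) (γ : E) : ℝ :=
  ∑ p ∈ (Λ ×ˢ Λ).filter (fun p => p.1 - p.2 = γ), ∑ z ∈ Λ, A (p.1 - z) * B (z - p.2)

/-- This is the squared Frobenius norm of the matrix (A(x - y)). Each value off the diagonal occurs
at most N times; the diagonal, where the multiplicity is |Λ|, contributes nothing since A(0) = 0. -/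
theorem sum_sub_sq_le {Λ : Finset E} {N : ℕ}
    (hN : ∀ x ≠ 0, ((Λ ×ˢ Λ).filter (fun p => p.1 - p.2 = x)).card ≤ N) {A : E → ℝ} (hA0 : A 0 = 0)
    {X : Finset E} (hX : ∀ x ∉ X, A x = 0) (hA : ∑ x ∈ X, A x ^ 2 ≤ 1) :
    ∑ p ∈ Λ ×ˢ Λ, A (p.1 - p.2) ^ 2 ≤ N := by
  have h1 : ∑ p ∈ Λ ×ˢ Λ, A (p.1 - p.2) ^ 2 =
      ∑ p ∈ (Λ ×ˢ Λ).filter (fun p => p.1 - p.2 ∈ X), A (p.1 - p.2) ^ 2 := by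
    rw [Finset.sum_filter_of_ne]
    intro p _ hp
    by_contra hcon
    exact hp (by rw [hX _ hcon]; simp)
  have h2 : ∑ p ∈ (Λ ×ˢ Λ).filter (fun p => p.1 - p.2 ∈ X), A (p.1 - p.2) ^ 2 =
      ∑ x ∈ X, ∑ p ∈ (Λ ×ˢ Λ).filter (fun p => p.1 - p.2 = x), A (p.1 - p.2) ^ 2 := by
    rw [← Finset.sum_fiberwise_of_maps_to (t := X) (g := fun p : E × E => p.1 - p.2)
      (fun p hp => (Finset.mem_filter.1 hp).2)]
    refine Finset.sum_congr rfl fun x hx => ?_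
    rw [Finset.filter_filter]
    refine Finset.sum_congr (Finset.filter_congr fun p _ => ?_) fun _ _ => rfl
    constructor
    · exact fun h => h.2
    · exact fun h => ⟨h ▸ hx, h⟩
  have h3 : ∀ x ∈ X, ∑ p ∈ (Λ ×ˢ Λ).filter (fun p => p.1 - p.2 = x), A (p.1 - p.2) ^ 2 ≤
      N * A x ^ 2 := by
    intro x _
    rw [Finset.sum_congr rfl (g := fun _ => A x ^ 2) fun p hp => by rw [(Finset.mem_filter.1 hp).2],
      Finset.sum_const, nsmul_eq_mul]
    by_cases hx : x = 0
    · rw [hx, hA0]; simp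
    · exact mul_le_mul_of_nonneg_right (Nat.cast_le.2 (hN x hx)) (sq_nonneg _)
  rw [h1, h2]
  refine (Finset.sum_le_sum h3).trans ?_
  rw [← Finset.mul_sum]
  exact mul_le_of_le_one_right (Nat.cast_nonneg _) hA

/-- One factor N comes from Cauchy–Schwarz over the positions with difference γ ≠ 0. The other two
come from the Frobenius norms of the two matrices, which are submultiplicative. -/
theorem sum_pathSum_sq_le {Λ : Finset E} {N : ℕ}
    (hN : ∀ x ≠ 0, ((Λ ×ˢ Λ).filter (fun p => p.1 - p.2 = x)).card ≤ N) {A B : E → ℝ} (hA0 : A 0 = 0)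
    (hB0 : B 0 = 0) {X : Finset E} (hAX : ∀ x ∉ X, A x = 0) (hBX : ∀ x ∉ X, B x = 0)
    (hA : ∑ x ∈ X, A x ^ 2 ≤ 1) (hB : ∑ x ∈ X, B x ^ 2 ≤ 1) {Γ : Finset E} (hΓ : (0 : E) ∉ Γ) :
    ∑ γ ∈ Γ, pathSum Λ A B γ ^ 2 ≤ N ^ 3 := by
  have h1 : ∀ γ ∈ Γ, pathSum Λ A B γ ^ 2 ≤ N * ∑ p ∈ (Λ ×ˢ Λ).filter (fun p => p.1 - p.2 = γ),
      (∑ z ∈ Λ, A (p.1 - z) * B (z - p.2)) ^ 2 := by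
    intro γ hγ
    refine (sq_sum_le_card_mul_sum_sq).trans ?_
    exact mul_le_mul_of_nonneg_right (Nat.cast_le.2 (hN γ fun h => hΓ (h ▸ hγ)))
      (Finset.sum_nonneg fun _ _ => sq_nonneg _)
  have h2 : ∑ γ ∈ Γ, ∑ p ∈ (Λ ×ˢ Λ).filter (fun p => p.1 - p.2 = γ),
      (∑ z ∈ Λ, A (p.1 - z) * B (z - p.2)) ^ 2 ≤
      ∑ p ∈ Λ ×ˢ Λ, (∑ z ∈ Λ, A (p.1 - z) * B (z - p.2)) ^ 2 :=
    Finset.sum_fiberwise_le_sum_of_sum_fiber_nonneg fun _ _ => Finset.sum_nonneg fun _ _ => sq_nonneg _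
  have h3 : ∑ p ∈ Λ ×ˢ Λ, (∑ z ∈ Λ, A (p.1 - z) * B (z - p.2)) ^ 2 ≤
      (∑ p ∈ Λ ×ˢ Λ, A (p.1 - p.2) ^ 2) * ∑ p ∈ Λ ×ˢ Λ, B (p.1 - p.2) ^ 2 := by
    rw [Finset.sum_product, Finset.sum_product, Finset.sum_product_right, Finset.sum_mul_sum]
    exact Finset.sum_le_sum fun x _ => Finset.sum_le_sum fun y _ =>
      Finset.sum_mul_sq_le_sq_mul_sq _ _ _
  refine (Finset.sum_le_sum h1).trans ?_
  rw [← Finset.mul_sum, pow_succ', pow_two]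
  refine mul_le_mul_of_nonneg_left (h2.trans (h3.trans ?_)) (Nat.cast_nonneg _)
  exact mul_le_mul (sum_sub_sq_le hN hA0 hAX hA) (sum_sub_sq_le hN hB0 hBX hB)
    (Finset.sum_nonneg fun _ _ => sq_nonneg _) (Nat.cast_nonneg _)

/-- Each q is charged to one path (x, z, y). The path determines u q and v q, so no term is used
twice, and the unused terms are nonnegative. -/
theorem sum_mul_le_pathSum {κ : Type*} (s : Finset κ) (u v : κ → E) {Λ : Finset E} {A B : E → ℝ}
    (hA : ∀ x, 0 ≤ A x) (hB : ∀ x, 0 ≤ B x) {γ : E}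
    (hs : ∀ q ∈ s, ∃ x ∈ Λ, ∃ y ∈ Λ, ∃ z ∈ Λ, u q = x - z ∧ v q = z - y ∧ x - y = γ)
    (hinj : ∀ q ∈ s, ∀ q' ∈ s, u q = u q' → v q = v q' → q = q') :
    ∑ q ∈ s, A (u q) * B (v q) ≤ pathSum Λ A B γ := by
  classical
  choose! x hx y hy z hz hu hv hxy using hs
  let g : κ → (E × E) × E := fun q => ((x q, y q), z q)
  have h1 : ∑ q ∈ s, A (u q) * B (v q) =
      ∑ t ∈ s.image g, A (t.1.1 - t.2) * B (t.2 - t.1.2) := by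
    rw [Finset.sum_image]
    · exact Finset.sum_congr rfl fun q hq => by rw [hu q hq, hv q hq]
    · intro q hq q' hq' h
      simp only [g, Prod.mk.injEq] at h
      exact hinj q hq q' hq' (by rw [hu q hq, hu q' hq', h.1.1, h.2])
        (by rw [hv q hq, hv q' hq', h.1.2, h.2])
  rw [h1, pathSum, ← Finset.sum_product' (f := fun (p : E × E) z => A (p.1 - z) * B (z - p.2))]
  refine Finset.sum_le_sum_of_subset_of_nonneg ?_ fun t _ _ => mul_nonneg (hA _) (hB _)
  intro t ht
  obtain ⟨q, hq, rfl⟩ := Finset.mem_image.1 ht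
  simp only [g, Finset.mem_product, Finset.mem_filter]
  exact ⟨⟨⟨hx q hq, hy q hq⟩, hxy q hq⟩, hz q hq⟩

end Paths

/-! ### Sums of short vectors in ℤ^m -/

section ShortVectors
variable {m : ℕ}

/-- The vectors `0`, `e_k` and `-e_k` in `ℤ^m`. -/
def shortVectors (m : ℕ) : Finset (Fin m → ℤ) :=
  insert 0 (Finset.univ.image (fun k => Pi.single k 1) ∪ Finset.univ.image fun k => Pi.single k (-1))

theorem mem_shortVectors {x : Fin m → ℤ} :
    x ∈ shortVectors m ↔ x = 0 ∨ (∃ k, x = Pi.single k 1) ∨ ∃ k, x = Pi.single k (-1) := by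
  simp [shortVectors, eq_comm]

theorem neg_mem_shortVectors {x : Fin m → ℤ} (hx : x ∈ shortVectors m) : -x ∈ shortVectors m := by
  rw [mem_shortVectors] at hx ⊢
  rcases hx with rfl | ⟨k, rfl⟩ | ⟨k, rfl⟩
  · simp
  · exact Or.inr (Or.inr ⟨k, (Pi.single_neg k 1).symm⟩)
  · exact Or.inr (Or.inl ⟨k, by rw [← Pi.single_neg]; simp⟩)

/-- A multiset of vectors that contains no opposite nonzero elements. -/
def IsNoncancelling (s : Multiset (Fin m → ℤ)) : Prop := ∀ x ∈ s, x ≠ 0 → -x ∉ s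

theorem sum_apply_eq_count {s : Multiset (Fin m → ℤ)} (hs : ∀ x ∈ s, x ∈ shortVectors m) (k : Fin m) :
    s.sum k = s.count (Pi.single k 1) - s.count (Pi.single k (-1)) := by
  induction s using Multiset.induction_on with
  | empty => simp
  | cons x s ih =>
    have hne : ∀ l : Fin m, (Pi.single l 1 : Fin m → ℤ) ≠ Pi.single k (-1) := by
      intro l h
      have := congrFun h l
      by_cases hlk : l = k
      · subst hlk; simp at this
      · simp [Pi.single_eq_of_ne hlk] at this
    have hne' : ∀ l : Fin m, (Pi.single l (-1) : Fin m → ℤ) ≠ Pi.single k 1 := by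
      intro l h
      have := congrFun h l
      by_cases hlk : l = k
      · subst hlk; simp at this
      · simp [Pi.single_eq_of_ne hlk] at this
    have h0 : ∀ (c : ℤ), c ≠ 0 → (0 : Fin m → ℤ) ≠ Pi.single k c := by
      intro c hc h
      have := congrFun h k
      simp at this
      exact hc this.symm
    rw [Multiset.sum_cons, Pi.add_apply, ih fun y hy => hs y (Multiset.mem_cons_of_mem hy)]
    rcases mem_shortVectors.1 (hs x (Multiset.mem_cons_self _ _)) with rfl | ⟨l, rfl⟩ | ⟨l, rfl⟩
    · rw [Multiset.count_cons_of_ne (h0 1 (by simp)).symm,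
        Multiset.count_cons_of_ne (h0 (-1) (by simp)).symm]
      simp
    · rw [Multiset.count_cons_of_ne (a := Pi.single k (-1)) (hne l).symm]
      by_cases hlk : l = k
      · subst hlk
        rw [Multiset.count_cons_self]
        simp; ring
      · rw [Multiset.count_cons_of_ne, Pi.single_eq_of_ne (Ne.symm hlk), zero_add]
        intro h
        have := congrFun h k
        rw [Pi.single_eq_of_ne (Ne.symm hlk)] at this
        simp at this
    · rw [Multiset.count_cons_of_ne (a := Pi.single k 1) (hne' l).symm]
      by_cases hlk : l = k
      · subst hlk
        rw [Multiset.count_cons_self]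
        simp; ring
      · rw [Multiset.count_cons_of_ne, Pi.single_eq_of_ne (Ne.symm hlk), zero_add]
        intro h
        have := congrFun h k
        rw [Pi.single_eq_of_ne (Ne.symm hlk)] at this
        simp at this

theorem single_ne_zero' (k : Fin m) {c : ℤ} (hc : c ≠ 0) : (Pi.single k c : Fin m → ℤ) ≠ 0 := by
  rwa [Ne, Pi.single_eq_zero_iff]

theorem IsNoncancelling.count_eq {s : Multiset (Fin m → ℤ)} (h : IsNoncancelling s)
    (hs : ∀ x ∈ s, x ∈ shortVectors m) (k : Fin m) :
    s.count (Pi.single k 1) = (s.sum k).toNat ∧ s.count (Pi.single k (-1)) = (-s.sum k).toNat := by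
  have h1 := sum_apply_eq_count hs k
  have h2 : s.count (Pi.single k 1) = 0 ∨ s.count (Pi.single k (-1)) = 0 := by
    by_cases h3 : Pi.single k 1 ∈ s
    · right
      have := h _ h3 (single_ne_zero' k one_ne_zero)
      rw [← Pi.single_neg] at this
      exact Multiset.count_eq_zero.2 this
    · exact Or.inl (Multiset.count_eq_zero.2 h3)
  omega

/-- Without cancellation, the multiplicities of e_k and -e_k are the positive and negative parts of
the k-th coordinate of the sum. The cardinality then fixes the number of zeros. -/
theorem IsNoncancelling.eq_of_sum_eq {s t : Multiset (Fin m → ℤ)} (h : IsNoncancelling s)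
    (hs : ∀ x ∈ s, x ∈ shortVectors m) (h' : IsNoncancelling t) (ht : ∀ x ∈ t, x ∈ shortVectors m)
    (hcard : s.card = t.card) (hsum : s.sum = t.sum) : s = t := by
  have h1 : s.filter (· ≠ 0) = t.filter (· ≠ 0) := by
    ext x
    rw [Multiset.count_filter, Multiset.count_filter]
    split_ifs with hx
    · by_cases hxs : x ∈ shortVectors m
      · rcases mem_shortVectors.1 hxs with rfl | ⟨k, rfl⟩ | ⟨k, rfl⟩
        · exact absurd rfl hx
        · rw [(h.count_eq hs k).1, (h'.count_eq ht k).1, hsum]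
        · rw [(h.count_eq hs k).2, (h'.count_eq ht k).2, hsum]
      · rw [Multiset.count_eq_zero.2 fun hx => hxs (hs _ hx),
          Multiset.count_eq_zero.2 fun hx => hxs (ht _ hx)]
    · rfl
  have h2 : ∀ u : Multiset (Fin m → ℤ), u.filter (fun x => ¬ x ≠ 0) =
      Multiset.replicate (u.filter (fun x => ¬ x ≠ 0)).card 0 := by
    intro u
    rw [Multiset.eq_replicate]
    exact ⟨rfl, fun x hx => not_not.1 (Multiset.mem_filter.1 hx).2⟩
  have h3 := Multiset.filter_add_not (fun x : Fin m → ℤ => x ≠ 0) s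
  have h4 := Multiset.filter_add_not (fun x : Fin m → ℤ => x ≠ 0) t
  have h5 : (s.filter (fun x => ¬ x ≠ 0)).card = (t.filter (fun x => ¬ x ≠ 0)).card := by
    have e3 := congrArg Multiset.card h3
    have e4 := congrArg Multiset.card h4
    rw [Multiset.card_add] at e3 e4
    rw [h1] at e3
    omega
  rw [← h3, ← h4, h1, h2 s, h2 t, h5]

theorem isNoncancelling_pair {x y : Fin m → ℤ} (h : x + y ≠ 0) : IsNoncancelling {x, y} := by
  have aux : ∀ z : Fin m → ℤ, z ≠ 0 → -z ≠ z := fun z hz h => hz (by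
    funext k; have := congrFun h k; simp at this ⊢; omega)
  intro z hz hz0 hz'
  simp only [Multiset.insert_eq_cons, Multiset.mem_cons, Multiset.mem_singleton] at hz hz'
  rcases hz with rfl | rfl <;> rcases hz' with h' | h'
  · exact aux _ hz0 h'
  · exact h (by rw [← h']; simp)
  · exact h (by rw [← h']; simp)
  · exact aux _ hz0 h'

theorem isNoncancelling_quad {x y z w : Fin m → ℤ} (h1 : x + y ≠ 0) (h2 : z + w ≠ 0)
    (h3 : x + z ≠ 0 ∨ x = 0) (h4 : x + w ≠ 0 ∨ x = 0) (h5 : y + z ≠ 0 ∨ y = 0)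
    (h6 : y + w ≠ 0 ∨ y = 0) :
    IsNoncancelling {x, y, z, w} := by
  have aux : ∀ z : Fin m → ℤ, z ≠ 0 → z + z ≠ 0 := fun z hz h => hz (by
    funext k; have := congrFun h k; simp at this ⊢; omega)
  intro u hu hu0 hu'
  simp only [Multiset.insert_eq_cons, Multiset.mem_cons, Multiset.mem_singleton] at hu hu'
  have key : ∀ v : Fin m → ℤ, -u = v → u + v = 0 := fun v hv => by rw [← hv]; simp
  have hux : u + x = 0 ∨ u + y = 0 ∨ u + z = 0 ∨ u + w = 0 := by
    rcases hu' with h | h | h | h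
    · exact Or.inl (key _ h)
    · exact Or.inr (Or.inl (key _ h))
    · exact Or.inr (Or.inr (Or.inl (key _ h)))
    · exact Or.inr (Or.inr (Or.inr (key _ h)))
  have hz : x = 0 → x + z = 0 → z = 0 := fun h h' => by rwa [h, zero_add] at h'
  rcases hu with rfl | rfl | rfl | rfl
  · rcases hux with h | h | h | h
    · exact aux _ hu0 h
    · exact h1 h
    · exact h3.elim (fun h' => h' h) hu0
    · exact h4.elim (fun h' => h' h) hu0
  · rcases hux with h | h | h | h
    · exact h1 (by rwa [add_comm])
    · exact aux _ hu0 h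
    · exact h5.elim (fun h' => h' h) hu0
    · exact h6.elim (fun h' => h' h) hu0
  · rcases hux with h | h | h | h
    · rw [add_comm] at h
      exact h3.elim (fun h' => h' h) fun h' => hu0 (by rwa [h', zero_add] at h)
    · rw [add_comm] at h
      exact h5.elim (fun h' => h' h) fun h' => hu0 (by rwa [h', zero_add] at h)
    · exact aux _ hu0 h
    · exact h2 h
  · rcases hux with h | h | h | h
    · rw [add_comm] at h
      exact h4.elim (fun h' => h' h) fun h' => hu0 (by rwa [h', zero_add] at h)
    · rw [add_comm] at h
      exact h6.elim (fun h' => h' h) fun h' => hu0 (by rwa [h', zero_add] at h)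
    · exact h2 (by rwa [add_comm])
    · exact aux _ hu0 h

/-- Otherwise x, y, z, w do not cancel, so they agree as a multiset with u, v, 0, 0, or with four
zeros when u + v = 0. Two of them are then zero, which is itself a forbidden vanishing pair. -/
theorem exists_cancel {x y z w : Fin m → ℤ} (hx : x ∈ shortVectors m) (hy : y ∈ shortVectors m)
    (hz : z ∈ shortVectors m) (hw : w ∈ shortVectors m) (h1 : x + y ≠ 0) (h2 : z + w ≠ 0)
    {u v : Fin m → ℤ} (hu : u ∈ shortVectors m) (hv : v ∈ shortVectors m)
    (h : x + y + (z + w) = u + v) : x + z = 0 ∨ x + w = 0 ∨ y + z = 0 ∨ y + w = 0 := by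
  by_contra! hcon
  obtain ⟨c1, c2, c3, c4⟩ := hcon
  have hn : IsNoncancelling {x, y, z, w} :=
    isNoncancelling_quad h1 h2 (Or.inl c1) (Or.inl c2) (Or.inl c3) (Or.inl c4)
  have hs : ∀ a ∈ ({x, y, z, w} : Multiset (Fin m → ℤ)), a ∈ shortVectors m := by
    intro a ha
    simp only [Multiset.insert_eq_cons, Multiset.mem_cons, Multiset.mem_singleton] at ha
    rcases ha with rfl | rfl | rfl | rfl <;> assumption
  have h0 : (0 : Fin m → ℤ) ∈ shortVectors m := mem_shortVectors.2 (Or.inl rfl)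
  have hsum : ({x, y, z, w} : Multiset (Fin m → ℤ)).sum = u + v := by
    simp only [Multiset.insert_eq_cons, Multiset.sum_cons, Multiset.sum_singleton]
    rw [← h, add_assoc]
  have hcount : 2 ≤ ({x, y, z, w} : Multiset (Fin m → ℤ)).count 0 := by
    by_cases huv : u + v = 0
    · have ht : ∀ a ∈ Multiset.replicate 4 (0 : Fin m → ℤ), a = 0 := fun a ha =>
        Multiset.eq_of_mem_replicate ha
      rw [hn.eq_of_sum_eq hs (fun a ha ha0 => absurd (ht a ha) ha0) (fun a ha => by rwa [ht a ha]) rfl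
        (by rw [hsum, huv, Multiset.sum_replicate, smul_zero]), Multiset.count_replicate_self]
      norm_num
    · have hp := isNoncancelling_pair huv
      have ht : ∀ a ∈ ({u, v} + Multiset.replicate 2 0 : Multiset (Fin m → ℤ)), a ≠ 0 →
          a ∈ ({u, v} : Multiset (Fin m → ℤ)) := fun a ha ha0 =>
        (Multiset.mem_add.1 ha).resolve_right fun h => ha0 (Multiset.eq_of_mem_replicate h)
      have hpm : ∀ a ∈ ({u, v} : Multiset (Fin m → ℤ)), a ∈ shortVectors m := by
        intro a ha
        simp only [Multiset.insert_eq_cons, Multiset.mem_cons, Multiset.mem_singleton] at ha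
        rcases ha with rfl | rfl <;> assumption
      rw [hn.eq_of_sum_eq (t := {u, v} + Multiset.replicate 2 0) hs
        (fun a ha ha0 hna => hp a (ht a ha ha0) ha0 (ht _ hna (neg_ne_zero.2 ha0)))
        (fun a ha => (em (a = 0)).elim (fun h => h ▸ h0) fun ha0 => hpm a (ht a ha ha0)) rfl
        (by rw [hsum, Multiset.sum_add, Multiset.sum_replicate, smul_zero, add_zero]; simp),
        Multiset.count_add, Multiset.count_replicate_self]
      exact Nat.le_add_left _ _
  have d1 : ¬ (x = 0 ∧ y = 0) := fun h => h1 (by rw [h.1, h.2, add_zero])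
  have d2 : ¬ (z = 0 ∧ w = 0) := fun h => h2 (by rw [h.1, h.2, add_zero])
  have d3 : ¬ (x = 0 ∧ z = 0) := fun h => c1 (by rw [h.1, h.2, add_zero])
  have d4 : ¬ (x = 0 ∧ w = 0) := fun h => c2 (by rw [h.1, h.2, add_zero])
  have d5 : ¬ (y = 0 ∧ z = 0) := fun h => c3 (by rw [h.1, h.2, add_zero])
  have d6 : ¬ (y = 0 ∧ w = 0) := fun h => c4 (by rw [h.1, h.2, add_zero])
  have hc : ({x, y, z, w} : Multiset (Fin m → ℤ)).count 0 = (if w = 0 then 1 else 0) +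
      (if z = 0 then 1 else 0) + (if y = 0 then 1 else 0) + (if x = 0 then 1 else 0) := by
    simp only [Multiset.insert_eq_cons, Multiset.count_cons, Multiset.count_singleton,
      eq_comm (a := (0 : Fin m → ℤ))]
  rw [hc] at hcount
  clear hc hs hn h h1 h2 c1 c2 c3 c4 hx hy hz hw hsum
  by_cases hx : x = 0
  · have hy : y ≠ 0 := fun hy => d1 ⟨hx, hy⟩
    have hz : z ≠ 0 := fun hz => d3 ⟨hx, hz⟩
    have hw : w ≠ 0 := fun hw => d4 ⟨hx, hw⟩
    rw [if_neg hw, if_neg hz, if_neg hy, if_pos hx] at hcount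
    omega
  rw [if_neg hx] at hcount
  by_cases hy : y = 0
  · have hz : z ≠ 0 := fun hz => d5 ⟨hy, hz⟩
    have hw : w ≠ 0 := fun hw => d6 ⟨hy, hw⟩
    rw [if_neg hw, if_neg hz, if_pos hy] at hcount
    omega
  rw [if_neg hy] at hcount
  by_cases hz : z = 0
  · have hw : w ≠ 0 := fun hw => d2 ⟨hz, hw⟩
    rw [if_neg hw, if_pos hz] at hcount
    omega
  rw [if_neg hz] at hcount
  split_ifs at hcount <;> omega

end ShortVectors

/-! ### Pair bounds from embeddings of the roots into ℤ^m -/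

theorem filter_image_sq_sum {κ E : Type*} [DecidableEq E] (s : Finset κ) (r : κ → E) (f : κ → ℝ)
    (p : E → Prop) [DecidablePred p] :
    ∑ γ ∈ (s.image r).filter p, (∑ q ∈ s with r q = γ, f q) ^ 2 =
      ∑ γ ∈ (s.filter fun q => p (r q)).image r,
        (∑ q ∈ s.filter fun q => p (r q) with r q = γ, f q) ^ 2 := by
  rw [Finset.filter_image]
  refine Finset.sum_congr rfl fun γ hγ => ?_
  obtain ⟨q, hq, rfl⟩ := Finset.mem_image.1 hγ
  rw [Finset.filter_filter]
  congr 1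
  refine Finset.sum_congr (Finset.filter_congr fun q' _ => ?_) fun _ _ => rfl
  exact ⟨fun h => ⟨by rw [h]; exact (Finset.mem_filter.1 hq).2, h⟩, fun h => h.2⟩

/-- The sums of two short vectors. -/
def IsShortSum {m : ℕ} (x : Fin m → ℤ) : Prop := ∃ u ∈ shortVectors m, ∃ v ∈ shortVectors m, x = u + v

section Classical
variable {ι R M N : Type*} [Fintype ι] [Field R] [CharZero R] [AddCommGroup M]
  [Module R M] [AddCommGroup N] [Module R N] {P : RootPairing ι R M N} [P.IsCrystallographic]

/-- An additive embedding of the roots into `ℤ^m` such that each root is the sum of two short vectors. -/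
structure ShortEmbedding (b : P.Base) {m : ℕ} (C : ι → Fin m → ℤ) : Prop where
  injective : Function.Injective C
  ne_zero : ∀ i, C i ≠ 0
  add_eq_iff : ∀ i j k l, P.root i + P.root j = P.root k + P.root l ↔ C i + C j = C k + C l
  eq_add : ∀ i j k, P.root k = P.root i + P.root j → C k = C i + C j
  neg : ∀ i, C (P.reflectionPerm i i) = -C i
  isShortSum : ∀ i, IsShortSum (C i)

variable {b : P.Base} {m : ℕ} {C : ι → Fin m → ℤ}

theorem mSq_le_two (i j : ι) : mSq P i j ≤ 2 := by
  unfold mSq; split_ifs <;> omega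

namespace ShortEmbedding
variable (h : ShortEmbedding b C)
include h

open Classical in
-- A negative pairing would make the sum a root, hence a sum of two short vectors.
theorem mSq_eq_of_not_isShortSum {i j : ι} (hi : b.IsPos i) (hj : b.IsPos j)
    (hij : ¬ IsShortSum (C i + C j)) : mSq P i j = 1 + if i = j then 1 else 0 := by
  by_cases heq : i = j
  · simp [mSq, heq]
  · have : ¬ P.pairingIn ℤ i j < 0 := by
      intro hneg
      obtain ⟨k, hk⟩ := P.root_add_root_mem_of_pairingIn_neg hneg
        fun h' => not_isPos_of_root_eq_neg b hj h' hi
      exact hij (h.eq_add i j k hk ▸ h.isShortSum k)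
    simp [mSq, heq, this]

open Classical in
-- Labels γ that are sums of two short vectors are bounded by `hpath`, at the price of m² ≤ 2. At
-- the others m² is 1 off the diagonal, so Σ m² is the count in `hnon`, and Cauchy–Schwarz applies.
theorem isPairBound {K₁ K₂ : ℕ}
    (hpath : ∀ a c : ι → ℝ, (∀ i, 0 ≤ a i) → (∀ i, 0 ≤ c i) →
      (∑ i with b.IsPos i, a i ^ 2 ≤ 1) → (∑ i with b.IsPos i, c i ^ 2 ≤ 1) →
      ∑ γ ∈ ((posPairs b).image fun q => C q.1 + C q.2).filter IsShortSum,
        (∑ q ∈ (posPairs b).filter (fun q => C q.1 + C q.2 = γ), a q.1 * c q.2) ^ 2 ≤ K₁)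
    (hnon : ∀ γ, ¬ IsShortSum γ → ((posPairs b).filter (fun q => C q.1 + C q.2 = γ)).card +
      ((posPairs b).filter (fun q => C q.1 + C q.2 = γ ∧ q.1 = q.2)).card ≤ K₂) :
    IsPairBound b (2 * K₁ + K₂) := by
  intro a c ha0 hc0 ha hc
  rw [sum_image_sq_sum_congr _ (fun q : ι × ι => P.root q.1 + P.root q.2) (fun q => C q.1 + C q.2) fun q q' => h.add_eq_iff _ _ _ _,
    ← Finset.sum_filter_add_sum_filter_not _ IsShortSum]
  refine add_le_add ?_ ?_
  · refine (Finset.sum_le_sum (g := fun γ => 2 *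
      (∑ q ∈ (posPairs b).filter (fun q => C q.1 + C q.2 = γ), a q.1 * c q.2) ^ 2)
      fun γ _ => ?_).trans ?_
    · have h1 : ∑ q ∈ (posPairs b).filter (fun q => C q.1 + C q.2 = γ),
          √(mSq P q.1 q.2) * (a q.1 * c q.2) ≤
          √2 * ∑ q ∈ (posPairs b).filter (fun q => C q.1 + C q.2 = γ), a q.1 * c q.2 := by
        rw [Finset.mul_sum]
        refine Finset.sum_le_sum fun q _ => mul_le_mul_of_nonneg_right ?_
          (mul_nonneg (ha0 _) (hc0 _))
        exact Real.sqrt_le_sqrt (by exact_mod_cast mSq_le_two q.1 q.2)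
      refine (pow_le_pow_left₀ (Finset.sum_nonneg fun q _ => mul_nonneg (Real.sqrt_nonneg _)
        (mul_nonneg (ha0 _) (hc0 _))) h1 2).trans (le_of_eq ?_)
      rw [mul_pow, Real.sq_sqrt (by norm_num)]
    · rw [← Finset.mul_sum]
      exact mul_le_mul_of_nonneg_left (hpath a c ha0 hc0 ha hc) (by norm_num)
  · rw [filter_image_sq_sum _ _ _ fun γ => ¬ IsShortSum γ]
    refine sum_image_sq_sum_sqrt_mul_le _ _ (fun q : ι × ι => mSq P q.1 q.2) _ (fun γ => ?_) ?_
    · by_cases hγ : IsShortSum γ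
      · rw [Finset.sum_eq_zero]
        · exact Nat.zero_le _
        · intro q hq
          obtain ⟨h1, h2⟩ := Finset.mem_filter.1 hq
          exact absurd (h2 ▸ hγ) (Finset.mem_filter.1 h1).2
      · refine le_trans (le_of_eq ?_) (hnon γ hγ)
        rw [Finset.card_eq_sum_ones, ← Finset.filter_filter _ fun q : ι × ι => q.1 = q.2,
          Finset.card_filter, ← Finset.sum_add_distrib, Finset.filter_filter]
        refine Finset.sum_congr (Finset.filter_congr fun q _ => ?_) fun q hq => ?_
        · exact ⟨fun h => h.2, fun h => ⟨by rw [h]; exact hγ, h⟩⟩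
        · obtain ⟨h1, h2⟩ := Finset.mem_filter.1 hq
          have h3 := (Finset.mem_filter.1 h1).2
          exact h.mSq_eq_of_not_isShortSum h3.1 h3.2 (h2 ▸ hγ)
    · refine le_trans (Finset.sum_le_sum_of_subset_of_nonneg (Finset.filter_subset _ _)
        fun _ _ _ => sq_nonneg _) (sum_posPairs_mul_sq_le b ha hc)

open Classical in
theorem exists_extension (a : ι → ℝ) (ha0 : ∀ i, 0 ≤ a i) (ha : ∑ i with b.IsPos i, a i ^ 2 ≤ 1) :
    ∃ A : (Fin m → ℤ) → ℝ, (∀ x, 0 ≤ A x) ∧ A 0 = 0 ∧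
      (∀ x ∉ (Finset.univ.filter b.IsPos).image C, A x = 0) ∧
      (∑ x ∈ (Finset.univ.filter b.IsPos).image C, A x ^ 2 ≤ 1) ∧ ∀ i, b.IsPos i → A (C i) = a i := by
  let A := Function.extend C (fun i => if b.IsPos i then a i else 0) 0
  have h1 : ∀ i, A (C i) = if b.IsPos i then a i else 0 := fun i => h.injective.extend_apply _ _ i
  have h2 : ∀ x, (¬ ∃ i, C i = x) → A x = 0 := fun x hx => Function.extend_apply' _ _ _ hx
  refine ⟨A, fun x => ?_, h2 0 fun ⟨i, hi⟩ => h.ne_zero i hi, fun x hx => ?_, ?_, fun i hi => ?_⟩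
  · by_cases hx : ∃ i, C i = x
    · obtain ⟨i, rfl⟩ := hx
      rw [h1]
      split_ifs
      · exact ha0 i
      · exact le_rfl
    · rw [h2 x hx]
  · by_cases hx' : ∃ i, C i = x
    · obtain ⟨i, rfl⟩ := hx'
      rw [h1, if_neg]
      intro hi
      exact hx (Finset.mem_image_of_mem _ (Finset.mem_filter.2 ⟨Finset.mem_univ _, hi⟩))
    · exact h2 x hx'
  · rw [Finset.sum_image fun i _ j _ hij => h.injective hij]
    refine le_trans (le_of_eq (Finset.sum_congr rfl fun i hi => ?_)) ha
    rw [h1, if_pos (Finset.mem_filter.1 hi).2]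
  · rw [h1, if_pos hi]

/-- If a vector of one root cancelled one of the other, γ would be the sum of the two that remain.
-/
theorem exists_quad {i j : ι} {γ : Fin m → ℤ} (hij : C i + C j = γ) (hγ : ¬ IsShortSum γ)
    {x y z w : Fin m → ℤ} (hx : x ∈ shortVectors m) (hy : y ∈ shortVectors m)
    (hz : z ∈ shortVectors m) (hw : w ∈ shortVectors m) (hi : C i = x + y) (hj : C j = z + w) :
    IsNoncancelling {x, y, z, w} := by
  have e : γ = x + y + (z + w) := by rw [← hij, hi, hj]
  refine isNoncancelling_quad (hi ▸ h.ne_zero i) (hj ▸ h.ne_zero j) (Or.inl ?_) (Or.inl ?_)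
    (Or.inl ?_) (Or.inl ?_)
  · intro h0
    exact hγ ⟨y, hy, w, hw, by rw [e, ← zero_add (y + w), ← h0]; abel⟩
  · intro h0
    exact hγ ⟨y, hy, z, hz, by rw [e, ← zero_add (y + z), ← h0]; abel⟩
  · intro h0
    exact hγ ⟨x, hx, w, hw, by rw [e, ← zero_add (x + w), ← h0]; abel⟩
  · intro h0
    exact hγ ⟨x, hx, z, hz, by rw [e, ← zero_add (x + z), ← h0]; abel⟩

theorem quad_eq {i j i' j' : ι} {γ : Fin m → ℤ} (hij : C i + C j = γ) (hij' : C i' + C j' = γ)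
    (hγ : ¬ IsShortSum γ)
    {x y z w x' y' z' w' : Fin m → ℤ} (hx : x ∈ shortVectors m) (hy : y ∈ shortVectors m)
    (hz : z ∈ shortVectors m) (hw : w ∈ shortVectors m) (hi : C i = x + y) (hj : C j = z + w)
    (hx' : x' ∈ shortVectors m) (hy' : y' ∈ shortVectors m)
    (hz' : z' ∈ shortVectors m) (hw' : w' ∈ shortVectors m) (hi' : C i' = x' + y')
    (hj' : C j' = z' + w') :
    ({x, y, z, w} : Multiset (Fin m → ℤ)) = {x', y', z', w'} := by
  refine (h.exists_quad hij hγ hx hy hz hw hi hj).eq_of_sum_eq ?_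
    (h.exists_quad hij' hγ hx' hy' hz' hw' hi' hj') ?_ rfl ?_
  · intro a ha
    simp only [Multiset.insert_eq_cons, Multiset.mem_cons, Multiset.mem_singleton] at ha
    rcases ha with rfl | rfl | rfl | rfl <;> assumption
  · intro a ha
    simp only [Multiset.insert_eq_cons, Multiset.mem_cons, Multiset.mem_singleton] at ha
    rcases ha with rfl | rfl | rfl | rfl <;> assumption
  · simp only [Multiset.insert_eq_cons, Multiset.sum_cons, Multiset.sum_singleton]
    rw [← add_assoc, ← add_assoc x', ← hi, ← hi', ← hj, ← hj', hij, hij']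

open Classical in
theorem card_fiber_le {γ : Fin m → ℤ} {S : Finset (Fin m → ℤ)}
    (hS : ∀ i j, C i + C j = γ → C i ∈ S) :
    ((posPairs b).filter (fun q => C q.1 + C q.2 = γ)).card ≤ S.card := by
  refine Finset.card_le_card_of_injOn (fun q => C q.1)
    (fun q hq => hS q.1 q.2 (Finset.mem_filter.1 hq).2) ?_
  intro q hq q' hq' hqq
  have h1 := (Finset.mem_filter.1 hq).2
  have h2 := (Finset.mem_filter.1 hq').2
  simp only at hqq
  rw [← h2, hqq, add_right_inj] at h1
  exact Prod.ext (h.injective hqq) (h.injective h1)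

open Classical in
theorem card_diag_le (γ : Fin m → ℤ) :
    ((posPairs b).filter (fun q => C q.1 + C q.2 = γ ∧ q.1 = q.2)).card ≤ 1 := by
  rw [Finset.card_le_one]
  rintro ⟨i, j⟩ hq ⟨k, l⟩ hq'
  obtain ⟨-, h1, h2⟩ := Finset.mem_filter.1 hq
  obtain ⟨-, h3, h4⟩ := Finset.mem_filter.1 hq'
  simp only at h1 h2 h3 h4
  subst h2 h4
  have : C i = C k := by
    funext t
    have := congrFun (h1.trans h3.symm) t
    simp at this
    omega
  rw [h.injective this]

open Classical in
-- The four short vectors in a decomposition of γ are determined by γ, and the first root is the sum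
-- of two of them: 6 = 4 choose 2.
theorem card_fiber_le_six {γ : Fin m → ℤ} (hγ : ¬ IsShortSum γ) :
    ((posPairs b).filter (fun q => C q.1 + C q.2 = γ)).card ≤ 6 := by
  by_cases hne : ∃ i j, C i + C j = γ
  · obtain ⟨i, j, hij⟩ := hne
    obtain ⟨x, hx, y, hy, hi⟩ := h.isShortSum i
    obtain ⟨z, hz, w, hw, hj⟩ := h.isShortSum j
    have hcard : (((Multiset.powersetCard 2 {x, y, z, w}).map Multiset.sum).toFinset).card ≤ 6 := by
      refine (Multiset.toFinset_card_le _).trans (le_of_eq ?_)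
      rw [Multiset.card_map, Multiset.card_powersetCard]
      rfl
    refine (h.card_fiber_le fun k l hkl => ?_).trans hcard
    obtain ⟨x', hx', y', hy', hk⟩ := h.isShortSum k
    obtain ⟨z', hz', w', hw', hl⟩ := h.isShortSum l
    rw [Multiset.mem_toFinset, Multiset.mem_map]
    refine ⟨{x', y'}, ?_, by simp [hk]⟩
    rw [Multiset.mem_powersetCard]
    refine ⟨?_, rfl⟩
    rw [h.quad_eq hij hkl hγ hx hy hz hw hi hj hx' hy' hz' hw' hk hl]
    exact Multiset.le_add_right {x', y'} {z', w'}
  · rw [Finset.card_eq_zero.2]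
    · norm_num
    · refine Finset.filter_eq_empty_iff.2 fun q _ hq => hne ⟨q.1, q.2, hq⟩

end ShortEmbedding

theorem single_ne_neg_single {m : ℕ} (k l : Fin m) :
    (Pi.single k 1 : Fin m → ℤ) ≠ -Pi.single l 1 := by
  intro h
  have := congrFun h k
  rw [Pi.single_eq_same, Pi.neg_apply, Pi.single_apply] at this
  split_ifs at this <;> omega

/-- The multiset {u, -v} is determined by x = u - v, and its two orderings are u - v and (-v) -
(-u). -/
theorem card_shortVectors_sub_le {m : ℕ} {x : Fin m → ℤ} (hx : x ≠ 0) :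
    ((shortVectors m ×ˢ shortVectors m).filter (fun p => p.1 - p.2 = x)).card ≤ 2 := by
  by_cases hne : ((shortVectors m ×ˢ shortVectors m).filter (fun p => p.1 - p.2 = x)).Nonempty
  · obtain ⟨⟨u, v⟩, huv⟩ := hne
    obtain ⟨h1, h2⟩ := Finset.mem_filter.1 huv
    obtain ⟨hu, hv⟩ := Finset.mem_product.1 h1
    simp only at hu hv h2
    refine (Finset.card_le_card (t := {(u, v), (-v, -u)}) ?_).trans Finset.card_le_two
    rintro ⟨u', v'⟩ huv'
    obtain ⟨h1', h2'⟩ := Finset.mem_filter.1 huv'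
    obtain ⟨hu', hv'⟩ := Finset.mem_product.1 h1'
    simp only at hu' hv' h2'
    have hs : ∀ u v : Fin m → ℤ, u ∈ shortVectors m → v ∈ shortVectors m →
        ∀ a ∈ ({u, -v} : Multiset (Fin m → ℤ)), a ∈ shortVectors m := by
      intro u v hu hv a ha
      simp only [Multiset.insert_eq_cons, Multiset.mem_cons, Multiset.mem_singleton] at ha
      rcases ha with rfl | rfl
      · exact hu
      · exact neg_mem_shortVectors hv
    have heq : ({u', -v'} : Multiset (Fin m → ℤ)) = {u, -v} :=
      (isNoncancelling_pair (by rwa [← sub_eq_add_neg, h2'])).eq_of_sum_eq (hs _ _ hu' hv')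
        (isNoncancelling_pair (by rwa [← sub_eq_add_neg, h2])) (hs _ _ hu hv) rfl (by
          simp only [Multiset.insert_eq_cons, Multiset.sum_cons, Multiset.sum_singleton,
            ← sub_eq_add_neg, h2, h2'])
    have hmem : u' ∈ ({u, -v} : Multiset (Fin m → ℤ)) := heq ▸ Multiset.mem_cons_self _ _
    simp only [Multiset.insert_eq_cons, Multiset.mem_cons, Multiset.mem_singleton] at hmem
    simp only [Finset.mem_insert, Finset.mem_singleton, Prod.mk.injEq]
    rcases hmem with rfl | rfl
    · exact Or.inl ⟨rfl, sub_right_injective (h2'.trans h2.symm)⟩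
    · refine Or.inr ⟨rfl, ?_⟩
      have := h2'.trans h2.symm
      have h3 : v' = -v - (u - v) := by rw [← this]; abel
      rw [h3]; abel
  · rw [Finset.not_nonempty_iff_eq_empty.1 hne]
    simp

/-- The reversed difference is excluded here, since -e_l is not a unit vector. -/
theorem card_single_sub_le {m : ℕ} (x : Fin m → ℤ) :
    (((Finset.univ.image fun k : Fin m => (Pi.single k 1 : Fin m → ℤ)) ×ˢ
      (Finset.univ.image fun k : Fin m => (Pi.single k 1 : Fin m → ℤ))).filter
        (fun p => p.1 - p.2 = x ∧ x ≠ 0)).card ≤ 1 := by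
  have hmem : ∀ k : Fin m, (Pi.single k 1 : Fin m → ℤ) ∈ shortVectors m := fun k =>
    mem_shortVectors.2 (Or.inr (Or.inl ⟨k, rfl⟩))
  have hs : ∀ k l : Fin m, ∀ a ∈ ({Pi.single k 1, -Pi.single l 1} : Multiset (Fin m → ℤ)),
      a ∈ shortVectors m := by
    intro k l a ha
    simp only [Multiset.insert_eq_cons, Multiset.mem_cons, Multiset.mem_singleton] at ha
    rcases ha with rfl | rfl
    · exact hmem k
    · exact neg_mem_shortVectors (hmem l)
  rw [Finset.card_le_one]
  rintro ⟨u, v⟩ hp ⟨u', v'⟩ hp'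
  simp only [Finset.mem_filter, Finset.mem_product, Finset.mem_image, Finset.mem_univ, true_and] at hp hp'
  obtain ⟨⟨⟨k, rfl⟩, l, rfl⟩, h1, hx⟩ := hp
  obtain ⟨⟨⟨k', rfl⟩, l', rfl⟩, h2, -⟩ := hp'
  have heq : ({Pi.single k 1, -Pi.single l 1} : Multiset (Fin m → ℤ)) =
      {Pi.single k' 1, -Pi.single l' 1} :=
    (isNoncancelling_pair (by rwa [← sub_eq_add_neg, h1])).eq_of_sum_eq (hs _ _)
      (isNoncancelling_pair (by rwa [← sub_eq_add_neg, h2])) (hs _ _) rfl (by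
        simp only [Multiset.insert_eq_cons, Multiset.sum_cons, Multiset.sum_singleton,
          ← sub_eq_add_neg, h1, h2])
  have hmem' : (Pi.single k 1 : Fin m → ℤ) ∈
      ({Pi.single k' 1, -Pi.single l' 1} : Multiset (Fin m → ℤ)) := heq ▸ Multiset.mem_cons_self _ _
  simp only [Multiset.insert_eq_cons, Multiset.mem_cons, Multiset.mem_singleton] at hmem'
  have hk : (Pi.single k 1 : Fin m → ℤ) = Pi.single k' 1 :=
    hmem'.resolve_right (single_ne_neg_single k l')
  rw [Prod.mk.injEq]
  refine ⟨hk, ?_⟩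
  rw [← h2, hk] at h1
  exact sub_right_injective h1

namespace ShortEmbedding
variable (h : ShortEmbedding b C)
include h

theorem add_ne_zero {i j : ι} (hi : b.IsPos i) (hj : b.IsPos j) : C i + C j ≠ 0 := by
  intro h0
  have h1 : i = P.reflectionPerm j j := h.injective (by rw [h.neg]; exact eq_neg_of_add_eq_zero_left h0)
  rw [h1] at hi
  exact (RootPairing.Base.IsPos.neg_iff_not b j).1 hi hj

open Classical in
theorem zero_notMem_image : (0 : Fin m → ℤ) ∉
    ((posPairs b).image fun q => C q.1 + C q.2).filter IsShortSum := by
  intro h0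
  obtain ⟨q, hq, h1⟩ := Finset.mem_image.1 (Finset.mem_filter.1 h0).1
  have h2 := (Finset.mem_filter.1 hq).2
  exact h.add_ne_zero h2.1 h2.2 h1

/-- The vector that cancels between the two roots is the middle vertex z. Short vectors are closed
under negation, so every case can be written with i before j. -/
theorem exists_path {i j : ι} (hij : IsShortSum (C i + C j)) :
    ∃ x ∈ shortVectors m, ∃ y ∈ shortVectors m, ∃ z ∈ shortVectors m,
      C i = x - z ∧ C j = z - y ∧ x - y = C i + C j := by
  obtain ⟨x, hx, y, hy, hi⟩ := h.isShortSum i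
  obtain ⟨z, hz, w, hw, hj⟩ := h.isShortSum j
  obtain ⟨u, hu, v, hv, huv⟩ := hij
  rw [hi, hj] at huv
  have key := exists_cancel hx hy hz hw (hi ▸ h.ne_zero i) (hj ▸ h.ne_zero j) hu hv huv
  rcases key with h0 | h0 | h0 | h0
  · have h1 := eq_neg_of_add_eq_zero_left h0
    exact ⟨y, hy, -w, neg_mem_shortVectors hw, z, hz, by rw [hi, h1]; abel, by rw [hj]; abel,
      by rw [hi, hj, h1]; abel⟩
  · have h1 := eq_neg_of_add_eq_zero_left h0
    exact ⟨y, hy, -z, neg_mem_shortVectors hz, w, hw, by rw [hi, h1]; abel, by rw [hj]; abel,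
      by rw [hi, hj, h1]; abel⟩
  · have h1 := eq_neg_of_add_eq_zero_left h0
    exact ⟨x, hx, -w, neg_mem_shortVectors hw, z, hz, by rw [hi, h1]; abel, by rw [hj]; abel,
      by rw [hi, hj, h1]; abel⟩
  · have h1 := eq_neg_of_add_eq_zero_left h0
    exact ⟨x, hx, -z, neg_mem_shortVectors hz, w, hw, by rw [hi, h1]; abel, by rw [hj]; abel,
      by rw [hi, hj, h1]; abel⟩

theorem isPairBound_of_shortEmbedding : IsPairBound b 24 := by
  classical
  -- K₁ = 2³, from multiplicity N = 2 in the path estimate. K₂ covers at most 6 pairs and one extra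
  -- for the diagonal. The total is 2·8 + 8.
  have key := h.isPairBound (K₁ := 8) (K₂ := 8) ?_ fun γ hγ => ?_
  · norm_num at key
    exact key
  · intro a c ha0 hc0 ha hc
    obtain ⟨A, hA, hA0, hAX, hA1, hAC⟩ := h.exists_extension a ha0 ha
    obtain ⟨B, hB, hB0, hBX, hB1, hBC⟩ := h.exists_extension c hc0 hc
    have h1 := sum_pathSum_sq_le (fun x hx => card_shortVectors_sub_le hx) hA0 hB0 hAX hBX hA1 hB1
      h.zero_notMem_image
    refine le_trans (Finset.sum_le_sum fun γ hγ => ?_) (h1.trans (by norm_num))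
    refine pow_le_pow_left₀ (Finset.sum_nonneg fun q _ => mul_nonneg (ha0 _) (hc0 _)) ?_ 2
    rw [Finset.sum_congr rfl (g := fun q => A (C q.1) * B (C q.2)) fun q hq => by
      have h2 := (Finset.mem_filter.1 (Finset.mem_filter.1 hq).1).2
      rw [hAC _ h2.1, hBC _ h2.2]]
    refine sum_mul_le_pathSum _ _ _ hA hB (fun q hq => ?_) fun q _ q' _ h1 h2 =>
      Prod.ext (h.injective h1) (h.injective h2)
    have h2 := (Finset.mem_filter.1 hq).2
    rw [← h2]
    exact h.exists_path (h2 ▸ (Finset.mem_filter.1 hγ).2)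
  · have h1 := h.card_fiber_le_six hγ
    have h2 := h.card_diag_le γ
    omega

end ShortEmbedding

/-! ### The sharper bound for type A -/

section TypeA
variable (h : ShortEmbedding b C) (hC : ∀ i, ∃ k l, C i = Pi.single k 1 - Pi.single l 1)
include h hC

/-- Only e_k and -e_l of different roots can cancel. Unit vectors are not closed under negation, so
the order of the two roots along the path is forced. -/
theorem ShortEmbedding.exists_path_or {i j : ι} (hij : IsShortSum (C i + C j)) :
    (∃ k l t, C i = Pi.single k 1 - Pi.single t 1 ∧ C j = Pi.single t 1 - Pi.single l 1) ∨
    ∃ k l t, C j = Pi.single k 1 - Pi.single t 1 ∧ C i = Pi.single t 1 - Pi.single l 1 := by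
  have hmem : ∀ k : Fin m, (Pi.single k 1 : Fin m → ℤ) ∈ shortVectors m := fun k =>
    mem_shortVectors.2 (Or.inr (Or.inl ⟨k, rfl⟩))
  obtain ⟨k, l, hi⟩ := hC i
  obtain ⟨k', l', hj⟩ := hC j
  obtain ⟨u, hu, v, hv, huv⟩ := hij
  rw [hi, hj] at huv
  rcases exists_cancel (hmem k) (neg_mem_shortVectors (hmem l)) (hmem k')
    (neg_mem_shortVectors (hmem l')) (by rw [← sub_eq_add_neg, ← hi]; exact h.ne_zero i)
    (by rw [← sub_eq_add_neg, ← hj]; exact h.ne_zero j) hu hv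
    (by rw [← sub_eq_add_neg, ← sub_eq_add_neg, huv]) with h0 | h0 | h0 | h0
  · exact absurd (eq_neg_of_add_eq_zero_left h0) (single_ne_neg_single k k')
  · rw [← sub_eq_add_neg, sub_eq_zero] at h0
    exact Or.inr ⟨k', l, k, by rw [hj, h0], hi⟩
  · rw [neg_add_eq_zero] at h0
    exact Or.inl ⟨k, l', k', by rw [hi, h0], hj⟩
  · exact absurd (neg_eq_iff_add_eq_zero.2 (by rw [add_comm, ← neg_eq_zero]; rw [← h0]; abel) )
      (single_ne_neg_single l l').symm

theorem ShortEmbedding.isPairBound_of_single_sub_single : IsPairBound b 12 := by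
  classical
  -- Now N = 1, but both orders of the matrix product occur: (s + t)² ≤ 2s² + 2t² gives K₁ = 2 + 2.
  -- The total is 2·4 + 4.
  have key := h.isPairBound (K₁ := 4) (K₂ := 4) ?_ fun γ hγ => ?_
  · norm_num at key
    exact key
  · intro a c ha0 hc0 ha hc
    obtain ⟨A, hA, hA0, hAX, hA1, hAC⟩ := h.exists_extension a ha0 ha
    obtain ⟨B, hB, hB0, hBX, hB1, hBC⟩ := h.exists_extension c hc0 hc
    set Λ : Finset (Fin m → ℤ) := Finset.univ.image fun k : Fin m => (Pi.single k 1 : Fin m → ℤ)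
    have hN : ∀ x : Fin m → ℤ, x ≠ 0 →
        ((Λ ×ˢ Λ).filter (fun p => p.1 - p.2 = x)).card ≤ 1 := by
      intro x hx
      have := card_single_sub_le x
      simpa only [ne_eq, hx, not_false_eq_true, and_true] using this
    have hΛ : ∀ k, (Pi.single k 1 : Fin m → ℤ) ∈ Λ := fun k =>
      Finset.mem_image_of_mem _ (Finset.mem_univ _)
    have h1 := sum_pathSum_sq_le hN hA0 hB0 hAX hBX hA1 hB1 h.zero_notMem_image
    have h2 := sum_pathSum_sq_le hN hB0 hA0 hBX hAX hB1 hA1 h.zero_notMem_image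
    have h3 : ∀ γ ∈ ((posPairs b).image fun q => C q.1 + C q.2).filter IsShortSum,
        (∑ q ∈ (posPairs b).filter (fun q => C q.1 + C q.2 = γ), a q.1 * c q.2) ^ 2 ≤
          2 * pathSum Λ A B γ ^ 2 + 2 * pathSum Λ B A γ ^ 2 := by
      intro γ hγ
      set F := (posPairs b).filter (fun q => C q.1 + C q.2 = γ)
      have hF : ∀ q ∈ F, C q.1 + C q.2 = γ := fun q hq => (Finset.mem_filter.1 hq).2
      let p : ι × ι → Prop := fun q =>
        ∃ k l t, C q.1 = Pi.single k 1 - Pi.single t 1 ∧ C q.2 = Pi.single t 1 - Pi.single l 1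
      have e1 : ∑ q ∈ F, a q.1 * c q.2 = ∑ q ∈ F with p q, A (C q.1) * B (C q.2) +
          ∑ q ∈ F with ¬ p q, B (C q.2) * A (C q.1) := by
        rw [← Finset.sum_filter_add_sum_filter_not F p]
        congr 1 <;> refine Finset.sum_congr rfl fun q hq => ?_
        all_goals
          have h2 := (Finset.mem_filter.1 (Finset.mem_filter.1 (Finset.mem_filter.1 hq).1).1).2
          rw [hAC _ h2.1, hBC _ h2.2]
        rw [mul_comm]
      have e2 : ∑ q ∈ F with p q, A (C q.1) * B (C q.2) ≤ pathSum Λ A B γ := by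
        refine sum_mul_le_pathSum _ _ _ hA hB (fun q hq => ?_) fun q _ q' _ h1 h2 =>
          Prod.ext (h.injective h1) (h.injective h2)
        obtain ⟨hq1, k, l, t, h4, h5⟩ := Finset.mem_filter.1 hq
        refine ⟨_, hΛ k, _, hΛ l, _, hΛ t, h4, h5, ?_⟩
        rw [← hF q hq1, h4, h5]; abel
      have e3 : ∑ q ∈ F with ¬ p q, B (C q.2) * A (C q.1) ≤ pathSum Λ B A γ := by
        refine sum_mul_le_pathSum _ (fun q => C q.2) (fun q => C q.1) hB hA (fun q hq => ?_)
          fun q _ q' _ h1 h2 => Prod.ext (h.injective h2) (h.injective h1)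
        obtain ⟨hq1, hq2⟩ := Finset.mem_filter.1 hq
        obtain ⟨k, l, t, h4, h5⟩ := (h.exists_path_or hC
          ((hF q hq1).symm ▸ (Finset.mem_filter.1 hγ).2)).resolve_left hq2
        refine ⟨_, hΛ k, _, hΛ l, _, hΛ t, h4, h5, ?_⟩
        rw [← hF q hq1, h4, h5]; abel
      have e4 : 0 ≤ ∑ q ∈ F, a q.1 * c q.2 := Finset.sum_nonneg fun q _ => mul_nonneg (ha0 _) (hc0 _)
      have e5 : ∑ q ∈ F, a q.1 * c q.2 ≤ pathSum Λ A B γ + pathSum Λ B A γ := by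
        rw [e1]; exact add_le_add e2 e3
      nlinarith [sq_nonneg (pathSum Λ A B γ - pathSum Λ B A γ)]
    refine (Finset.sum_le_sum h3).trans ?_
    rw [Finset.sum_add_distrib, ← Finset.mul_sum, ← Finset.mul_sum]
    norm_num at h1 h2 ⊢
    linarith
  · have hmem : ∀ k : Fin m, (Pi.single k 1 : Fin m → ℤ) ∈ shortVectors m := fun k =>
      mem_shortVectors.2 (Or.inr (Or.inl ⟨k, rfl⟩))
    -- The multiset e_k, -e_l, e_k', -e_l' is determined by γ, and a root takes one positive and one
    -- negative vector from it, which leaves four choices.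
    have hfib : ∀ {k l k' l' : Fin m} {i j i' j' : ι}, C i + C j = γ →
        C i = Pi.single k 1 - Pi.single l 1 → C j = Pi.single k' 1 - Pi.single l' 1 →
        C i' + C j' = γ → C i' ∈ ({Pi.single k 1 - Pi.single l 1, Pi.single k 1 - Pi.single l' 1,
          Pi.single k' 1 - Pi.single l 1, Pi.single k' 1 - Pi.single l' 1} : Finset (Fin m → ℤ)) := by
      intro k l k' l' i j i' j' hij hi hj hij'
      obtain ⟨s, t, hi'⟩ := hC i'
      obtain ⟨s', t', hj'⟩ := hC j'
      have heq := h.quad_eq hij' hij hγ (hmem s) (neg_mem_shortVectors (hmem t)) (hmem s')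
        (neg_mem_shortVectors (hmem t')) (by rw [hi', sub_eq_add_neg]) (by rw [hj', sub_eq_add_neg])
        (hmem k) (neg_mem_shortVectors (hmem l)) (hmem k') (neg_mem_shortVectors (hmem l'))
        (by rw [hi, sub_eq_add_neg]) (by rw [hj, sub_eq_add_neg])
      have h1 : (Pi.single s 1 : Fin m → ℤ) ∈ ({Pi.single k 1, -Pi.single l 1, Pi.single k' 1,
          -Pi.single l' 1} : Multiset (Fin m → ℤ)) := heq ▸ Multiset.mem_cons_self _ _
      have h2 : (-Pi.single t 1 : Fin m → ℤ) ∈ ({Pi.single k 1, -Pi.single l 1, Pi.single k' 1,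
          -Pi.single l' 1} : Multiset (Fin m → ℤ)) :=
        heq ▸ Multiset.mem_cons_of_mem (Multiset.mem_cons_self _ _)
      simp only [Multiset.insert_eq_cons, Multiset.mem_cons, Multiset.mem_singleton,
        single_ne_neg_single, false_or, or_false, neg_inj] at h1 h2
      have h3 : ∀ r, -Pi.single t 1 ≠ (Pi.single r 1 : Fin m → ℤ) := fun r =>
        (single_ne_neg_single r t).symm
      simp only [h3, false_or] at h2
      rw [hi']
      rcases h1 with h1 | h1 <;> rcases h2 with h2 | h2 <;> rw [h1, h2] <;> simp
    -- On the diagonal the four choices coincide, so the count is at most 1 + 1; off it there is no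
    -- extra term.
    by_cases hdiag : ∃ i, C i + C i = γ
    · obtain ⟨i, hii⟩ := hdiag
      obtain ⟨k, l, hi⟩ := hC i
      have h1 := h.card_diag_le γ
      have h2 : ((posPairs b).filter (fun q => C q.1 + C q.2 = γ)).card ≤ 1 := by
        refine (h.card_fiber_le (S := {C i}) fun i' j' hij' => ?_).trans (by simp)
        have := hfib hii hi hi hij'
        simpa [hi] using this
      omega
    · have h1 : (posPairs b).filter (fun q => C q.1 + C q.2 = γ ∧ q.1 = q.2) = ∅ :=
        Finset.filter_eq_empty_iff.2 fun q _ hq => hdiag ⟨q.1, by rw [← hq.1, ← hq.2]⟩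
      rw [h1, Finset.card_empty, add_zero]
      by_cases hne : ∃ i j, C i + C j = γ
      · obtain ⟨i, j, hij⟩ := hne
        obtain ⟨k, l, hi⟩ := hC i
        obtain ⟨k', l', hj⟩ := hC j
        exact (h.card_fiber_le fun i' j' hij' => hfib hij hi hj hij').trans Finset.card_le_four
      · rw [Finset.card_eq_zero.2]
        · norm_num
        · exact Finset.filter_eq_empty_iff.2 fun q _ hq => hne ⟨q.1, q.2, hq⟩

end TypeA
end Classical

/-! ### Standard models of the classical root systems -/

section Embedding
open Matrix
variable {ι R M N : Type*} [Fintype ι] [Field R] [CharZero R] [AddCommGroup M] [Module R M]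
  [AddCommGroup N] [Module R N] {P : RootPairing ι R M N} [P.IsCrystallographic] [P.IsRootSystem]
  [P.IsReduced]
  {b : P.Base} {n : ℕ} {A : Matrix (Fin n) (Fin n) ℤ}

/-- The simple coroots span and the pairing is perfect, so the Cartan matrix is nondegenerate. This
makes the models in ℤ^m injective. -/
theorem RootCoordinates.eq_zero_of_forall_sum_mul_eq_zero (X : RootCoordinates b A) {x : Fin n → ℤ}
    (hx : ∀ l, ∑ k, x k * A k l = 0) : x = 0 := by
  have h1 : P.toLinearMap (∑ k, x k • P.root (X.simple k)) = 0 := by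
    have hspan : (⊤ : Submodule R N) ≤ Submodule.span R (P.coroot '' b.support) := by
      rw [b.span_coroot_support]
      exact RootPairing.IsRootSystem.span_coroot_eq_top.ge
    ext z
    have hz := hspan (Submodule.mem_top (x := z))
    induction hz using Submodule.span_induction with
    | mem z hz =>
      obtain ⟨i, hi, rfl⟩ := hz
      obtain ⟨l, rfl⟩ := X.exists_simple i hi
      have h2 := congrArg (algebraMap ℤ R) (hx l)
      simp only [map_sum, map_mul, ← X.pairingIn_simple, P.algebraMap_pairingIn, map_zero] at h2
      simp only [map_sum, map_zsmul, LinearMap.sum_apply, LinearMap.smul_apply,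
        P.root_coroot_eq_pairing, LinearMap.zero_apply, zsmul_eq_mul]
      simpa using h2
    | zero => simp
    | add y z _ _ hy hz => rw [map_add, hy, hz]; simp
    | smul c z _ hz => rw [map_smul, hz]; simp
  have h2 : ∑ k, x k • P.root (X.simple k) = 0 := by
    apply (LinearMap.IsPerfPair.bijective_left (p := P.toLinearMap)).1
    rw [h1, map_zero]
  exact X.sum_smul_root_injective (a₂ := 0) (by simpa using h2)

/-- The vectors s and v model simple roots and coroots. Differences of elements of Λ are preserved
by the simple reflections and contain the simple roots, hence contain all roots. -/
theorem RootCoordinates.shortEmbedding (X : RootCoordinates b A) {m : ℕ} {s v : Fin n → Fin m → ℤ}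
    (hsv : ∀ k l, s k ⬝ᵥ v l = A k l) {Λ : Set (Fin m → ℤ)}
    (hΛ : ∀ u ∈ Λ, u ∈ shortVectors m)
    (hs : ∀ l, ∃ u ∈ Λ, ∃ w ∈ Λ, s l = u - w)
    (hrefl : ∀ l, ∀ u ∈ Λ, u - (u ⬝ᵥ v l) • s l ∈ Λ) :
    ShortEmbedding b (fun i => ∑ k, X.coord i k • s k) ∧
      ∀ i, ∃ u ∈ Λ, ∃ w ∈ Λ, ∑ k, X.coord i k • s k = u - w := by
  have hdot : ∀ (x : Fin n → ℤ) l, (∑ k, x k • s k) ⬝ᵥ v l = ∑ k, x k * A k l := by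
    intro x l
    rw [sum_dotProduct]
    exact Finset.sum_congr rfl fun k _ => by rw [smul_dotProduct, hsv, smul_eq_mul]
  have hinj : ∀ x : Fin n → ℤ, ∑ k, x k • s k = 0 → x = 0 := by
    intro x hx
    apply X.eq_zero_of_forall_sum_mul_eq_zero
    intro l
    rw [← hdot, hx, zero_dotProduct]
  have hinj' : Function.Injective fun x : Fin n → ℤ => ∑ k, x k • s k := by
    intro x y hxy
    refine sub_eq_zero.1 (hinj _ ?_)
    simpa [sub_smul, Finset.sum_sub_distrib, sub_eq_zero] using hxy
  have hneg : ∀ i, ∑ k, X.coord (P.reflectionPerm i i) k • s k = -∑ k, X.coord i k • s k := by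
    intro i
    rw [X.coord_reflectionPerm_self]
    simp
  have hmem : ∀ i, ∃ u ∈ Λ, ∃ w ∈ Λ, ∑ k, X.coord i k • s k = u - w := by
    intro i
    induction i using b.induction_reflect with
    | h₀ i hi =>
      obtain ⟨u, hu, w, hw, h⟩ := hi
      exact ⟨w, hw, u, hu, by rw [hneg, h, neg_sub]⟩
    | h₁ i hi =>
      obtain ⟨l, rfl⟩ := X.exists_simple i hi
      obtain ⟨u, hu, w, hw, h⟩ := hs l
      refine ⟨u, hu, w, hw, ?_⟩
      rw [X.coord_simple, ← h]
      simp [Pi.single_apply]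
    | h₂ i j hi hj =>
      obtain ⟨l, rfl⟩ := X.exists_simple j hj
      obtain ⟨u, hu, w, hw, h⟩ := hi
      refine ⟨_, hrefl l u hu, _, hrefl l w hw, ?_⟩
      have h1 := hdot (X.coord i) l
      rw [X.coord_reflectionPerm, ← h1, h, sub_dotProduct]
      simp only [Pi.sub_apply, sub_smul, Finset.sum_sub_distrib, h]
      have h2 : ∑ k, (Pi.single l (u ⬝ᵥ v l - w ⬝ᵥ v l) : Fin n → ℤ) k • s k =
          (u ⬝ᵥ v l - w ⬝ᵥ v l) • s l := by
        rw [Finset.sum_eq_single l]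
        · rw [Pi.single_eq_same]
        · intro k _ hk; rw [Pi.single_eq_of_ne hk, zero_smul]
        · simp
      rw [h2, sub_smul]
      abel
  refine ⟨⟨fun i j hij => X.coord_injective (hinj' hij), fun i hi => ?_, fun i j k l => ?_,
    fun i j k h => ?_, hneg, fun i => ?_⟩, hmem⟩
  · apply P.ne_zero i
    rw [X.root_eq, hinj _ hi]
    simp
  · rw [X.root_add_root_eq_iff, ← hinj'.eq_iff]
    simp only [Pi.add_apply, add_smul, Finset.sum_add_distrib]
  · rw [X.root_eq_add_iff] at h
    simp only [h, Pi.add_apply, add_smul, Finset.sum_add_distrib]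
  · obtain ⟨u, hu, w, hw, h⟩ := hmem i
    exact ⟨u, hΛ u hu, -w, neg_mem_shortVectors (hΛ w hw), by rw [h, sub_eq_add_neg]⟩

/-- The `a`-th unit vector of `ℤ^m`, which is zero if `m ≤ a`. -/
def unitVec (m a : ℕ) : Fin m → ℤ := fun t => if t.val = a then 1 else 0

theorem unitVec_eq_single {m a : ℕ} (h : a < m) : unitVec m a = Pi.single ⟨a, h⟩ 1 := by
  ext t
  simp [unitVec, Pi.single_apply, Fin.ext_iff]

theorem unitVec_dotProduct (m a c : ℕ) :
    unitVec m a ⬝ᵥ unitVec m c = if a = c ∧ a < m then 1 else 0 := by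
  by_cases h : a < m
  · rw [unitVec_eq_single h, single_one_dotProduct]
    simp [unitVec, h]
  · have : unitVec m a = 0 := by
      ext t
      have := t.2
      simp only [unitVec, Pi.zero_apply, ite_eq_right_iff]
      omega
    rw [this, zero_dotProduct, if_neg (by tauto)]

theorem unitVec_mem_shortVectors (m a : ℕ) : unitVec m a ∈ shortVectors m := by
  rw [mem_shortVectors]
  by_cases h : a < m
  · exact Or.inr (Or.inl ⟨_, unitVec_eq_single h⟩)
  · left
    ext t
    have := t.2
    simp only [unitVec, Pi.zero_apply, ite_eq_right_iff]
    omega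

theorem exists_reflect_unitVec {m a k : ℕ} (hk : k + 1 < m) (ha : a < m) : ∃ c < m,
    unitVec m a - (unitVec m a ⬝ᵥ (unitVec m k - unitVec m (k + 1))) •
      (unitVec m k - unitVec m (k + 1)) = unitVec m c := by
  rw [dotProduct_sub, unitVec_dotProduct, unitVec_dotProduct]
  by_cases h1 : a = k
  · subst h1
    refine ⟨a + 1, hk, ?_⟩
    simp [ha]
  · by_cases h2 : a = k + 1
    · subst h2
      refine ⟨k, by omega, ?_⟩
      simp [hk]
    · exact ⟨a, ha, by simp [h1, h2]⟩

theorem reflect_mem_shortVectors {m : ℕ} {s v : Fin m → ℤ}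
    (h : ∀ a < m, unitVec m a - (unitVec m a ⬝ᵥ v) • s ∈ shortVectors m) {u : Fin m → ℤ}
    (hu : u ∈ shortVectors m) : u - (u ⬝ᵥ v) • s ∈ shortVectors m := by
  rcases mem_shortVectors.1 hu with rfl | ⟨k, rfl⟩ | ⟨k, rfl⟩
  · simpa using hu
  · have := h k.1 k.2
    rwa [unitVec_eq_single k.2] at this
  · have := neg_mem_shortVectors (h k.1 k.2)
    rw [unitVec_eq_single k.2] at this
    rw [Pi.single_neg, neg_dotProduct, neg_smul]
    convert this using 1
    abel

theorem isPairBound_A (h : HasCartanMatrix b (CartanMatrix.A n)) : IsPairBound b 12 := by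
  obtain ⟨X⟩ := h.nonempty_rootCoordinates
  obtain ⟨h1, h2⟩ := X.shortEmbedding (m := n + 1) (s := fun k => unitVec _ k - unitVec _ (k + 1))
    (v := fun k => unitVec _ k - unitVec _ (k + 1)) (Λ := {u | ∃ a < n + 1, u = unitVec _ a})
    (fun k l => by
      have hk := k.2
      have hl := l.2
      simp only [sub_dotProduct, dotProduct_sub, unitVec_dotProduct, CartanMatrix.A, Matrix.of_apply,
        Fin.ext_iff]
      split_ifs <;> omega)
    (by rintro _ ⟨a, -, rfl⟩; exact unitVec_mem_shortVectors _ _)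
    (fun l => ⟨_, ⟨l, by omega, rfl⟩, _, ⟨l + 1, by omega, rfl⟩, rfl⟩)
    (by
      rintro l _ ⟨a, ha, rfl⟩
      exact exists_reflect_unitVec (by omega) ha)
  refine h1.isPairBound_of_single_sub_single fun i => ?_
  obtain ⟨_, ⟨a, ha, rfl⟩, _, ⟨c, hc, rfl⟩, h3⟩ := h2 i
  exact ⟨⟨a, ha⟩, ⟨c, hc⟩, by rw [← unitVec_eq_single, ← unitVec_eq_single]; exact h3⟩

theorem reflect_unitVec_mem {m a k : ℕ} (hk : k + 1 < m) (ha : a < m) :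
    unitVec m a - (unitVec m a ⬝ᵥ (unitVec m k - unitVec m (k + 1))) •
      (unitVec m k - unitVec m (k + 1)) ∈ shortVectors m := by
  obtain ⟨c, -, h⟩ := exists_reflect_unitVec hk ha
  rw [h]
  exact unitVec_mem_shortVectors _ _

theorem unitVec_self (m : ℕ) : unitVec m m = 0 := by
  ext t
  have := t.2
  simp only [unitVec, Pi.zero_apply, ite_eq_right_iff]
  omega

theorem isPairBound_B (h : HasCartanMatrix b (CartanMatrix.B n)) : IsPairBound b 24 := by
  obtain ⟨X⟩ := h.nonempty_rootCoordinates
  -- Since `unitVec n n` is zero, the last simple root is the short root given by the last unit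
  -- vector. Its coroot is twice that vector.
  refine (X.shortEmbedding (m := n) (s := fun k => unitVec _ k - unitVec _ (k + 1))
    (v := fun k => if k.1 + 1 = n then (2 : ℤ) • unitVec _ k else unitVec _ k - unitVec _ (k + 1))
    (Λ := ↑(shortVectors n)) ?_ (fun _ h => h) ?_ ?_).1.isPairBound_of_shortEmbedding
  · intro k l
    have hk := k.2
    have hl := l.2
    by_cases hn : l.1 + 1 = n
    · simp only [if_pos hn, sub_dotProduct, dotProduct_sub, dotProduct_smul, unitVec_dotProduct,
        CartanMatrix.B, Matrix.of_apply, Fin.ext_iff, smul_eq_mul]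
      split_ifs <;> omega
    · simp only [if_neg hn, sub_dotProduct, dotProduct_sub, unitVec_dotProduct, CartanMatrix.B,
        Matrix.of_apply, Fin.ext_iff]
      split_ifs <;> omega
  · exact fun l => ⟨_, unitVec_mem_shortVectors _ _, _, unitVec_mem_shortVectors _ _, rfl⟩
  · refine fun l u hu => reflect_mem_shortVectors (fun a ha => ?_) hu
    by_cases hn : l.1 + 1 = n
    · rw [if_pos hn, hn, unitVec_self, sub_zero, dotProduct_smul, unitVec_dotProduct]
      split_ifs with h
      · rw [h.1, smul_eq_mul, mul_one, two_smul]
        convert neg_mem_shortVectors (unitVec_mem_shortVectors n l.1) using 1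
        abel
      · simpa using unitVec_mem_shortVectors n a
    · rw [if_neg hn]
      exact reflect_unitVec_mem (by omega) ha

theorem isPairBound_C (h : HasCartanMatrix b (CartanMatrix.C n)) : IsPairBound b 24 := by
  obtain ⟨X⟩ := h.nonempty_rootCoordinates
  refine (X.shortEmbedding (m := n) (v := fun k => unitVec _ k - unitVec _ (k + 1))
    (s := fun k => if k.1 + 1 = n then (2 : ℤ) • unitVec _ k else unitVec _ k - unitVec _ (k + 1))
    (Λ := ↑(shortVectors n)) ?_ (fun _ h => h) ?_ ?_).1.isPairBound_of_shortEmbedding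
  · intro k l
    have hk := k.2
    have hl := l.2
    by_cases hn : k.1 + 1 = n
    · simp only [if_pos hn, dotProduct_sub, smul_dotProduct, unitVec_dotProduct,
        CartanMatrix.C, Matrix.of_apply, Fin.ext_iff, smul_eq_mul]
      split_ifs <;> omega
    · simp only [if_neg hn, sub_dotProduct, dotProduct_sub, unitVec_dotProduct, CartanMatrix.C,
        Matrix.of_apply, Fin.ext_iff]
      split_ifs <;> omega
  · intro l
    by_cases hn : l.1 + 1 = n
    · refine ⟨_, unitVec_mem_shortVectors _ l, _, neg_mem_shortVectors (unitVec_mem_shortVectors _ l), ?_⟩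
      simp only [if_pos hn, two_smul, sub_neg_eq_add]
    · simp only [if_neg hn]
      exact ⟨_, unitVec_mem_shortVectors _ _, _, unitVec_mem_shortVectors _ _, rfl⟩
  · refine fun l u hu => reflect_mem_shortVectors (fun a ha => ?_) hu
    by_cases hn : l.1 + 1 = n
    · rw [if_pos hn, hn, unitVec_self, sub_zero, unitVec_dotProduct]
      split_ifs with h
      · rw [h.1, one_smul, two_smul]
        convert neg_mem_shortVectors (unitVec_mem_shortVectors n l.1) using 1
        abel
      · simpa using unitVec_mem_shortVectors n a
    · rw [if_neg hn]
      exact reflect_unitVec_mem (by omega) ha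

/-- The simple roots of type `D_n`. -/
def simpleRootD (n : ℕ) (k : Fin n) : Fin n → ℤ :=
  if k.1 + 1 = n then unitVec n (n - 2) + unitVec n (n - 1) else unitVec n k - unitVec n (k + 1)

theorem simpleRootD_of_eq (k : Fin n) (hk : k.1 + 1 = n) :
    simpleRootD n k = unitVec n (n - 2) + unitVec n (n - 1) := if_pos hk

theorem simpleRootD_of_ne (k : Fin n) (hk : ¬ k.1 + 1 = n) :
    simpleRootD n k = unitVec n k - unitVec n (k + 1) := if_neg hk

theorem simpleRootD_dotProduct_last_last (hn : 2 ≤ n) (k l : Fin n) (h : k.1 + 1 = n) (h' : l.1 + 1 = n) :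
    simpleRootD n k ⬝ᵥ simpleRootD n l = CartanMatrix.D n k l := by
  have hk := k.2
  have hl := l.2
  rw [simpleRootD_of_eq k h, simpleRootD_of_eq l h']
  simp only [add_dotProduct, dotProduct_add, unitVec_dotProduct, CartanMatrix.D, Matrix.of_apply,
    Fin.ext_iff]
  grind

theorem simpleRootD_dotProduct_last_ne (hn : 2 ≤ n) (k l : Fin n) (h : k.1 + 1 = n) (h' : ¬ l.1 + 1 = n) :
    simpleRootD n k ⬝ᵥ simpleRootD n l = CartanMatrix.D n k l := by
  have hk := k.2
  have hl := l.2
  rw [simpleRootD_of_eq k h, simpleRootD_of_ne l h']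
  simp only [add_dotProduct, dotProduct_sub, unitVec_dotProduct, CartanMatrix.D, Matrix.of_apply,
    Fin.ext_iff]
  grind

theorem simpleRootD_dotProduct_ne_ne (hn : 2 ≤ n) (k l : Fin n) (h : ¬ k.1 + 1 = n) (h' : ¬ l.1 + 1 = n) :
    simpleRootD n k ⬝ᵥ simpleRootD n l = CartanMatrix.D n k l := by
  have hk := k.2
  have hl := l.2
  rw [simpleRootD_of_ne k h, simpleRootD_of_ne l h']
  simp only [sub_dotProduct, dotProduct_sub, unitVec_dotProduct, CartanMatrix.D, Matrix.of_apply,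
    Fin.ext_iff]
  grind

theorem cartanMatrix_D_comm (k l : Fin n) : CartanMatrix.D n k l = CartanMatrix.D n l k :=
  congrFun (congrFun (CartanMatrix.D_isSymm n) l) k

theorem simpleRootD_dotProduct (hn : 2 ≤ n) (k l : Fin n) :
    simpleRootD n k ⬝ᵥ simpleRootD n l = CartanMatrix.D n k l := by
  by_cases h : k.1 + 1 = n <;> by_cases h' : l.1 + 1 = n
  · exact simpleRootD_dotProduct_last_last hn k l h h'
  · exact simpleRootD_dotProduct_last_ne hn k l h h'
  · rw [dotProduct_comm, cartanMatrix_D_comm]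
    exact simpleRootD_dotProduct_last_ne hn l k h' h
  · exact simpleRootD_dotProduct_ne_ne hn k l h h'

theorem isPairBound_D (h : HasCartanMatrix b (CartanMatrix.D n)) : IsPairBound b 24 := by
  -- The index n - 2 of the model truncates here, but a Cartan matrix of size at most 1 is also of
  -- type B.
  by_cases h2 : n < 2
  · apply isPairBound_B (n := n)
    convert h using 1
    ext i j
    have hi := i.2
    have hj := j.2
    have : i = j := Fin.ext (by omega)
    simp [CartanMatrix.B, CartanMatrix.D, this]
  obtain ⟨X⟩ := h.nonempty_rootCoordinates
  refine (X.shortEmbedding (m := n) (v := simpleRootD n) (s := simpleRootD n)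
    (Λ := ↑(shortVectors n)) ?_ (fun _ h => h) ?_ ?_).1.isPairBound_of_shortEmbedding
  · exact simpleRootD_dotProduct (by omega)
  · intro l
    by_cases hn : l.1 + 1 = n
    · refine ⟨_, unitVec_mem_shortVectors _ (n - 2), _,
        neg_mem_shortVectors (unitVec_mem_shortVectors _ (n - 1)), ?_⟩
      rw [simpleRootD_of_eq l hn, sub_neg_eq_add]
    · rw [simpleRootD_of_ne l hn]
      exact ⟨_, unitVec_mem_shortVectors _ _, _, unitVec_mem_shortVectors _ _, rfl⟩
  · refine fun l u hu => reflect_mem_shortVectors (fun a ha => ?_) hu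
    by_cases hn : l.1 + 1 = n
    · rw [simpleRootD_of_eq l hn, dotProduct_add, unitVec_dotProduct, unitVec_dotProduct]
      by_cases h1 : a = n - 2
      · rw [if_pos ⟨h1, ha⟩, if_neg (by omega), add_zero, one_smul, h1]
        convert neg_mem_shortVectors (unitVec_mem_shortVectors n (n - 1)) using 1
        abel
      · by_cases h3 : a = n - 1
        · rw [if_neg (by omega), if_pos ⟨h3, ha⟩, zero_add, one_smul, h3]
          convert neg_mem_shortVectors (unitVec_mem_shortVectors n (n - 2)) using 1
          abel
        · rw [if_neg (by tauto), if_neg (by tauto), add_zero, zero_smul, sub_zero]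
          exact unitVec_mem_shortVectors n a
    · rw [simpleRootD_of_ne l hn]
      exact reflect_unitVec_mem (by omega) ha

end Embedding

/-! ### Certified lists of positive roots -/

section RootLists

/-- The dot product of two lists of integers. -/
def dotList (x y : List ℤ) : ℤ := (List.zipWith (· * ·) x y).sum

/-- The sum of two lists of integers. -/
def addList (x y : List ℤ) : List ℤ := List.zipWith (· + ·) x y

theorem zipWith_ofFn {n : ℕ} {α β γ : Type*} (f : α → β → γ) (x : Fin n → α) (y : Fin n → β) :
    List.zipWith f (List.ofFn x) (List.ofFn y) = List.ofFn fun k => f (x k) (y k) := by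
  apply List.ext_getElem
  · simp
  · intro i h1 h2
    simp

theorem dotList_ofFn {n : ℕ} (x y : Fin n → ℤ) :
    dotList (List.ofFn x) (List.ofFn y) = ∑ k, x k * y k := by
  rw [dotList, zipWith_ofFn, List.sum_ofFn]

theorem addList_ofFn {n : ℕ} (x y : Fin n → ℤ) :
    addList (List.ofFn x) (List.ofFn y) = List.ofFn (x + y) := zipWith_ofFn _ _ _

variable {n : ℕ}

/-- The simple reflection with index `l`, in the coordinates of a root and of its coroot. -/
def reflectList (A : Matrix (Fin n) (Fin n) ℤ) (l : Fin n) (z : List ℤ × List ℤ) :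
    List ℤ × List ℤ :=
  (z.1.set l (z.1.getD l 0 - dotList z.1 (List.ofFn fun k => A k l)),
    z.2.set l (z.2.getD l 0 - dotList (List.ofFn (A l)) z.2))

/-- The coordinates of the negative of a root. -/
def negList (z : List ℤ × List ℤ) : List ℤ × List ℤ := (z.1.map (-·), z.2.map (-·))

/-- The coordinates of a simple root. -/
def simpleList (n : ℕ) (l : Fin n) : List ℤ × List ℤ :=
  (List.ofFn fun k => if k = l then 1 else 0, List.ofFn fun k => if k = l then 1 else 0)

/-- The value of a root on a coroot. -/
def pairList (A : Matrix (Fin n) (Fin n) ℤ) (z w : List ℤ × List ℤ) : ℤ :=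
  dotList z.1 (List.ofFn fun k => dotList (List.ofFn (A k)) w.2)

/-- The sum of the `m_{α,β}²` over all `α`, `β` in a list with `α + β = g`. -/
def fiberSum (A : Matrix (Fin n) (Fin n) ℤ) (L : List (List ℤ × List ℤ)) (g : List ℤ) : ℕ :=
  (L.map fun z => (L.map fun w => if addList z.1 w.1 = g then
    (if z = w ∨ pairList A z w < 0 then 2 else 1) else 0).sum).sum

/-- `L` consists of the coordinates of the positive roots and their coroots, for the root system
with Cartan matrix `A`. -/
structure IsPositiveRootList (A : Matrix (Fin n) (Fin n) ℤ) (L : List (List ℤ × List ℤ)) :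
    Prop where
  nodup : L.Nodup
  simple_mem : ∀ l, simpleList n l ∈ L
  reflect_mem : ∀ z ∈ L, ∀ l, reflectList A l z ∈ L ∨ negList (reflectList A l z) ∈ L
  descend : ∀ z ∈ L, (∃ l, z = simpleList n l) ∨ ∃ l, reflectList A l z ∈ L ∧
    (reflectList A l z).1.sum < z.1.sum ∧ reflectList A l (reflectList A l z) = z
  sum_pos : ∀ z ∈ L, 0 < z.1.sum

theorem set_ofFn (x : Fin n → ℤ) (l : Fin n) (a : ℤ) :
    (List.ofFn x).set l a = List.ofFn (Function.update x l a) := by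
  apply List.ext_getElem
  · simp
  · intro i h1 h2
    rw [List.length_set, List.length_ofFn] at h1
    by_cases h : i = l
    · subst h; simp
    · rw [List.getElem_set_ne (Ne.symm h), List.getElem_ofFn, List.getElem_ofFn,
        Function.update_of_ne]
      intro h'
      exact h (congrArg Fin.val h')

theorem getD_ofFn (x : Fin n → ℤ) (l : Fin n) : (List.ofFn x).getD l 0 = x l := by
  rw [List.getD_eq_getElem _ _ (by simp)]
  simp

variable {ι R M N : Type*} [Fintype ι] [Field R] [CharZero R] [AddCommGroup M] [Module R M]
  [AddCommGroup N] [Module R N] {P : RootPairing ι R M N} [P.IsCrystallographic]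
  {b : P.Base} {A : Matrix (Fin n) (Fin n) ℤ}

namespace RootCoordinates
variable (X : RootCoordinates b A)
include X

/-- The coordinates of a root and of its coroot, as a pair of lists. -/
def toLists (i : ι) : List ℤ × List ℤ := (List.ofFn (X.coord i), List.ofFn (X.cocoord i))

theorem toLists_injective : Function.Injective X.toLists := by
  intro i j hij
  exact X.coord_injective (List.ofFn_injective (congrArg Prod.fst hij))

theorem toLists_simple (l : Fin n) : X.toLists (X.simple l) = simpleList n l := by
  rw [toLists, X.coord_simple, X.cocoord_simple, simpleList]
  congr 2 <;> exact funext fun k => Pi.single_apply l 1 k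

theorem toLists_reflectionPerm (l : Fin n) (i : ι) :
    X.toLists (P.reflectionPerm (X.simple l) i) = reflectList A l (X.toLists i) := by
  have h : ∀ (x : Fin n → ℤ) (s : ℤ), x - Pi.single l s = Function.update x l (x l - s) := by
    intro x s
    ext k
    by_cases hk : k = l
    · subst hk; simp
    · simp [hk]
  simp only [toLists, reflectList, dotList_ofFn, getD_ofFn, set_ofFn, X.coord_reflectionPerm,
    X.cocoord_reflectionPerm, h]

theorem toLists_reflectionPerm_self (i : ι) :
    X.toLists (P.reflectionPerm i i) = negList (X.toLists i) := by
  have h : X.cocoord (P.reflectionPerm i i) = -X.cocoord i := by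
    apply X.cocoord_eq_of_coroot_eq
    have : P.coroot (P.reflectionPerm i i) = - P.coroot i := by
      rw [P.coroot_reflectionPerm, P.coreflection_apply_self]
    rw [this, X.coroot_eq i]
    simp
  simp only [toLists, negList, X.coord_reflectionPerm_self, h, List.map_ofFn]
  rfl

theorem isPos_iff_sum (i : ι) : b.IsPos i ↔ 0 < (X.toLists i).1.sum := by
  rw [X.isPos_iff, toLists, List.sum_ofFn]

theorem pairingIn_eq_pairList (i j : ι) :
    P.pairingIn ℤ i j = pairList A (X.toLists i) (X.toLists j) := by
  rw [X.pairingIn_eq]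
  simp only [pairList, toLists, dotList_ofFn]
  refine Finset.sum_congr rfl fun k _ => ?_
  rw [Finset.mul_sum]
  exact Finset.sum_congr rfl fun l _ => by ring

theorem root_add_root_eq_iff_addList {i j k l : ι} : P.root i + P.root j = P.root k + P.root l ↔
    addList (X.toLists i).1 (X.toLists j).1 = addList (X.toLists k).1 (X.toLists l).1 := by
  rw [X.root_add_root_eq_iff]
  simp only [toLists, addList_ofFn]
  exact List.ofFn_injective.eq_iff.symm

variable {L : List (List ℤ × List ℤ)} (hL : IsPositiveRootList A L)
include hL

/-- By `descend`, each entry that is not simple is a simple reflection of an entry of smaller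
height, so induction on the height applies. -/
theorem exists_toLists_eq {z : List ℤ × List ℤ} (hz : z ∈ L) : ∃ i, b.IsPos i ∧ X.toLists i = z := by
  have key : ∀ (h : ℕ) (z : List ℤ × List ℤ), z ∈ L → z.1.sum ≤ h → ∃ i, X.toLists i = z := by
    intro h
    induction h with
    | zero =>
      intro z hz hh
      have := hL.sum_pos z hz
      omega
    | succ h ih =>
      intro z hz hh
      rcases hL.descend z hz with ⟨l, rfl⟩ | ⟨l, h1, h2, h3⟩
      · exact ⟨X.simple l, X.toLists_simple l⟩
      · obtain ⟨i, hi⟩ := ih _ h1 (by omega)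
        exact ⟨P.reflectionPerm (X.simple l) i, by rw [X.toLists_reflectionPerm, hi, h3]⟩
  obtain ⟨i, hi⟩ := key z.1.sum.toNat z hz (by omega)
  exact ⟨i, (X.isPos_iff_sum i).2 (hi ▸ hL.sum_pos z hz), hi⟩

/-- Up to sign, L contains the simple roots and is closed under simple reflections, so it contains
every root up to sign. The height fixes the sign. -/
theorem toLists_mem [P.IsReduced] {i : ι} (hi : b.IsPos i) : X.toLists i ∈ L := by
  have hnn : ∀ z : List ℤ × List ℤ, negList (negList z) = z := by
    intro z
    simp [negList, Function.comp_def]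
  have hsum : ∀ z : List ℤ × List ℤ, (negList z).1.sum = -z.1.sum := by
    intro z
    have : ∀ l : List ℤ, (l.map (-·)).sum = -l.sum := by
      intro l
      induction l with
      | nil => simp
      | cons a l ih => simp [ih]; ring
    exact this z.1
  have key : ∀ i, X.toLists i ∈ L ∨ negList (X.toLists i) ∈ L := by
    intro i
    induction i using b.induction_reflect with
    | h₀ i hi =>
      rw [X.toLists_reflectionPerm_self, hnn]
      exact hi.symm
    | h₁ i hi =>
      obtain ⟨l, rfl⟩ := X.exists_simple i hi
      rw [X.toLists_simple]
      exact Or.inl (hL.simple_mem l)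
    | h₂ i j hi hj =>
      obtain ⟨l, rfl⟩ := X.exists_simple j hj
      rcases hi with hi | hi
      · rw [X.toLists_reflectionPerm]
        exact hL.reflect_mem _ hi l
      · obtain ⟨k, -, hk⟩ := X.exists_toLists_eq hL hi
        have h1 : k = P.reflectionPerm i i := X.toLists_injective (by
          rw [hk, X.toLists_reflectionPerm_self])
        have h2 : P.reflectionPerm (X.simple l) k =
            P.reflectionPerm (P.reflectionPerm (X.simple l) i) (P.reflectionPerm (X.simple l) i) := by
          apply P.root.injective
          rw [h1]
          rw [P.root_reflectionPerm (X.simple l), P.root_reflectionPerm i i, P.reflection_apply_self,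
            map_neg, P.root_reflectionPerm (P.reflectionPerm (X.simple l) i),
            P.reflection_apply_self, P.root_reflectionPerm (X.simple l)]
        rcases hL.reflect_mem _ hi l with h3 | h3
        · right
          rw [← hk, ← X.toLists_reflectionPerm, h2, X.toLists_reflectionPerm_self] at h3
          exact h3
        · left
          rw [← hk, ← X.toLists_reflectionPerm, h2, X.toLists_reflectionPerm_self, hnn] at h3
          exact h3
  refine (key i).resolve_right fun h => ?_
  have h1 := hL.sum_pos _ h
  rw [hsum] at h1
  have h2 := (X.isPos_iff_sum i).1 hi
  omega

variable [P.IsReduced]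

open Classical in
theorem sum_isPos (F : List ℤ × List ℤ → ℕ) :
    ∑ i with b.IsPos i, F (X.toLists i) = (L.map F).sum := by
  have h1 : (Finset.univ.filter b.IsPos).image X.toLists = L.toFinset := by
    ext z
    simp only [Finset.mem_image, Finset.mem_filter, Finset.mem_univ, true_and, List.mem_toFinset]
    constructor
    · rintro ⟨i, hi, rfl⟩
      exact X.toLists_mem hL hi
    · intro hz
      exact X.exists_toLists_eq hL hz
  rw [← List.sum_toFinset F hL.nodup, ← h1, Finset.sum_image fun i _ j _ h => X.toLists_injective h]

open Classical in
theorem sum_mSq_eq_fiberSum (i j : ι) :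
    ∑ q ∈ (posPairs b).filter (fun q => P.root q.1 + P.root q.2 = P.root i + P.root j),
      mSq P q.1 q.2 = fiberSum A L (addList (X.toLists i).1 (X.toLists j).1) := by
  have h : posPairs b = (Finset.univ.filter b.IsPos) ×ˢ (Finset.univ.filter b.IsPos) := by
    ext q; simp [posPairs]
  rw [Finset.sum_filter, h, Finset.sum_product, fiberSum, ← X.sum_isPos hL]
  refine Finset.sum_congr rfl fun k _ => ?_
  rw [← X.sum_isPos hL]
  refine Finset.sum_congr rfl fun l _ => ?_
  simp only [X.root_add_root_eq_iff_addList, mSq, X.pairingIn_eq_pairList,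
    ← X.toLists_injective.eq_iff]

open Classical in
theorem cDelta_le_of_fiberSum_le {K : ℕ}
    (h : ∀ z ∈ L, ∀ w ∈ L, fiberSum A L (addList z.1 w.1) ≤ K) : cDelta b ≤ K := by
  refine Finset.sup_le fun γ hγ => ?_
  obtain ⟨q, hq, rfl⟩ := Finset.mem_image.1 hγ
  have h1 := (Finset.mem_filter.1 hq).2
  refine le_trans (le_of_eq ?_) (h _ (X.toLists_mem hL h1.1) _ (X.toLists_mem hL h1.2))
  exact X.sum_mSq_eq_fiberSum hL q.1 q.2

theorem le_cDelta {K : ℕ} {z w : List ℤ × List ℤ} (hz : z ∈ L) (hw : w ∈ L)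
    (h : K ≤ fiberSum A L (addList z.1 w.1)) : K ≤ cDelta b := by
  obtain ⟨i, -, rfl⟩ := X.exists_toLists_eq hL hz
  obtain ⟨j, -, rfl⟩ := X.exists_toLists_eq hL hw
  refine h.trans ?_
  rw [← X.sum_mSq_eq_fiberSum hL]
  exact sum_mSq_le_cDelta b _

open Classical in
-- This avoids evaluating every fibre. If γ is a root, then m² ≤ 2, and the pairs are counted
-- through a linear functional c: `mask` has a bit at each value of c on a positive root, and a pair
-- needs c(γ) - c(α) to be such a value. If γ is not a root, then m² = 1 off the diagonal, and
-- heights alone bound the number of pairs.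
theorem cDelta_le {K H mask : ℕ} {c : List ℤ} {S : List ℕ}
    (hS : L.map (fun z => (dotList c z.1).toNat) = S)
    (hc : ∀ z ∈ L, 0 ≤ dotList c z.1) (hlen : c.length = n)
    (hmask : ∀ a ∈ S, mask.testBit a)
    (hroot : ∀ a ∈ S, 2 * (S.map fun x => if mask.testBit (a - x) then 1 else 0).sum ≤ K)
    (hH : ∀ z ∈ L, z.1.sum ≤ (H : ℤ))
    (hwin : ∀ h < 2 * H + 1,
      2 * (L.map fun z => if (h : ℤ) ≤ 2 * z.1.sum ∧ z.1.sum < (h : ℤ) then 1 else 0).sum + 1 ≤ K) :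
    cDelta b ≤ K := by
  refine Finset.sup_le fun γ hγ => ?_
  obtain ⟨⟨i₀, j₀⟩, hq, rfl⟩ := Finset.mem_image.1 hγ
  obtain ⟨-, hi₀, hj₀⟩ := Finset.mem_filter.1 hq
  simp only at hi₀ hj₀ ⊢
  set F := (posPairs b).filter (fun q => P.root q.1 + P.root q.2 = P.root i₀ + P.root j₀) with hF
  have hFpos : ∀ q ∈ F, b.IsPos q.1 ∧ b.IsPos q.2 := fun q hq =>
    (Finset.mem_filter.1 (Finset.mem_filter.1 hq).1).2
  have hFsum : ∀ q ∈ F, P.root q.1 + P.root q.2 = P.root i₀ + P.root j₀ := fun q hq =>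
    (Finset.mem_filter.1 hq).2
  have hcard : ∀ (T : Finset (ι × ι)) (p : ι → Prop) [DecidablePred p], T ⊆ F → (∀ q ∈ T, p q.1) →
      T.card ≤ ((Finset.univ.filter b.IsPos).filter p).card := by
    intro T p _ hT hp
    refine Finset.card_le_card_of_injOn (fun q => q.1) (fun q hq => ?_) fun q hq q' hq' h => ?_
    · simp only [Finset.coe_filter, Finset.mem_filter, Finset.mem_univ, true_and, Set.mem_ofPred_eq]
      exact ⟨(hFpos q (hT hq)).1, hp q hq⟩
    · have h1 := (hFsum q (hT hq)).trans (hFsum q' (hT hq')).symm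
      simp only at h
      rw [h, add_right_inj] at h1
      exact Prod.ext h (P.root.injective h1)
  by_cases hγ : ∃ k, P.root k = P.root i₀ + P.root j₀
  · obtain ⟨k, hk⟩ := hγ
    obtain ⟨c, rfl⟩ : ∃ c' : Fin n → ℤ, List.ofFn c' = c := by
      subst hlen
      exact ⟨_, List.ofFn_get c⟩
    have hkpos : b.IsPos k := hi₀.add hj₀ hk
    set f : ι → ℤ := fun i => dotList (List.ofFn c) (X.toLists i).1 with hf
    have hmemS : ∀ i, b.IsPos i → (f i).toNat ∈ S := fun i hi => by
      rw [← hS]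
      exact List.mem_map_of_mem (f := fun z => (dotList (List.ofFn c) z.1).toNat)
        (X.toLists_mem hL hi)
    have hadd : ∀ q ∈ F, f k = f q.1 + f q.2 := by
      intro q hq
      have h1 := X.root_eq_add_iff.1 (hk.trans (hFsum q hq).symm)
      simp only [hf, toLists, dotList_ofFn, h1, Pi.add_apply, mul_add, Finset.sum_add_distrib]
    have h1 := hcard F (fun i => mask.testBit ((f k).toNat - (f i).toNat)) subset_rfl (by
      intro q hq
      have e1 := hadd q hq
      have e2 := hc _ (X.toLists_mem hL (hFpos q hq).1)
      have e3 := hc _ (X.toLists_mem hL (hFpos q hq).2)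
      have e4 : (f k).toNat - (f q.1).toNat = (f q.2).toNat := by
        change 0 ≤ f q.1 at e2
        change 0 ≤ f q.2 at e3
        omega
      rw [e4]
      exact hmask _ (hmemS _ (hFpos q hq).2))
    rw [Finset.card_filter (fun i => mask.testBit ((f k).toNat - (f i).toNat)),
      X.sum_isPos hL fun z => if mask.testBit ((f k).toNat -
      (dotList (List.ofFn c) z.1).toNat) then 1 else 0] at h1
    have h2 := hroot _ (hmemS k hkpos)
    rw [← hS, List.map_map] at h2
    calc ∑ q ∈ F, mSq P q.1 q.2 ≤ ∑ q ∈ F, 2 := Finset.sum_le_sum fun q _ => mSq_le_two _ _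
      _ = 2 * F.card := by rw [Finset.sum_const, smul_eq_mul, mul_comm]
      _ ≤ _ := (Nat.mul_le_mul_left 2 h1).trans h2
  · have hm : ∀ q ∈ F, mSq P q.1 q.2 = 1 + if q.1 = q.2 then 1 else 0 := by
      rintro ⟨i, j⟩ hq
      by_cases heq : i = j
      · simp [mSq, heq]
      · have : ¬ P.pairingIn ℤ i j < 0 := by
          intro hneg
          obtain ⟨k, hk⟩ := P.root_add_root_mem_of_pairingIn_neg hneg
            fun h' => not_isPos_of_root_eq_neg b (hFpos _ hq).2 h' (hFpos _ hq).1
          exact hγ ⟨k, hk.trans (hFsum _ hq)⟩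
        simp [mSq, heq, this]
    have hdiag : (F.filter fun q => q.1 = q.2).card ≤ 1 := by
      rw [Finset.card_le_one]
      rintro ⟨i, j⟩ hq ⟨k, l⟩ hq'
      obtain ⟨h1, h2⟩ := Finset.mem_filter.1 hq
      obtain ⟨h3, h4⟩ := Finset.mem_filter.1 hq'
      simp only at h2 h4
      subst h2 h4
      have h5 := (hFsum _ h1).trans (hFsum _ h3).symm
      simp only [X.root_add_root_eq_iff] at h5
      have : X.coord i = X.coord k := by
        funext t
        have := congrFun h5 t
        simp at this
        omega
      rw [X.coord_injective this]
    set f : ι → ℤ := fun i => (X.toLists i).1.sum with hf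
    set h := f i₀ + f j₀ with hh
    have hadd : ∀ q ∈ F, f q.1 + f q.2 = h := by
      intro q hq
      have h1 := X.root_add_root_eq_iff.1 (hFsum q hq)
      simp only [hh, hf, toLists, List.sum_ofFn, ← Finset.sum_add_distrib]
      exact Finset.sum_congr rfl fun t _ => congrFun h1 t
    have hpos : ∀ i, b.IsPos i → 0 < f i := fun i hi => (X.isPos_iff_sum i).1 hi
    have hle : ∀ i, b.IsPos i → f i ≤ H := fun i hi => hH _ (X.toLists_mem hL hi)
    -- In every pair or in its swap, the first root has height at least h/2. It is below h because
    -- the other root is positive. So twice this window bounds the fibre; the final + 1 accounts for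
    -- the diagonal pair.
    have h1 := hcard (F.filter fun q => h ≤ 2 * f q.1) (fun i => h ≤ 2 * f i ∧ f i < h)
      (Finset.filter_subset _ _) (by
        intro q hq
        obtain ⟨e1, e2⟩ := Finset.mem_filter.1 hq
        have e3 := hadd q e1
        have e4 := hpos _ (hFpos q e1).2
        exact ⟨e2, by omega⟩)
    have h2 : (F.filter fun q => ¬ h ≤ 2 * f q.1).card ≤ (F.filter fun q => h ≤ 2 * f q.1).card := by
      refine Finset.card_le_card_of_injOn Prod.swap (fun q hq => ?_)
        fun q _ q' _ h => Prod.swap_injective h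
      obtain ⟨e1, e2⟩ := Finset.mem_filter.1 hq
      have e3 := hadd q e1
      refine Finset.mem_coe.2 (Finset.mem_filter.2 ⟨?_, ?_⟩)
      · refine Finset.mem_filter.2 ⟨Finset.mem_filter.2 ⟨Finset.mem_univ _, ?_⟩, ?_⟩
        · exact (hFpos q e1).symm
        · change P.root q.2 + P.root q.1 = _
          rw [add_comm]
          exact hFsum q e1
      · change h ≤ 2 * f q.2
        omega
    have h3 : F.card ≤ 2 * (F.filter fun q => h ≤ 2 * f q.1).card := by
      have := Finset.card_filter_add_card_filter_not (s := F) fun q => h ≤ 2 * f q.1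
      omega
    rw [Finset.card_filter (fun i => h ≤ 2 * f i ∧ f i < h),
      X.sum_isPos hL fun z => if h ≤ 2 * z.1.sum ∧ z.1.sum < h then 1 else 0] at h1
    have e1 := hpos _ hi₀
    have e2 := hpos _ hj₀
    have e3 := hle _ hi₀
    have e4 := hle _ hj₀
    have h4 := hwin h.toNat (by omega)
    rw [Int.toNat_of_nonneg (by omega)] at h4
    rw [Finset.sum_congr rfl hm, Finset.sum_add_distrib, ← Finset.card_eq_sum_ones,
      ← Finset.card_filter]
    omega

end RootCoordinates
end RootLists

/-! ### The exceptional types -/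

section ExceptionalTypes

/-- The coordinates of the positive roots and of their coroots, for type `G₂`. -/
def posRootsG₂ : List (List ℤ × List ℤ) :=
  [([0, 1], [0, 1]), ([1, 0], [1, 0]), ([1, 1], [3, 1]), ([1, 2], [3, 2]), ([1, 3], [1, 1]), ([2,
   3], [2, 1])]

theorem isPositiveRootList_G₂ : IsPositiveRootList CartanMatrix.G₂ posRootsG₂ where
  nodup := by decide +kernel
  simple_mem := by decide +kernel
  reflect_mem := by decide +kernel
  descend := by decide +kernel
  sum_pos := by decide +kernel

/-- The coordinates of the positive roots and of their coroots, for type `F₄`. -/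
def posRootsF₄ : List (List ℤ × List ℤ) :=
  [([0, 0, 0, 1], [0, 0, 0, 1]), ([0, 0, 1, 0], [0, 0, 1, 0]), ([0, 1, 0, 0], [0, 1, 0, 0]), ([1,
   0, 0, 0], [1, 0, 0, 0]), ([0, 0, 1, 1], [0, 0, 1, 1]), ([0, 1, 1, 0], [0, 2, 1, 0]), ([1, 1, 0,
   0], [1, 1, 0, 0]), ([0, 1, 1, 1], [0, 2, 1, 1]), ([0, 1, 2, 0], [0, 1, 1, 0]), ([1, 1, 1, 0],
   [2, 2, 1, 0]), ([0, 1, 2, 1], [0, 2, 2, 1]), ([1, 1, 1, 1], [2, 2, 1, 1]), ([1, 1, 2, 0], [1,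
   1, 1, 0]), ([0, 1, 2, 2], [0, 1, 1, 1]), ([1, 1, 2, 1], [2, 2, 2, 1]), ([1, 2, 2, 0], [1, 2, 1,
   0]), ([1, 1, 2, 2], [1, 1, 1, 1]), ([1, 2, 2, 1], [2, 4, 2, 1]), ([1, 2, 2, 2], [1, 2, 1, 1]),
   ([1, 2, 3, 1], [2, 4, 3, 1]), ([1, 2, 3, 2], [2, 4, 3, 2]), ([1, 2, 4, 2], [1, 2, 2, 1]), ([1,
   3, 4, 2], [1, 3, 2, 1]), ([2, 3, 4, 2], [2, 3, 2, 1])]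

theorem isPositiveRootList_F₄ : IsPositiveRootList CartanMatrix.F₄ posRootsF₄ where
  nodup := by decide +kernel
  simple_mem := by decide +kernel
  reflect_mem := by decide +kernel
  descend := by decide +kernel
  sum_pos := by decide +kernel

/-- The coordinates of the positive roots and of their coroots, for type `E₆`. -/
def posRootsE₆ : List (List ℤ × List ℤ) :=
  [[0, 0, 0, 0, 0, 1], [0, 0, 0, 0, 1, 0], [0, 0, 0, 1, 0, 0], [0, 0, 1, 0, 0, 0], [0, 1, 0, 0, 0,
   0], [1, 0, 0, 0, 0, 0], [0, 0, 0, 0, 1, 1], [0, 0, 0, 1, 1, 0], [0, 0, 1, 1, 0, 0], [0, 1, 0,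
   1, 0, 0], [1, 0, 1, 0, 0, 0], [0, 0, 0, 1, 1, 1], [0, 0, 1, 1, 1, 0], [0, 1, 0, 1, 1, 0], [0,
   1, 1, 1, 0, 0], [1, 0, 1, 1, 0, 0], [0, 0, 1, 1, 1, 1], [0, 1, 0, 1, 1, 1], [0, 1, 1, 1, 1, 0],
   [1, 0, 1, 1, 1, 0], [1, 1, 1, 1, 0, 0], [0, 1, 1, 1, 1, 1], [0, 1, 1, 2, 1, 0], [1, 0, 1, 1, 1,
   1], [1, 1, 1, 1, 1, 0], [0, 1, 1, 2, 1, 1], [1, 1, 1, 1, 1, 1], [1, 1, 1, 2, 1, 0], [0, 1, 1,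
   2, 2, 1], [1, 1, 1, 2, 1, 1], [1, 1, 2, 2, 1, 0], [1, 1, 1, 2, 2, 1], [1, 1, 2, 2, 1, 1], [1,
   1, 2, 2, 2, 1], [1, 1, 2, 3, 2, 1], [1, 2, 2, 3, 2, 1]].map fun x => (x, x)

theorem isPositiveRootList_E₆ : IsPositiveRootList CartanMatrix.E₆ posRootsE₆ where
  nodup := by decide +kernel
  simple_mem := by decide +kernel
  reflect_mem := by decide +kernel
  descend := by decide +kernel
  sum_pos := by decide +kernel

/-- The coordinates of the positive roots and of their coroots, for type `E₇`. -/
def posRootsE₇ : List (List ℤ × List ℤ) :=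
  [[0, 0, 0, 0, 0, 0, 1], [0, 0, 0, 0, 0, 1, 0], [0, 0, 0, 0, 1, 0, 0], [0, 0, 0, 1, 0, 0, 0], [0,
   0, 1, 0, 0, 0, 0], [0, 1, 0, 0, 0, 0, 0], [1, 0, 0, 0, 0, 0, 0], [0, 0, 0, 0, 0, 1, 1], [0, 0,
   0, 0, 1, 1, 0], [0, 0, 0, 1, 1, 0, 0], [0, 0, 1, 1, 0, 0, 0], [0, 1, 0, 1, 0, 0, 0], [1, 0, 1,
   0, 0, 0, 0], [0, 0, 0, 0, 1, 1, 1], [0, 0, 0, 1, 1, 1, 0], [0, 0, 1, 1, 1, 0, 0], [0, 1, 0, 1,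
   1, 0, 0], [0, 1, 1, 1, 0, 0, 0], [1, 0, 1, 1, 0, 0, 0], [0, 0, 0, 1, 1, 1, 1], [0, 0, 1, 1, 1,
   1, 0], [0, 1, 0, 1, 1, 1, 0], [0, 1, 1, 1, 1, 0, 0], [1, 0, 1, 1, 1, 0, 0], [1, 1, 1, 1, 0, 0,
   0], [0, 0, 1, 1, 1, 1, 1], [0, 1, 0, 1, 1, 1, 1], [0, 1, 1, 1, 1, 1, 0], [0, 1, 1, 2, 1, 0, 0],
   [1, 0, 1, 1, 1, 1, 0], [1, 1, 1, 1, 1, 0, 0], [0, 1, 1, 1, 1, 1, 1], [0, 1, 1, 2, 1, 1, 0], [1,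
   0, 1, 1, 1, 1, 1], [1, 1, 1, 1, 1, 1, 0], [1, 1, 1, 2, 1, 0, 0], [0, 1, 1, 2, 1, 1, 1], [0, 1,
   1, 2, 2, 1, 0], [1, 1, 1, 1, 1, 1, 1], [1, 1, 1, 2, 1, 1, 0], [1, 1, 2, 2, 1, 0, 0], [0, 1, 1,
   2, 2, 1, 1], [1, 1, 1, 2, 1, 1, 1], [1, 1, 1, 2, 2, 1, 0], [1, 1, 2, 2, 1, 1, 0], [0, 1, 1, 2,
   2, 2, 1], [1, 1, 1, 2, 2, 1, 1], [1, 1, 2, 2, 1, 1, 1], [1, 1, 2, 2, 2, 1, 0], [1, 1, 1, 2, 2,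
   2, 1], [1, 1, 2, 2, 2, 1, 1], [1, 1, 2, 3, 2, 1, 0], [1, 1, 2, 2, 2, 2, 1], [1, 1, 2, 3, 2, 1,
   1], [1, 2, 2, 3, 2, 1, 0], [1, 1, 2, 3, 2, 2, 1], [1, 2, 2, 3, 2, 1, 1], [1, 1, 2, 3, 3, 2, 1],
   [1, 2, 2, 3, 2, 2, 1], [1, 2, 2, 3, 3, 2, 1], [1, 2, 2, 4, 3, 2, 1], [1, 2, 3, 4, 3, 2, 1], [2,
   2, 3, 4, 3, 2, 1]].map fun x => (x, x)

theorem isPositiveRootList_E₇ : IsPositiveRootList CartanMatrix.E₇ posRootsE₇ where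
  nodup := by decide +kernel
  simple_mem := by decide +kernel
  reflect_mem := by decide +kernel
  descend := by decide +kernel
  sum_pos := by decide +kernel

/-- The coordinates of the positive roots and of their coroots, for type `E₈`. -/
def posRootsE₈ : List (List ℤ × List ℤ) :=
  [[0, 0, 0, 0, 0, 0, 0, 1], [0, 0, 0, 0, 0, 0, 1, 0], [0, 0, 0, 0, 0, 1, 0, 0], [0, 0, 0, 0, 1,
   0, 0, 0], [0, 0, 0, 1, 0, 0, 0, 0], [0, 0, 1, 0, 0, 0, 0, 0], [0, 1, 0, 0, 0, 0, 0, 0], [1, 0,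
   0, 0, 0, 0, 0, 0], [0, 0, 0, 0, 0, 0, 1, 1], [0, 0, 0, 0, 0, 1, 1, 0], [0, 0, 0, 0, 1, 1, 0,
   0], [0, 0, 0, 1, 1, 0, 0, 0], [0, 0, 1, 1, 0, 0, 0, 0], [0, 1, 0, 1, 0, 0, 0, 0], [1, 0, 1, 0,
   0, 0, 0, 0], [0, 0, 0, 0, 0, 1, 1, 1], [0, 0, 0, 0, 1, 1, 1, 0], [0, 0, 0, 1, 1, 1, 0, 0], [0,
   0, 1, 1, 1, 0, 0, 0], [0, 1, 0, 1, 1, 0, 0, 0], [0, 1, 1, 1, 0, 0, 0, 0], [1, 0, 1, 1, 0, 0, 0,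
   0], [0, 0, 0, 0, 1, 1, 1, 1], [0, 0, 0, 1, 1, 1, 1, 0], [0, 0, 1, 1, 1, 1, 0, 0], [0, 1, 0, 1,
   1, 1, 0, 0], [0, 1, 1, 1, 1, 0, 0, 0], [1, 0, 1, 1, 1, 0, 0, 0], [1, 1, 1, 1, 0, 0, 0, 0], [0,
   0, 0, 1, 1, 1, 1, 1], [0, 0, 1, 1, 1, 1, 1, 0], [0, 1, 0, 1, 1, 1, 1, 0], [0, 1, 1, 1, 1, 1, 0,
   0], [0, 1, 1, 2, 1, 0, 0, 0], [1, 0, 1, 1, 1, 1, 0, 0], [1, 1, 1, 1, 1, 0, 0, 0], [0, 0, 1, 1,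
   1, 1, 1, 1], [0, 1, 0, 1, 1, 1, 1, 1], [0, 1, 1, 1, 1, 1, 1, 0], [0, 1, 1, 2, 1, 1, 0, 0], [1,
   0, 1, 1, 1, 1, 1, 0], [1, 1, 1, 1, 1, 1, 0, 0], [1, 1, 1, 2, 1, 0, 0, 0], [0, 1, 1, 1, 1, 1, 1,
   1], [0, 1, 1, 2, 1, 1, 1, 0], [0, 1, 1, 2, 2, 1, 0, 0], [1, 0, 1, 1, 1, 1, 1, 1], [1, 1, 1, 1,
   1, 1, 1, 0], [1, 1, 1, 2, 1, 1, 0, 0], [1, 1, 2, 2, 1, 0, 0, 0], [0, 1, 1, 2, 1, 1, 1, 1], [0,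
   1, 1, 2, 2, 1, 1, 0], [1, 1, 1, 1, 1, 1, 1, 1], [1, 1, 1, 2, 1, 1, 1, 0], [1, 1, 1, 2, 2, 1, 0,
   0], [1, 1, 2, 2, 1, 1, 0, 0], [0, 1, 1, 2, 2, 1, 1, 1], [0, 1, 1, 2, 2, 2, 1, 0], [1, 1, 1, 2,
   1, 1, 1, 1], [1, 1, 1, 2, 2, 1, 1, 0], [1, 1, 2, 2, 1, 1, 1, 0], [1, 1, 2, 2, 2, 1, 0, 0], [0,
   1, 1, 2, 2, 2, 1, 1], [1, 1, 1, 2, 2, 1, 1, 1], [1, 1, 1, 2, 2, 2, 1, 0], [1, 1, 2, 2, 1, 1, 1,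
   1], [1, 1, 2, 2, 2, 1, 1, 0], [1, 1, 2, 3, 2, 1, 0, 0], [0, 1, 1, 2, 2, 2, 2, 1], [1, 1, 1, 2,
   2, 2, 1, 1], [1, 1, 2, 2, 2, 1, 1, 1], [1, 1, 2, 2, 2, 2, 1, 0], [1, 1, 2, 3, 2, 1, 1, 0], [1,
   2, 2, 3, 2, 1, 0, 0], [1, 1, 1, 2, 2, 2, 2, 1], [1, 1, 2, 2, 2, 2, 1, 1], [1, 1, 2, 3, 2, 1, 1,
   1], [1, 1, 2, 3, 2, 2, 1, 0], [1, 2, 2, 3, 2, 1, 1, 0], [1, 1, 2, 2, 2, 2, 2, 1], [1, 1, 2, 3,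
   2, 2, 1, 1], [1, 1, 2, 3, 3, 2, 1, 0], [1, 2, 2, 3, 2, 1, 1, 1], [1, 2, 2, 3, 2, 2, 1, 0], [1,
   1, 2, 3, 2, 2, 2, 1], [1, 1, 2, 3, 3, 2, 1, 1], [1, 2, 2, 3, 2, 2, 1, 1], [1, 2, 2, 3, 3, 2, 1,
   0], [1, 1, 2, 3, 3, 2, 2, 1], [1, 2, 2, 3, 2, 2, 2, 1], [1, 2, 2, 3, 3, 2, 1, 1], [1, 2, 2, 4,
   3, 2, 1, 0], [1, 1, 2, 3, 3, 3, 2, 1], [1, 2, 2, 3, 3, 2, 2, 1], [1, 2, 2, 4, 3, 2, 1, 1], [1,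
   2, 3, 4, 3, 2, 1, 0], [1, 2, 2, 3, 3, 3, 2, 1], [1, 2, 2, 4, 3, 2, 2, 1], [1, 2, 3, 4, 3, 2, 1,
   1], [2, 2, 3, 4, 3, 2, 1, 0], [1, 2, 2, 4, 3, 3, 2, 1], [1, 2, 3, 4, 3, 2, 2, 1], [2, 2, 3, 4,
   3, 2, 1, 1], [1, 2, 2, 4, 4, 3, 2, 1], [1, 2, 3, 4, 3, 3, 2, 1], [2, 2, 3, 4, 3, 2, 2, 1], [1,
   2, 3, 4, 4, 3, 2, 1], [2, 2, 3, 4, 3, 3, 2, 1], [1, 2, 3, 5, 4, 3, 2, 1], [2, 2, 3, 4, 4, 3, 2,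
   1], [1, 3, 3, 5, 4, 3, 2, 1], [2, 2, 3, 5, 4, 3, 2, 1], [2, 2, 4, 5, 4, 3, 2, 1], [2, 3, 3, 5,
   4, 3, 2, 1], [2, 3, 4, 5, 4, 3, 2, 1], [2, 3, 4, 6, 4, 3, 2, 1], [2, 3, 4, 6, 5, 3, 2, 1], [2,
   3, 4, 6, 5, 4, 2, 1], [2, 3, 4, 6, 5, 4, 3, 1], [2, 3, 4, 6, 5, 4, 3, 2]].map fun x => (x, x)

theorem isPositiveRootList_E₈ : IsPositiveRootList CartanMatrix.E₈ posRootsE₈ where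
  nodup := by decide +kernel
  simple_mem := by decide +kernel
  reflect_mem := by decide +kernel
  descend := by decide +kernel
  sum_pos := by decide +kernel

variable {ι R M N : Type*} [Fintype ι] [Field R] [CharZero R] [AddCommGroup M] [Module R M]
  [AddCommGroup N] [Module R N] {P : RootPairing ι R M N} [P.IsCrystallographic]
  [P.IsReduced] {b : P.Base}

theorem cDelta_eq_of_G₂ (h : HasCartanMatrix b CartanMatrix.G₂) : cDelta b = 6 := by
  obtain ⟨X⟩ := h.nonempty_rootCoordinates
  refine le_antisymm ?_ ?_
  · exact X.cDelta_le_of_fiberSum_le isPositiveRootList_G₂ (by decide +kernel)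
  · exact X.le_cDelta isPositiveRootList_G₂ (z := ([1, 3], [1, 1]))
      (w := ([1, 0], [1, 0])) (by decide +kernel) (by decide +kernel) (by decide +kernel)

theorem cDelta_eq_of_F₄ (h : HasCartanMatrix b CartanMatrix.F₄) : cDelta b = 28 := by
  obtain ⟨X⟩ := h.nonempty_rootCoordinates
  refine le_antisymm ?_ ?_
  -- H is the height of the highest root. Bit 0 of the mask is clear, so a truncated difference that
  -- equals 0 counts no pair. The same holds for the masks of types E.
  · exact X.cDelta_le (H := 11) (mask := 77928290645878202577704)
      (c := [5, 8, 9, 3]) isPositiveRootList_F₄ rfl (by decide +kernel) rfl (by decide +kernel)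
      (by decide +kernel) (by decide +kernel) (by decide +kernel)
  -- The sum is the highest short root. For the highest root the value is lower, as some pairs
  -- consist of orthogonal short roots.
  · exact X.le_cDelta isPositiveRootList_F₄ (z := ([1, 2, 3, 1], [2, 4, 3, 1]))
      (w := ([0, 0, 0, 1], [0, 0, 0, 1])) (by decide +kernel) (by decide +kernel) (by decide +kernel)

theorem cDelta_eq_of_E₆ (h : HasCartanMatrix b CartanMatrix.E₆) : cDelta b = 40 := by
  obtain ⟨X⟩ := h.nonempty_rootCoordinates
  refine le_antisymm ?_ ?_
  · exact X.cDelta_le (H := 11) (mask := 1393881646818296029461450046453759095460928)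
      (c := [10, 14, 15, 16, 6, 12]) isPositiveRootList_E₆ rfl (by decide +kernel) rfl (by decide +kernel)
      (by decide +kernel) (by decide +kernel) (by decide +kernel)
  -- In types E the maximum is attained at the highest root, which is the sum of these two roots.
  · exact X.le_cDelta isPositiveRootList_E₆ (z := ([1, 1, 2, 3, 2, 1], [1, 1, 2, 3, 2, 1]))
      (w := ([0, 1, 0, 0, 0, 0], [0, 1, 0, 0, 0, 0])) (by decide +kernel) (by decide +kernel) (by decide +kernel)

theorem cDelta_eq_of_E₇ (h : HasCartanMatrix b CartanMatrix.E₇) : cDelta b = 64 := by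
  obtain ⟨X⟩ := h.nonempty_rootCoordinates
  refine le_antisymm ?_ ?_
  · exact X.cDelta_le (H := 17) (mask := 9174274432055144197306693027461390715918459877783685789414324782554187979316724283905835880986445105631504)
      (c := [15, 25, 27, 22, 29, 4, 8]) isPositiveRootList_E₇ rfl (by decide +kernel) rfl (by decide +kernel)
      (by decide +kernel) (by decide +kernel) (by decide +kernel)
  · exact X.le_cDelta isPositiveRootList_E₇ (z := ([1, 2, 3, 4, 3, 2, 1], [1, 2, 3, 4, 3, 2, 1]))
      (w := ([1, 0, 0, 0, 0, 0, 0], [1, 0, 0, 0, 0, 0, 0])) (by decide +kernel) (by decide +kernel) (by decide +kernel)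

theorem cDelta_eq_of_E₈ (h : HasCartanMatrix b CartanMatrix.E₈) : cDelta b = 112 := by
  obtain ⟨X⟩ := h.nonempty_rootCoordinates
  refine le_antisymm ?_ ?_
  · exact X.cDelta_le (H := 29) (mask := 3485195879244805085258215108138772190058992843469280488084819236591232428292219454276285301398741707346882410558834458042076520016802056833022154433096340541249246825963372761639002411666006831360294611796142520159393005923751067817021296908421801568758139276700974403691257666736642)
      (c := [9, 56, 12, 45, 26, 38, 50, 1]) isPositiveRootList_E₈ rfl (by decide +kernel) rfl (by decide +kernel)
      (by decide +kernel) (by decide +kernel) (by decide +kernel)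
  · exact X.le_cDelta isPositiveRootList_E₈ (z := ([2, 3, 4, 6, 5, 4, 3, 1], [2, 3, 4, 6, 5, 4, 3, 1]))
      (w := ([0, 0, 0, 0, 0, 0, 0, 1], [0, 0, 0, 0, 0, 0, 0, 1])) (by decide +kernel) (by decide +kernel) (by decide +kernel)

end ExceptionalTypes

end OrbitCurvature

/-! ### The main theorem -/

open OrbitCurvature in
theorem mainTheorem4 {d : ℕ} {K : Type*} [TopologicalSpace K]
    [ChartedSpace (EuclideanSpace ℝ (Fin d)) K] [Group K] [LieGroup (𝓡 d) ∞ K]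
    [CompactSpace K] [ConnectedSpace K] [LieAlgebra.IsSimple ℝ (GroupLieAlgebra (𝓡 d) K)]
    {V : Type*} [NormedAddCommGroup V] [InnerProductSpace ℂ V] [FiniteDimensional ℂ V]
    (ρ : Representation ℂ K V) [ρ.IsIrreducible]
    (hsmooth : ∀ v : V, ContMDiff (𝓡 d) 𝓘(ℝ, V) ∞ (fun k : K => ρ k v))
    (hunitary : ∀ (k : K) (v w : V), inner ℂ (ρ k v) (ρ k w) = inner ℂ v w)
    (𝔱 : LieSubalgebra ℝ (GroupLieAlgebra (𝓡 d) K)) [𝔱.IsCartanSubalgebra]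
    (b : (roots 𝔱).Base) (p : V) (hp : IsHighestWeightVector ρ b p) (hp1 : ‖p‖ = 1) :
    (∀ n : ℕ, HasCartanMatrix b (CartanMatrix.A n) → normII d ρ p ≤ ENNReal.ofReal (2 * √3)) ∧
    (∀ n : ℕ, HasCartanMatrix b (CartanMatrix.B n) → normII d ρ p ≤ ENNReal.ofReal (2 * √6)) ∧
    (∀ n : ℕ, HasCartanMatrix b (CartanMatrix.C n) → normII d ρ p ≤ ENNReal.ofReal (2 * √6)) ∧
    (∀ n : ℕ, HasCartanMatrix b (CartanMatrix.D n) → normII d ρ p ≤ ENNReal.ofReal (2 * √6)) ∧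
    normII d ρ p ≤ ENNReal.ofReal √(cDelta b) ∧
    (HasCartanMatrix b CartanMatrix.G₂ →
      cDelta b = 6 ∧ normII d ρ p ≤ ENNReal.ofReal √6) ∧
    (HasCartanMatrix b CartanMatrix.F₄ →
      cDelta b = 28 ∧ normII d ρ p ≤ ENNReal.ofReal (2 * √7)) ∧
    (HasCartanMatrix b CartanMatrix.E₆ →
      cDelta b = 40 ∧ normII d ρ p ≤ ENNReal.ofReal (2 * √10)) ∧
    (HasCartanMatrix b CartanMatrix.E₇ →
      cDelta b = 64 ∧ normII d ρ p ≤ ENNReal.ofReal 8) ∧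
    (HasCartanMatrix b CartanMatrix.E₈ →
      cDelta b = 112 ∧ normII d ρ p ≤ ENNReal.ofReal (4 * √7)) := by
  have h := fun C hC => normII_le (C := C) hsmooth hunitary hp hp1 hC
  have hc := h _ (isPairBound_cDelta b)
  have hs : ∀ m k : ℝ, 0 ≤ m → √(m ^ 2 * k) = m * √k := fun m k hm => by
    rw [Real.sqrt_mul (sq_nonneg m), Real.sqrt_sq hm]
  have h12 : √(12 : ℝ) = 2 * √3 := by rw [← hs 2 3 (by norm_num)]; norm_num
  have h24 : √(24 : ℝ) = 2 * √6 := by rw [← hs 2 6 (by norm_num)]; norm_num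
  have h28 : √((28 : ℕ) : ℝ) = 2 * √7 := by rw [← hs 2 7 (by norm_num)]; norm_num
  have h40 : √((40 : ℕ) : ℝ) = 2 * √10 := by rw [← hs 2 10 (by norm_num)]; norm_num
  have h64 : √((64 : ℕ) : ℝ) = 8 := by
    rw [← Real.sqrt_sq (show (0 : ℝ) ≤ 8 by norm_num)]; norm_num
  have h112 : √((112 : ℕ) : ℝ) = 4 * √7 := by rw [← hs 4 7 (by norm_num)]; norm_num
  refine ⟨fun n hA => ?_, fun n hB => ?_, fun n hC => ?_, fun n hD => ?_, hc, fun hG => ?_,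
    fun hF => ?_, fun hE => ?_, fun hE => ?_, fun hE => ?_⟩
  · exact h12 ▸ h _ (isPairBound_A hA)
  · exact h24 ▸ h _ (isPairBound_B hB)
  · exact h24 ▸ h _ (isPairBound_C hC)
  · exact h24 ▸ h _ (isPairBound_D hD)
  · have e := cDelta_eq_of_G₂ hG
    exact ⟨e, by rw [e] at hc; exact_mod_cast hc⟩
  · have e := cDelta_eq_of_F₄ hF
    exact ⟨e, by rw [e, h28] at hc; exact hc⟩
  · have e := cDelta_eq_of_E₆ hE
    exact ⟨e, by rw [e, h40] at hc; exact hc⟩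
  · have e := cDelta_eq_of_E₇ hE
    exact ⟨e, by rw [e, h64] at hc; exact hc⟩
  · have e := cDelta_eq_of_E₈ hE
    exact ⟨e, by rw [e, h112] at hc; exact hc⟩
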